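/- Let $N\ge 1$ be an integer, $p>1$, $A>0$, and let $\phi(x):=(1+|x|)^{-A}$ for $x\in\mathbb{R}^N$. For $0<\alpha<1$ consider the Cauchy problem $$\partial_t^\alpha u-\Delta u=u^p\ \text{ in }(0,T)\times\mathbb{R}^N,\qquad u(0)=\mu\ \text{ in }\mathbb{R}^N, \qquad (\ast)$$ where $\partial_t^\alpha$ is the Caputo derivative and $\mu\ge0$ is a Radon measure. Let $G(t,x)=(4\pi t)^{-N/2}e^{-|x|^2/(4t)}$, $e^{t\Delta}\mu(x)=\int G(t,x-y)\,d\mu(y)$, and let $h_\alpha\ge0$ be the probability density on $(0,\infty)$ with $\int_0^\infty h_\alpha(\theta)e^{z\theta}\,d\theta=\sum_{k\ge0}\frac{z^k}{\Gamma(\alpha k+1)}$ for all $z\in\mathbb{C}$; put $P_\alpha(t)=\int_0^\infty h_\alpha(\theta)e^{t^\alpha\theta\Delta}\,d\theta$ and $S_\alpha(t)=\int_0^\infty\theta h_\alpha(\theta)e^{t^\alpha\theta\Delta}\,d\theta$. A solution of $(\ast)$ in $[0,T]\times\mathbb{R}^N$ is a nonnegative measurable function $u$ with $$\infty>u(t,x)=[P_\alpha(t)\mu](x)+\alpha\int_0^t(t-s)^{\alpha-1}[S_\alpha(t-s)u(s)^p](x)\,ds$$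 for almost all $t\in(0,T]$ and $x\in\mathbb{R}^N$; it is the minimal solution if it is $\le$ every solution in $[0,T]\times\mathbb{R}^N$ almost everywhere. The life span $T_\alpha[\mu]$ is the supremum of all $T'>0$ such that the minimal solution exists in $[0,T']\times\mathbb{R}^N$. Functions $f\ge 0$ are identified with the measures $f\,dx$. Theorem. Suppose that $p<p_F:=1+\frac2N$ or $A<\frac{2}{p-1}$. Then there exist $\kappa_0\in(0,1)$, independent of $\alpha$, and $c(\alpha),C(\alpha)>0$ $(0<\alpha<1)$, independent of $\kappa$, with $\liminf_{\alpha\to1-0}c(\alpha)>0$ and $\limsup_{\alpha\to1-0}C(\alpha)<\infty$, such that for all $\alpha\in(0,1)$ and all $\kappa\in(0,\kappa_0)$ $$c(\alpha)\,F_\alpha(\kappa)\le T_\alpha[\kappa\phi]\le C(\alpha)\,F_\alpha(\kappa),$$ where $$F_\alpha(\kappa)=\begin{cases}\kappa^{-\left(\frac{\alpha}{p-1}-\frac{\alpha}{2}\min(A,N)\right)^{-1}}&\text{if }A\ne N,\\[4pt]\left(\dfrac{\kappa^{-1}}{\log\kappa^{-1}}\right)^{\left(\frac{\alpha}{p-1}-\frac{\alpha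 N}{2}\right)^{-1}}&\text{if }A=N.\end{cases}$$ -/

import Mathlib

open MeasureTheory Set Filter Topology
open scoped ENNReal

namespace TimeFractional

noncomputable section

/-- The Zolotarev kernel
`a_α(φ) = sin((1-α)φ) sin(αφ)^{α/(1-α)} / sin(φ)^{1/(1-α)}`, `0 < φ < π`. -/
def zolotarev (α φ : ℝ) : ℝ :=
  Real.sin ((1 - α) * φ) * Real.sin (α * φ) ^ (α / (1 - α)) / Real.sin φ ^ (1 / (1 - α))

/-- The probability density `h_α` on `(0,∞)` (the M-Wright function), written through the
positive integral representation
`h_α(θ) = θ^{α/(1-α)} / (π(1-α)) ∫_0^π a_α(φ) exp(-a_α(φ) θ^{1/(1-α)}) dφ`.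
The theorems `wrightDensity_nonneg` and `integral_wrightDensity_mul_cexp` below show that it is the
nonnegative function with `∫_0^∞ h_α(θ) e^{zθ} dθ = E_{α,1}(z)` for all `z ∈ ℂ`; this identity
determines `h_α` up to null sets. -/
def wrightDensity (α θ : ℝ) : ℝ :=
  1 / (Real.pi * (1 - α)) * θ ^ (α / (1 - α)) *
    ∫ φ in Ioo 0 Real.pi, zolotarev α φ * Real.exp (-zolotarev α φ * θ ^ (1 / (1 - α)))

/-- The Mittag-Leffler function `E_{α,β}(z) = ∑ z^k / Γ(αk + β)`. -/
def mittagLeffler (α β : ℝ) (z : ℂ) : ℂ :=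
  ∑' k : ℕ, z ^ k / (Real.Gamma (α * k + β) : ℂ)

lemma sin_mul_pos {α φ : ℝ} (hα : α ∈ Ioo (0 : ℝ) 1) (hφ : φ ∈ Ioo 0 Real.pi) :
    0 < Real.sin (α * φ) := by
  obtain ⟨h0, h1⟩ := hα
  obtain ⟨p0, p1⟩ := hφ
  exact Real.sin_pos_of_pos_of_lt_pi (by positivity) (by nlinarith)

lemma one_sub_mem {α : ℝ} (hα : α ∈ Ioo (0 : ℝ) 1) : 1 - α ∈ Ioo (0 : ℝ) 1 :=
  ⟨by linarith [hα.2], by linarith [hα.1]⟩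

lemma zolotarev_pos {α φ : ℝ} (hα : α ∈ Ioo (0 : ℝ) 1) (hφ : φ ∈ Ioo 0 Real.pi) :
    0 < zolotarev α φ := by
  have h1 := sin_mul_pos hα hφ
  have h2 := sin_mul_pos (one_sub_mem hα) hφ
  have h3 := Real.sin_pos_of_pos_of_lt_pi hφ.1 hφ.2
  unfold zolotarev; positivity

lemma inv_Gamma_eq (y : ℝ) : (Real.Gamma y)⁻¹ = y * (Real.Gamma (y + 1))⁻¹ := by
  rcases eq_or_ne y 0 with rfl | h
  · simp [Real.Gamma_zero]
  · rw [Real.Gamma_add_one h, mul_inv]; field_simp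

/-- auxiliary: the continuous extension of `sin(πs)/s` -/
def tau (s : ℝ) : ℝ := if s = 0 then Real.pi else Real.sin (s * Real.pi) / s

lemma sum_choose_tau (k : ℕ) (x : ℝ) :
    ∑ j ∈ Finset.range (k + 1), (k.choose j : ℝ) * tau (j - x) =
      Real.pi * k.factorial * ((Real.Gamma (1 + x))⁻¹ * (Real.Gamma (1 + k - x))⁻¹) := by
  induction k generalizing x with
  | zero =>
    rcases eq_or_ne x 0 with rfl | h
    · simp [tau]
    · have := Real.Gamma_mul_Gamma_one_sub x
      have e : (Real.Gamma (1 + x))⁻¹ * (Real.Gamma (1 - x))⁻¹ = 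
          (Real.pi * x)⁻¹ * Real.sin (Real.pi * x) := by
        rw [add_comm, Real.Gamma_add_one h, mul_inv, mul_assoc, ← mul_inv, this]
        field_simp
      simp [tau, h, e, mul_comm x]
      field_simp
  | succ k ih =>
    have key : ∑ j ∈ Finset.range (k + 2), ((k + 1).choose j : ℝ) * tau (j - x) =
      ∑ j ∈ Finset.range (k + 1), (k.choose j : ℝ) * tau (j - x) +
      ∑ j ∈ Finset.range (k + 1), (k.choose j : ℝ) * tau (j - (x - 1)) := by
      rw [Finset.sum_range_succ']
      rw [Finset.sum_range_succ' (fun j => (k.choose j : ℝ) * tau (j - x))]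
      have : ∑ j ∈ Finset.range k, (k.choose (j + 1) : ℝ) * tau ((j + 1 : ℕ) - x)
        = ∑ j ∈ Finset.range (k + 1), (k.choose (j + 1) : ℝ) * tau ((j + 1 : ℕ) - x) := by
        rw [Finset.sum_range_succ]; simp
      rw [this]
      have e2 : ∀ j : ℕ, ((j + 1 : ℕ) : ℝ) - x = j - (x - 1) := fun j => by push_cast; ring
      simp only [Nat.choose_succ_succ', e2]
      push_cast
      simp only [add_mul, Finset.sum_add_distrib]
      simp
      ring
    rw [key, ih, ih]
    have g1 := inv_Gamma_eq (1 + (x - 1))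
    have g2 := inv_Gamma_eq (1 + k - x)
    rw [g1, g2]
    rw [Nat.factorial_succ]
    push_cast
    rw [show 1 + (x - 1) + 1 = 1 + x by ring, show 1 + (k : ℝ) - (x - 1) = 1 + k - x + 1 by ring,
      show 1 + ((k : ℝ) + 1) - x = 1 + k - x + 1 by ring]
    ring

/-- auxiliary: `a_α(φ)^{-(1-α)}` -/
def bfun (α φ : ℝ) : ℝ :=
  Real.sin φ / Real.sin ((1 - α) * φ) *
    (Real.sin (α * φ) / Real.sin ((1 - α) * φ)) ^ (-α)

lemma bfun_eq {α φ : ℝ} (hα : α ∈ Ioo (0 : ℝ) 1) (hφ : φ ∈ Ioo 0 Real.pi) :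
    zolotarev α φ ^ (-(1 - α)) = bfun α φ := by
  have h1 := sin_mul_pos hα hφ
  have h2 := sin_mul_pos (one_sub_mem hα) hφ
  have h3 := Real.sin_pos_of_pos_of_lt_pi hφ.1 hφ.2
  have ha : 1 - α ≠ 0 := by linarith [hα.2]
  unfold zolotarev bfun
  rw [Real.div_rpow (by positivity) (by positivity), Real.mul_rpow (by positivity) (by positivity),
    ← Real.rpow_mul h1.le, ← Real.rpow_mul h3.le, Real.div_rpow h1.le h2.le]
  rw [show α / (1 - α) * -(1 - α) = -α by field_simp,
    show 1 / (1 - α) * -(1 - α) = -1 by field_simp, Real.rpow_neg_one,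
    show -(1 - α) = -1 + α by ring, Real.rpow_add h2, Real.rpow_neg_one, Real.rpow_neg h2.le]
  have := Real.rpow_pos_of_pos h2 α
  field_simp

/-- auxiliary: `sin(αφ)/sin((1-α)φ)`, extended continuously to `φ = 0` -/
def rfun (α φ : ℝ) : ℝ :=
  α / (1 - α) * (Real.sinc (α * φ) / Real.sinc ((1 - α) * φ))

lemma sinc_mul_pos {α φ : ℝ} (hα : α ∈ Ioo (0 : ℝ) 1) (hφ : φ ∈ Icc 0 Real.pi) :
    0 < Real.sinc (α * φ) := by
  rcases eq_or_lt_of_le hφ.1 with h | h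
  · simp [← h]
  · rw [Real.sinc_of_ne_zero (mul_pos hα.1 h).ne']
    refine div_pos (Real.sin_pos_of_pos_of_lt_pi (mul_pos hα.1 h) ?_) (mul_pos hα.1 h)
    nlinarith [hα.2, hφ.2]

lemma rfun_pos {α φ : ℝ} (hα : α ∈ Ioo (0 : ℝ) 1) (hφ : φ ∈ Icc 0 Real.pi) :
    0 < rfun α φ := by
  have h1 := sinc_mul_pos hα hφ
  have h2 := sinc_mul_pos (one_sub_mem hα) hφ
  have := hα.1
  have := (one_sub_mem hα).1
  unfold rfun; positivity

lemma rfun_eq {α φ : ℝ} (hα : α ∈ Ioo (0 : ℝ) 1) (hφ : 0 < φ) :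
    rfun α φ = Real.sin (α * φ) / Real.sin ((1 - α) * φ) := by
  have h1 := hα.1
  have h2 := (one_sub_mem hα).1
  unfold rfun
  rw [Real.sinc_of_ne_zero (by positivity), Real.sinc_of_ne_zero (by positivity)]
  field_simp

lemma rfun_continuousOn {α : ℝ} (hα : α ∈ Ioo (0 : ℝ) 1) :
    ContinuousOn (rfun α) (Icc 0 Real.pi) := by
  unfold rfun
  refine continuousOn_const.mul (ContinuousOn.div ?_ ?_ ?_)
  · exact (Real.continuous_sinc.comp (by fun_prop)).continuousOn
  · exact (Real.continuous_sinc.comp (by fun_prop)).continuousOn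
  · exact fun φ hφ => (sinc_mul_pos (one_sub_mem hα) hφ).ne'

lemma rfun_hasDerivAt {α φ : ℝ} (hα : α ∈ Ioo (0 : ℝ) 1) (hφ : φ ∈ Ioo 0 Real.pi) :
    ∃ r', HasDerivAt (rfun α) r' φ := by
  have h2 := sin_mul_pos (one_sub_mem hα) hφ
  have : DifferentiableAt ℝ (fun φ => Real.sin (α * φ) / Real.sin ((1 - α) * φ)) φ := by
    refine DifferentiableAt.div ?_ ?_ h2.ne' <;> fun_prop
  refine ⟨_, (this.hasDerivAt).congr_of_eventuallyEq ?_⟩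
  filter_upwards [lt_mem_nhds hφ.1] with x hx using rfun_eq hα hx

lemma complex_sum {α φ : ℝ} (k : ℕ) (hα : α ∈ Ioo (0 : ℝ) 1) (hφ : φ ∈ Ioo 0 Real.pi) :
    ∑ j ∈ Finset.range (k + 1), ((k.choose j : ℝ) : ℂ) *
      ((rfun α φ ^ ((j : ℝ) - α * k) : ℝ) : ℂ) * Complex.exp ((((j : ℝ) - α * k) * φ : ℝ) * Complex.I) =
    ((bfun α φ ^ k : ℝ) : ℂ) := by
  have hr := rfun_pos hα (Ioo_subset_Icc_self hφ)
  have h1 := sin_mul_pos hα hφ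
  have h2 := sin_mul_pos (one_sub_mem hα) hφ
  set r := rfun α φ with hrdef
  have hb : bfun α φ = Real.sin φ / Real.sin ((1 - α) * φ) * r ^ (-α) := by
    rw [hrdef, rfun_eq hα hφ.1, bfun]
  have hbase : (1 : ℂ) + (r : ℂ) * Complex.exp (φ * Complex.I) =
      ((Real.sin φ / Real.sin ((1 - α) * φ) : ℝ) : ℂ) * Complex.exp ((α * φ : ℝ) * Complex.I) := by
    have hs : Real.sin φ = Real.sin (α * φ) * Real.cos ((1 - α) * φ) +
        Real.cos (α * φ) * Real.sin ((1 - α) * φ) := by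
      rw [← Real.sin_add]; ring_nf
    have hs3 : Real.sin ((1 - α) * φ) = Real.sin φ * Real.cos (α * φ) - Real.cos φ * Real.sin (α * φ) := by
      rw [← Real.sin_sub]; ring_nf
    rw [hrdef, rfun_eq hα hφ.1]
    rw [Complex.exp_mul_I, Complex.exp_mul_I, ← Complex.ofReal_cos, ← Complex.ofReal_sin,
      ← Complex.ofReal_cos, ← Complex.ofReal_sin]
    apply Complex.ext
    · simp only [Complex.add_re, Complex.one_re, Complex.mul_re, Complex.ofReal_re,
        Complex.ofReal_im, Complex.add_im, Complex.mul_im, Complex.I_re, Complex.I_im]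
      generalize Real.sin ((1 - α) * φ) = S at *
      field_simp
      linear_combination hs3
    · simp only [Complex.add_re, Complex.one_im, Complex.mul_re, Complex.ofReal_re,
        Complex.ofReal_im, Complex.add_im, Complex.mul_im, Complex.I_re, Complex.I_im]
      field_simp
      ring
  have term : ∀ j ∈ Finset.range (k + 1), ((k.choose j : ℝ) : ℂ) *
      ((r ^ ((j : ℝ) - α * k) : ℝ) : ℂ) * Complex.exp ((((j : ℝ) - α * k) * φ : ℝ) * Complex.I) =
      (((r : ℂ) * Complex.exp (φ * Complex.I)) ^ j * 1 ^ (k - j) * (k.choose j : ℂ)) *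
        (((r ^ (-α)) ^ k : ℝ) * Complex.exp (-(k * ((α * φ : ℝ) * Complex.I)))) := by
    intro j _
    have : r ^ ((j : ℝ) - α * k) = r ^ j * (r ^ (-α)) ^ k := by
      rw [sub_eq_add_neg, Real.rpow_add hr, Real.rpow_natCast, ← Real.rpow_natCast (r ^ (-α)),
        ← Real.rpow_mul hr.le]; ring_nf
    have he : Complex.exp ((((j : ℝ) - α * k) * φ : ℝ) * Complex.I) =
        Complex.exp (φ * Complex.I) ^ j * Complex.exp (-(k * ((α * φ : ℝ) * Complex.I))) := by
      rw [← Complex.exp_nat_mul, ← Complex.exp_add]; congr 1; push_cast; ring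
    rw [this, he]; push_cast; ring
  rw [Finset.sum_congr rfl term, ← Finset.sum_mul, ← add_pow, add_comm, hbase, mul_pow,
    ← Complex.exp_nat_mul, hb]
  have : Complex.exp (k * ((α * φ : ℝ) * Complex.I)) * Complex.exp (-(k * ((α * φ : ℝ) * Complex.I))) = 1 := by
    rw [← Complex.exp_add]; simp
  push_cast at this ⊢
  linear_combination (((Complex.sin φ / Complex.sin ((1 - α) * φ)) ^ k) * ((r ^ (-α) : ℝ) : ℂ) ^ k) * this

lemma sum_cos {α φ : ℝ} (k : ℕ) (hα : α ∈ Ioo (0 : ℝ) 1) (hφ : φ ∈ Ioo 0 Real.pi) :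
    ∑ j ∈ Finset.range (k + 1), (k.choose j : ℝ) *
      rfun α φ ^ ((j : ℝ) - α * k) * Real.cos (((j : ℝ) - α * k) * φ) = bfun α φ ^ k := by
  have := congrArg Complex.re (complex_sum k hα hφ)
  rw [Complex.re_sum, Complex.ofReal_re] at this
  rw [← this]
  refine Finset.sum_congr rfl fun j _ => ?_
  rw [← Complex.ofReal_mul, Complex.re_ofReal_mul, Complex.exp_ofReal_mul_I_re]

lemma sum_sin {α φ : ℝ} (k : ℕ) (hα : α ∈ Ioo (0 : ℝ) 1) (hφ : φ ∈ Ioo 0 Real.pi) :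
    ∑ j ∈ Finset.range (k + 1), (k.choose j : ℝ) *
      rfun α φ ^ ((j : ℝ) - α * k) * Real.sin (((j : ℝ) - α * k) * φ) = 0 := by
  have := congrArg Complex.im (complex_sum k hα hφ)
  rw [Complex.im_sum, Complex.ofReal_im] at this
  rw [← this]
  refine Finset.sum_congr rfl fun j _ => ?_
  rw [← Complex.ofReal_mul, Complex.im_ofReal_mul, Complex.exp_ofReal_mul_I_im]

/-- auxiliary primitive -/
def prim (α s φ : ℝ) : ℝ := if s = 0 then φ else rfun α φ ^ s * Real.sin (s * φ) / s

lemma prim_continuousOn {α : ℝ} (s : ℝ) (hα : α ∈ Ioo (0 : ℝ) 1) :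
    ContinuousOn (prim α s) (Icc 0 Real.pi) := by
  unfold prim
  split_ifs
  · exact continuousOn_id
  · refine ContinuousOn.div_const (ContinuousOn.mul ?_ (by fun_prop)) _
    exact (rfun_continuousOn hα).rpow_const fun φ hφ => Or.inl (rfun_pos hα hφ).ne'

lemma prim_hasDerivAt {α φ r' : ℝ} (s : ℝ) (hα : α ∈ Ioo (0 : ℝ) 1) (hφ : φ ∈ Ioo 0 Real.pi)
    (hr' : HasDerivAt (rfun α) r' φ) :
    HasDerivAt (prim α s) (rfun α φ ^ s * Real.cos (s * φ) +
      r' / rfun α φ * (rfun α φ ^ s * Real.sin (s * φ))) φ := by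
  have hr := rfun_pos hα (Ioo_subset_Icc_self hφ)
  unfold prim
  split_ifs with h
  · subst h; simpa using hasDerivAt_id' φ
  · have h1 := hr'.rpow_const (p := s) (Or.inl hr.ne')
    have h2 : HasDerivAt (fun x => Real.sin (s * x)) (Real.cos (s * φ) * s) φ := by
      simpa using ((hasDerivAt_id φ).const_mul s).sin
    convert! (h1.mul h2).div_const s using 1
    rw [Real.rpow_sub_one hr.ne']
    field_simp
    ring

lemma integral_bfun_pow {α : ℝ} (k : ℕ) (hα : α ∈ Ioo (0 : ℝ) 1) :
    IntegrableOn (fun φ => bfun α φ ^ k) (Ioo 0 Real.pi) ∧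
    ∫ φ in Ioo 0 Real.pi, bfun α φ ^ k =
      Real.pi * k.factorial * ((Real.Gamma (1 + α * k))⁻¹ * (Real.Gamma (1 + k - α * k))⁻¹) := by
  have hπ := Real.pi_pos
  set D : ℝ → ℝ := fun φ => ∑ j ∈ Finset.range (k + 1), (k.choose j : ℝ) *
      rfun α φ ^ ((j : ℝ) - α * k) * Real.cos (((j : ℝ) - α * k) * φ) with hD
  have hDc : ContinuousOn D (Icc 0 Real.pi) := by
    refine continuousOn_finsetSum _ fun j _ => ?_
    refine ContinuousOn.mul (continuousOn_const.mul ?_) (by fun_prop)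
    exact (rfun_continuousOn hα).rpow_const fun φ hφ => Or.inl (rfun_pos hα hφ).ne'
  have hDi : IntegrableOn D (Ioo 0 Real.pi) :=
    (hDc.integrableOn_Icc).mono_set Ioo_subset_Icc_self
  have hEq : EqOn D (fun φ => bfun α φ ^ k) (Ioo 0 Real.pi) := fun φ hφ => sum_cos k hα hφ
  refine ⟨hDi.congr_fun hEq measurableSet_Ioo, ?_⟩
  rw [← setIntegral_congr_fun measurableSet_Ioo hEq, ← integral_Ioc_eq_integral_Ioo,
    ← intervalIntegral.integral_of_le hπ.le]
  rw [intervalIntegral.integral_eq_sub_of_hasDerivAt_of_le hπ.le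
    (f := fun φ => ∑ j ∈ Finset.range (k + 1), (k.choose j : ℝ) * prim α ((j : ℝ) - α * k) φ)]
  · have : rfun α Real.pi = 1 := by
      rw [rfun_eq hα hπ]
      have := sinc_mul_pos hα ⟨hπ.le, le_refl _⟩
      rw [Real.sinc_of_ne_zero (mul_pos hα.1 hπ).ne'] at this
      rw [show (1 - α) * Real.pi = Real.pi - α * Real.pi by ring, Real.sin_pi_sub, div_self]
      intro h; simp [h] at this
    rw [← sum_choose_tau, ← Finset.sum_sub_distrib]
    refine Finset.sum_congr rfl fun j _ => ?_
    rw [← mul_sub]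
    congr 1
    unfold prim tau
    rw [this]
    split_ifs <;> simp
  · exact continuousOn_finsetSum _ fun j _ => continuousOn_const.mul (prim_continuousOn _ hα)
  · intro φ hφ
    obtain ⟨r', hr'⟩ := rfun_hasDerivAt hα hφ
    have := HasDerivAt.fun_sum (u := Finset.range (k + 1)) fun j _ =>
      (prim_hasDerivAt ((j : ℝ) - α * k) hα hφ hr').const_mul (k.choose j : ℝ)
    convert! this using 1
    have h0 := sum_sin k hα hφ
    simp only [mul_add, Finset.sum_add_distrib, hD, ← mul_assoc]
    simp only [mul_comm _ (r' / rfun α φ), mul_assoc] at h0 ⊢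
    rw [← Finset.mul_sum, h0]; simp
  · rw [intervalIntegrable_iff_integrableOn_Icc_of_le hπ.le]
    exact hDc.integrableOn_Icc

/-- the integrand of the moment of order `k`, as a function of both variables -/
def jointDensity (α : ℝ) (k : ℕ) (z : ℝ × ℝ) : ℝ :=
  z.1 ^ k * (1 / (Real.pi * (1 - α)) * z.1 ^ (α / (1 - α)) *
    (zolotarev α z.2 * Real.exp (-zolotarev α z.2 * z.1 ^ (1 / (1 - α)))))

lemma integral_jointDensity_left {α φ : ℝ} (k : ℕ) (hα : α ∈ Ioo (0 : ℝ) 1)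
    (hφ : φ ∈ Ioo 0 Real.pi) :
    IntegrableOn (fun θ => jointDensity α k (θ, φ)) (Ioi 0) ∧
    ∫ θ in Ioi 0, jointDensity α k (θ, φ) =
      Real.Gamma (1 + k - α * k) / Real.pi * bfun α φ ^ k := by
  have ha := (one_sub_mem hα).1
  have hz := zolotarev_pos hα hφ
  have hq : 0 < 1 / (1 - α) := by positivity
  have hs : -1 < (k : ℝ) + α / (1 - α) := by
    have := div_pos hα.1 ha
    have : (0 : ℝ) ≤ k := Nat.cast_nonneg k
    linarith
  have hEq : EqOn (fun θ => zolotarev α φ / (Real.pi * (1 - α)) *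
      (θ ^ ((k : ℝ) + α / (1 - α)) * Real.exp (-zolotarev α φ * θ ^ (1 / (1 - α)))))
      (fun θ => jointDensity α k (θ, φ)) (Ioi 0) := by
    intro θ hθ
    simp only [jointDensity]
    rw [Real.rpow_add hθ, Real.rpow_natCast]
    ring
  constructor
  · exact IntegrableOn.congr_fun
      ((integrableOn_rpow_mul_exp_neg_mul_rpow hs hq hz).const_mul _) hEq measurableSet_Ioi
  · rw [← setIntegral_congr_fun measurableSet_Ioi hEq, integral_const_mul,
      integral_rpow_mul_exp_neg_mul_rpow hq hs hz, ← bfun_eq hα hφ, ← Real.rpow_natCast,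
      ← Real.rpow_mul hz.le]
    have e1 : ((k : ℝ) + α / (1 - α) + 1) / (1 / (1 - α)) = 1 + k - α * k := by
      field_simp; ring
    have e2 : -((k : ℝ) + α / (1 - α) + 1) / (1 / (1 - α)) = -(1 - α) * k - 1 := by
      field_simp; ring
    rw [e1, e2, Real.rpow_sub_one hz.ne']
    field_simp

lemma measurable_zolotarev (α : ℝ) : Measurable (zolotarev α) := by
  unfold zolotarev; fun_prop

lemma measurable_jointDensity (α : ℝ) (k : ℕ) : Measurable (jointDensity α k) := by
  have := measurable_zolotarev α
  unfold jointDensity; fun_prop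

lemma jointDensity_nonneg {α θ φ : ℝ} (k : ℕ) (hα : α ∈ Ioo (0 : ℝ) 1)
    (hφ : φ ∈ Ioo 0 Real.pi) (hθ : 0 < θ) : 0 ≤ jointDensity α k (θ, φ) := by
  have ha := (one_sub_mem hα).1
  have hz := zolotarev_pos hα hφ
  simp only [jointDensity]
  positivity

lemma jointDensity_integrable {α : ℝ} (k : ℕ) (hα : α ∈ Ioo (0 : ℝ) 1) :
    Integrable (jointDensity α k)
      ((volume.restrict (Ioi 0)).prod (volume.restrict (Ioo 0 Real.pi))) := by
  rw [integrable_prod_iff' (measurable_jointDensity α k).aestronglyMeasurable]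
  constructor
  · filter_upwards [ae_restrict_mem measurableSet_Ioo] with φ hφ
    exact (integral_jointDensity_left k hα hφ).1
  · refine IntegrableOn.congr_fun ((integral_bfun_pow k hα).1.const_mul
      (Real.Gamma (1 + k - α * k) / Real.pi)) ?_ measurableSet_Ioo
    intro φ hφ
    beta_reduce
    rw [← (integral_jointDensity_left k hα hφ).2]
    refine setIntegral_congr_fun measurableSet_Ioi fun θ hθ => ?_
    exact (Real.norm_of_nonneg (jointDensity_nonneg k hα hφ hθ)).symm

lemma pow_mul_wrightDensity (α θ : ℝ) (k : ℕ) :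
    θ ^ k * wrightDensity α θ = ∫ φ in Ioo 0 Real.pi, jointDensity α k (θ, φ) := by
  simp only [wrightDensity, jointDensity]
  rw [integral_const_mul, integral_const_mul]

/-- `∫_0^∞ θ^k h_α(θ) dθ = k! / Γ(1 + αk)`; for `k = 0`, the total mass is one. -/
theorem wrightDensity_moment {α : ℝ} (hα : α ∈ Ioo (0 : ℝ) 1) (k : ℕ) :
    IntegrableOn (fun θ => θ ^ k * wrightDensity α θ) (Ioi 0) ∧
    ∫ θ in Ioi 0, θ ^ k * wrightDensity α θ = k.factorial / Real.Gamma (1 + α * k) := by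
  have hi := jointDensity_integrable k hα
  simp only [pow_mul_wrightDensity]
  refine ⟨hi.integral_prod_left, ?_⟩
  rw [integral_integral_swap (f := fun θ φ => jointDensity α k (θ, φ)) hi,
    setIntegral_congr_fun measurableSet_Ioo
      (fun φ hφ => (integral_jointDensity_left k hα hφ).2), integral_const_mul,
    (integral_bfun_pow k hα).2]
  have hG : Real.Gamma (1 + k - α * k) ≠ 0 := by
    refine (Real.Gamma_pos_of_pos ?_).ne'
    have := mul_nonneg (Nat.cast_nonneg (α := ℝ) k) (one_sub_mem hα).1.le
    linarith
  have := Real.pi_pos.ne'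
  generalize Real.Gamma (1 + k - α * k) = X at *
  field_simp

theorem wrightDensity_nonneg {α θ : ℝ} (hα : α ∈ Ioo (0 : ℝ) 1) (hθ : 0 < θ) :
    0 ≤ wrightDensity α θ := by
  have := pow_mul_wrightDensity α θ 0
  rw [pow_zero, one_mul] at this
  rw [this]
  exact setIntegral_nonneg measurableSet_Ioo fun φ hφ => jointDensity_nonneg 0 hα hφ hθ

lemma Gamma_lower {s R : ℝ} (hs : 0 ≤ s) (hR : 0 ≤ R) :
    R ^ s * Real.exp (-R) ≤ Real.Gamma (1 + s) := by
  rw [Real.Gamma_eq_integral (by linarith), show 1 + s - 1 = s by ring,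
    ← integral_exp_neg_Ioi, ← integral_const_mul]
  have hI := Real.GammaIntegral_convergent (s := 1 + s) (by linarith)
  rw [show 1 + s - 1 = s by ring] at hI
  refine (setIntegral_mono_on ?_ (hI.mono_set (Ioi_subset_Ioi hR)) measurableSet_Ioi ?_).trans
    (setIntegral_mono_set hI ?_ (Ioi_subset_Ioi hR).eventuallyLE)
  · exact (integrableOn_exp_neg_Ioi R).const_mul _
  · intro x hx
    rw [mul_comm]
    exact mul_le_mul_of_nonneg_left (Real.rpow_le_rpow hR (le_of_lt hx) hs) (Real.exp_pos _).le
  · filter_upwards [ae_restrict_mem measurableSet_Ioi] with x hx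
    have : (0 : ℝ) < x := hx
    simp only [Pi.zero_apply]; positivity

lemma summable_mittagLeffler {α : ℝ} (hα : 0 < α) (y : ℝ) (hy : 0 ≤ y) :
    Summable fun k : ℕ => y ^ k / Real.Gamma (1 + α * k) := by
  set R : ℝ := (2 * y + 1) ^ (1 / α) with hR
  have hR0 : 0 ≤ R := by positivity
  have hgeo : Summable fun k : ℕ => Real.exp R * (1 / 2 : ℝ) ^ k :=
    (summable_geometric_of_lt_one (by norm_num) (by norm_num)).mul_left _
  refine Summable.of_nonneg_of_le (fun k => ?_) (fun k => ?_) hgeo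
  · have := Real.Gamma_pos_of_pos (s := 1 + α * k) (by positivity)
    positivity
  · have hG := Real.Gamma_pos_of_pos (s := 1 + α * k) (by positivity)
    have hl := Gamma_lower (s := α * k) (R := R) (by positivity) hR0
    have hRk : R ^ (α * k) = (2 * y + 1) ^ k := by
      rw [hR, ← Real.rpow_mul (by positivity), ← Real.rpow_natCast]
      congr 1; field_simp
    rw [hRk] at hl
    rw [div_le_iff₀ hG]
    have h1 : y ^ k ≤ (1 / 2 : ℝ) ^ k * (2 * y + 1) ^ k := by
      rw [← mul_pow]; exact pow_le_pow_left₀ hy (by linarith) k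
    calc y ^ k ≤ (1 / 2 : ℝ) ^ k * (2 * y + 1) ^ k := h1
      _ = Real.exp R * (1 / 2 : ℝ) ^ k * ((2 * y + 1) ^ k * Real.exp (-R)) := by
        rw [Real.exp_neg]; field_simp
      _ ≤ _ := by gcongr

/-- The identity that characterizes `h_α`. -/
theorem integral_wrightDensity_mul_cexp {α : ℝ} (hα : α ∈ Ioo (0 : ℝ) 1) (z : ℂ) :
    ∫ θ in Ioi 0, (wrightDensity α θ : ℂ) * Complex.exp (z * θ) = mittagLeffler α 1 z := by
  set F : ℕ → ℝ → ℂ := fun k θ =>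
    (z ^ k / (k.factorial : ℂ)) * ((θ ^ k * wrightDensity α θ : ℝ) : ℂ) with hF
  have hFi : ∀ k, Integrable (F k) (volume.restrict (Ioi 0)) := fun k =>
    ((wrightDensity_moment hα k).1.ofReal).const_mul _
  have hFn : ∀ k, ∫ θ in Ioi 0, ‖F k θ‖ = ‖z‖ ^ k / Real.Gamma (1 + α * k) := by
    intro k
    have : EqOn (fun θ => ‖F k θ‖)
        (fun θ => (‖z‖ ^ k / k.factorial) * (θ ^ k * wrightDensity α θ)) (Ioi 0) := by
      intro θ hθ
      have h0 : (0 : ℝ) < θ := hθ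
      have h1 := wrightDensity_nonneg hα h0
      simp only [hF, norm_mul, norm_div, norm_pow, Complex.norm_real, Complex.norm_natCast,
        Real.norm_of_nonneg h0.le, Real.norm_of_nonneg h1]
    rw [setIntegral_congr_fun measurableSet_Ioi this, integral_const_mul,
      (wrightDensity_moment hα k).2]
    have := Nat.cast_ne_zero (R := ℝ).2 k.factorial_ne_zero
    field_simp
  have hsum := hasSum_integral_of_summable_integral_norm hFi
    (by simpa only [hFn] using summable_mittagLeffler hα.1 ‖z‖ (norm_nonneg z))
  have hpt : ∀ θ : ℝ, ∑' k, F k θ = (wrightDensity α θ : ℂ) * Complex.exp (z * θ) := by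
    intro θ
    have := (NormedSpace.expSeries_div_hasSum_exp (z * θ : ℂ)).mul_left (wrightDensity α θ : ℂ)
    rw [← Complex.exp_eq_exp_ℂ] at this
    rw [← this.tsum_eq]
    refine tsum_congr fun k => ?_
    simp only [hF]; push_cast; ring
  simp only [hpt] at hsum
  rw [← hsum.tsum_eq, mittagLeffler]
  refine tsum_congr fun k => ?_
  simp only [hF]
  rw [integral_const_mul, integral_complex_ofReal, (wrightDensity_moment hα k).2, add_comm (α * (k : ℝ)) 1]
  have := Nat.cast_ne_zero (R := ℂ).2 k.factorial_ne_zero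
  push_cast
  field_simp

/-- The Gauss kernel `G(t,x) = (4πt)^{-N/2} exp(-|x|²/(4t))` on `ℝ^N`. -/
def heatKernel {N : ℕ} (t : ℝ) (x : EuclideanSpace ℝ (Fin N)) : ℝ :=
  1 / (4 * Real.pi * t) ^ ((N : ℝ) / 2) * Real.exp (-‖x‖ ^ 2 / (4 * t))

/-- `(e^{tΔ} μ)(x) = ∫ G(t, x - y) dμ(y)`, with values in `[0,∞]`. -/
def heat {N : ℕ} (t : ℝ) (μ : Measure (EuclideanSpace ℝ (Fin N)))
    (x : EuclideanSpace ℝ (Fin N)) : ℝ≥0∞ :=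
  ∫⁻ y, ENNReal.ofReal (heatKernel t (x - y)) ∂μ

/-- `P_α(t) μ = ∫_0^∞ h_α(θ) e^{t^α θ Δ} μ dθ`. -/
def opP {N : ℕ} (α t : ℝ) (μ : Measure (EuclideanSpace ℝ (Fin N)))
    (x : EuclideanSpace ℝ (Fin N)) : ℝ≥0∞ :=
  ∫⁻ θ in Ioi (0 : ℝ), ENNReal.ofReal (wrightDensity α θ) * heat (t ^ α * θ) μ x

/-- `S_α(t) μ = ∫_0^∞ θ h_α(θ) e^{t^α θ Δ} μ dθ`. -/
def opS {N : ℕ} (α t : ℝ) (μ : Measure (EuclideanSpace ℝ (Fin N)))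
    (x : EuclideanSpace ℝ (Fin N)) : ℝ≥0∞ :=
  ∫⁻ θ in Ioi (0 : ℝ), ENNReal.ofReal (θ * wrightDensity α θ) * heat (t ^ α * θ) μ x

/-- `u` is a solution in `[0,T] × ℝ^N` of `∂_t^α u - Δu = u^p`, `u(0) = μ`: a nonnegative measurable
function such that, for almost all `(t,x) ∈ (0,T] × ℝ^N`,
`∞ > u(t,x) = [P_α(t)μ](x) + α ∫_0^t (t-s)^{α-1} [S_α(t-s) u(s)^p](x) ds`.
A nonnegative function `f` is identified with the measure `f dx`. Only the values of `u` on
`(0,T] × ℝ^N` matter. -/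
def IsSolution {N : ℕ} (α p T : ℝ) (μ : Measure (EuclideanSpace ℝ (Fin N)))
    (u : ℝ × EuclideanSpace ℝ (Fin N) → ℝ≥0∞) : Prop :=
  Measurable u ∧
  ∀ᵐ z ∂(volume.restrict (Ioc (0 : ℝ) T ×ˢ (univ : Set (EuclideanSpace ℝ (Fin N))))),
    u z < ∞ ∧
    u z = opP α z.1 μ z.2 + ENNReal.ofReal α *
      ∫⁻ s in Ioo (0 : ℝ) z.1, ENNReal.ofReal ((z.1 - s) ^ (α - 1)) *
        opS α (z.1 - s) (volume.withDensity fun y => u (s, y) ^ p) z.2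

/-- The minimal solution in `[0,T] × ℝ^N`: a solution below every other one almost everywhere. -/
def IsMinimalSolution {N : ℕ} (α p T : ℝ) (μ : Measure (EuclideanSpace ℝ (Fin N)))
    (u : ℝ × EuclideanSpace ℝ (Fin N) → ℝ≥0∞) : Prop :=
  IsSolution α p T μ u ∧
  ∀ v, IsSolution α p T μ v →
    ∀ᵐ z ∂(volume.restrict (Ioc (0 : ℝ) T ×ˢ (univ : Set (EuclideanSpace ℝ (Fin N))))), u z ≤ v z

/-- The life span
`T_α[μ] = sup {T' > 0 : the minimal solution exists in [0,T'] × ℝ^N} ∈ [0,∞]`. -/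
def lifespan {N : ℕ} (α p : ℝ) (μ : Measure (EuclideanSpace ℝ (Fin N))) : ℝ≥0∞ :=
  sSup {τ | ∃ T' : ℝ, 0 < T' ∧ τ = ENNReal.ofReal T' ∧ ∃ u, IsMinimalSolution α p T' μ u}

/-- The initial value `κφ` with `φ(x) = (1+|x|)^{-A}`, as a measure on `ℝ^N`. -/
def decayData (N : ℕ) (A κ : ℝ) : Measure (EuclideanSpace ℝ (Fin N)) :=
  volume.withDensity fun x => ENNReal.ofReal (κ * (1 + ‖x‖) ^ (-A))

/-- `T(α,κ) ≃ F(α,κ)` for all sufficiently small `κ > 0`: there are `c(α), C(α) > 0`, bounded away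
from `0` and `∞` as `α → 1-0`, such that `c(α) F(α,κ) ≤ T(α,κ) ≤ C(α) F(α,κ)`
for all `α ∈ (0,1)` and `κ ∈ (0,κ₀)`, with `κ₀` independent of `α`. -/
def SimeqSmall (T : ℝ → ℝ → ℝ≥0∞) (F : ℝ → ℝ → ℝ) : Prop :=
  ∃ κ₀ ∈ Ioo (0 : ℝ) 1, ∃ c C : ℝ → ℝ,
    (∀ α ∈ Ioo (0 : ℝ) 1, 0 < c α ∧ 0 < C α) ∧
    (∃ m M : ℝ, 0 < m ∧ ∀ᶠ α in 𝓝[<] (1 : ℝ), m ≤ c α ∧ C α ≤ M) ∧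
    ∀ α ∈ Ioo (0 : ℝ) 1, ∀ κ ∈ Ioo (0 : ℝ) κ₀,
      ENNReal.ofReal (c α * F α κ) ≤ T α κ ∧ T α κ ≤ ENNReal.ofReal (C α * F α κ)

end

end TimeFractional

/-!
The lower bound for the life span comes from subordination. If the heat flow of `μ` decays like
`τ^(-a/2)`, then `exp((τ/τ₀)^γ) e^{τΔ}μ` with `γ = 1 - (p-1)a/2` is a supersolution of the heat
equation with source `u^p` up to times of order `τ₀`. Averaging it over `τ = t^α θ` with weight
`h_α(θ)` gives a supersolution of the time-fractional equation on `(0, τ₀^{1/α}]`. Two facts make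
this work. The fractional Duhamel integral of an averaged family is the average of the ordinary
Duhamel integrals, because two measures on the quadrant agree: both have exponential moments and the
mixed moments `j! k! / Γ(1 + α(j+k+1))`. The nonlinearity passes through the average by Hölder's
inequality. Monotone iteration below the supersolution then yields the minimal solution.

For the upper bound, consider a solution on the parabolic cylinder `|x| ≤ R`, `t ≤ T` with
`T^α = R²`. A lower bound for `u` there, fed back into the Duhamel term, improves on a shorter time
interval; if `κ m R^{2/(p-1)-N}` is large, `m` being the mass of `φ` in the ball of radius `R`, the
improvements multiply and `u` is infinite before `T`. The constants stay bounded as `α → 1` because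
they only involve moments of `h_α`.
-/

namespace TimeFractional

noncomputable section

/-! ### Moments of the Wright density -/

/-- The probability law `h_α(θ) dθ` on `(0,∞)`: `P_α(t)` averages the heat semigroup over it. -/
def wrightMeasure (α : ℝ) : Measure ℝ :=
  (volume.restrict (Ioi 0)).withDensity fun θ => ENNReal.ofReal (wrightDensity α θ)

/-- The measure `θ h_α(θ) dθ` on `(0,∞)`: `S_α(t)` averages the heat semigroup over it. -/
def biasedWrightMeasure (α : ℝ) : Measure ℝ :=
  (wrightMeasure α).withDensity fun θ => ENNReal.ofReal θ

instance (α : ℝ) : SigmaFinite (wrightMeasure α) := SigmaFinite.withDensity_ofReal _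

instance (α : ℝ) : SigmaFinite (biasedWrightMeasure α) := SigmaFinite.withDensity_ofReal _

theorem measurable_wrightDensity (α : ℝ) : Measurable (wrightDensity α) := by
  have h_eq : wrightDensity α = fun θ => ∫ φ in Ioo 0 Real.pi, jointDensity α 0 (θ, φ) := by
    funext θ
    rw [← pow_mul_wrightDensity, pow_zero, one_mul]
  rw [h_eq]
  exact ((measurable_jointDensity α 0).stronglyMeasurable.integral_prod_right'
    (ν := volume.restrict (Ioo 0 Real.pi))).measurable

theorem lintegral_wrightMeasure (α : ℝ) (f : ℝ → ℝ≥0∞) :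
    ∫⁻ θ, f θ ∂wrightMeasure α =
      ∫⁻ θ in Ioi (0 : ℝ), ENNReal.ofReal (wrightDensity α θ) * f θ := by
  rw [wrightMeasure, lintegral_withDensity_eq_lintegral_mul_non_measurable _
    (measurable_wrightDensity α).ennreal_ofReal (ae_of_all _ fun _ => ENNReal.ofReal_lt_top)]
  rfl

theorem lintegral_biasedWrightMeasure (α : ℝ) (f : ℝ → ℝ≥0∞) :
    ∫⁻ θ, f θ ∂biasedWrightMeasure α = ∫⁻ θ, ENNReal.ofReal θ * f θ ∂wrightMeasure α := by
  rw [biasedWrightMeasure, lintegral_withDensity_eq_lintegral_mul_non_measurable _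
    ENNReal.measurable_ofReal (ae_of_all _ fun _ => ENNReal.ofReal_lt_top)]
  rfl

theorem ae_pos_wrightMeasure (α : ℝ) : ∀ᵐ θ ∂wrightMeasure α, 0 < θ :=
  (withDensity_absolutelyContinuous _ _).ae_le (ae_restrict_mem measurableSet_Ioi)

theorem ae_pos_biasedWrightMeasure (α : ℝ) : ∀ᵐ θ ∂biasedWrightMeasure α, 0 < θ :=
  (withDensity_absolutelyContinuous _ _).ae_le (ae_pos_wrightMeasure α)

theorem opP_eq_lintegral {N : ℕ} (α t : ℝ) (μ : Measure (EuclideanSpace ℝ (Fin N)))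
    (x : EuclideanSpace ℝ (Fin N)) :
    opP α t μ x = ∫⁻ θ, heat (t ^ α * θ) μ x ∂wrightMeasure α := by
  rw [lintegral_wrightMeasure, opP]

theorem opS_eq_lintegral {N : ℕ} (α t : ℝ) (μ : Measure (EuclideanSpace ℝ (Fin N)))
    (x : EuclideanSpace ℝ (Fin N)) :
    opS α t μ x = ∫⁻ θ, heat (t ^ α * θ) μ x ∂biasedWrightMeasure α := by
  rw [lintegral_biasedWrightMeasure, lintegral_wrightMeasure, opS]
  refine setLIntegral_congr_fun measurableSet_Ioi fun θ hθ => ?_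
  rw [mul_comm θ, ENNReal.ofReal_mul' (le_of_lt hθ), mul_assoc]

theorem lintegral_pow_wrightMeasure {α : ℝ} (hα : α ∈ Ioo (0 : ℝ) 1) (k : ℕ) :
    ∫⁻ θ, ENNReal.ofReal (θ ^ k) ∂wrightMeasure α =
      ENNReal.ofReal (k.factorial / Real.Gamma (1 + α * k)) := by
  rw [lintegral_wrightMeasure, ← (wrightDensity_moment hα k).2,
    ofReal_integral_eq_lintegral_ofReal (wrightDensity_moment hα k).1]
  · refine setLIntegral_congr_fun measurableSet_Ioi fun θ hθ => ?_
    rw [ENNReal.ofReal_mul (pow_nonneg (le_of_lt hθ) k), mul_comm]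
  · filter_upwards [ae_restrict_mem measurableSet_Ioi] with θ hθ
    exact mul_nonneg (pow_nonneg (le_of_lt hθ) k) (wrightDensity_nonneg hα hθ)

theorem lintegral_pow_biasedWrightMeasure {α : ℝ} (hα : α ∈ Ioo (0 : ℝ) 1) (k : ℕ) :
    ∫⁻ θ, ENNReal.ofReal (θ ^ k) ∂biasedWrightMeasure α =
      ENNReal.ofReal ((k + 1).factorial / Real.Gamma (1 + α * (k + 1))) := by
  rw [lintegral_biasedWrightMeasure, ← Nat.cast_succ, ← lintegral_pow_wrightMeasure hα (k + 1)]
  refine lintegral_congr_ae ?_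
  filter_upwards [ae_pos_wrightMeasure α] with θ hθ
  rw [← ENNReal.ofReal_mul hθ.le, pow_succ']

theorem wrightMeasure_univ {α : ℝ} (hα : α ∈ Ioo (0 : ℝ) 1) : wrightMeasure α univ = 1 := by
  simpa using lintegral_pow_wrightMeasure hα 0

theorem biasedWrightMeasure_univ {α : ℝ} (hα : α ∈ Ioo (0 : ℝ) 1) :
    biasedWrightMeasure α univ = ENNReal.ofReal (1 / Real.Gamma (1 + α)) := by
  simpa using lintegral_pow_biasedWrightMeasure hα 0

theorem integral_pow_eq_of_lintegral_eq {μ : Measure ℝ} (hμ : ∀ᵐ θ ∂μ, 0 < θ) {k : ℕ} {m : ℝ}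
    (hm : 0 ≤ m) (h : ∫⁻ θ, ENNReal.ofReal (θ ^ k) ∂μ = ENNReal.ofReal m) :
    ∫ θ, θ ^ k ∂μ = m := by
  rw [integral_eq_lintegral_of_nonneg_ae
      (hμ.mono fun θ hθ => by simp only [Pi.zero_apply]; positivity)
    (by fun_prop), h, ENNReal.toReal_ofReal hm]

theorem factorial_div_Gamma_nonneg {α : ℝ} (hα : 0 < α) (k : ℕ) :
    0 ≤ (k.factorial : ℝ) / Real.Gamma (1 + α * k) :=
  div_nonneg k.factorial.cast_nonneg (Real.Gamma_nonneg_of_nonneg (by positivity))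

theorem integral_pow_wrightMeasure {α : ℝ} (hα : α ∈ Ioo (0 : ℝ) 1) (k : ℕ) :
    ∫ θ, θ ^ k ∂wrightMeasure α = k.factorial / Real.Gamma (1 + α * k) :=
  integral_pow_eq_of_lintegral_eq (ae_pos_wrightMeasure α)
    (factorial_div_Gamma_nonneg hα.1 k) (lintegral_pow_wrightMeasure hα k)

theorem integral_pow_biasedWrightMeasure {α : ℝ} (hα : α ∈ Ioo (0 : ℝ) 1) (k : ℕ) :
    ∫ θ, θ ^ k ∂biasedWrightMeasure α = (k + 1).factorial / Real.Gamma (1 + α * (k + 1)) :=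
  integral_pow_eq_of_lintegral_eq (ae_pos_biasedWrightMeasure α)
    (mod_cast factorial_div_Gamma_nonneg hα.1 (k + 1))
    (lintegral_pow_biasedWrightMeasure hα k)

theorem Gamma_one_add_le_one {s : ℝ} (hs : s ∈ Icc (0 : ℝ) 1) : Real.Gamma (1 + s) ≤ 1 := by
  have h_convex := Real.convexOn_Gamma.2 (mem_Ioi.2 one_pos) (mem_Ioi.2 two_pos)
    (sub_nonneg.2 hs.2) hs.1 (sub_add_cancel 1 s)
  simp only [smul_eq_mul, Real.Gamma_one, Real.Gamma_two] at h_convex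
  calc Real.Gamma (1 + s) = Real.Gamma ((1 - s) * 1 + s * 2) := by ring_nf
    _ ≤ (1 - s) * 1 + s * 1 := h_convex
    _ = 1 := by ring

theorem one_le_biasedWrightMeasure_univ {α : ℝ} (hα : α ∈ Ioo (0 : ℝ) 1) :
    1 ≤ biasedWrightMeasure α univ := by
  rw [biasedWrightMeasure_univ hα, ENNReal.one_le_ofReal,
    one_le_div (Real.Gamma_pos_of_pos (by linarith [hα.1]))]
  exact Gamma_one_add_le_one ⟨hα.1.le, hα.2.le⟩

theorem lintegral_sq_wrightMeasure_le {α : ℝ} (hα : α ∈ Ioo (0 : ℝ) 1) :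
    ∫⁻ θ, ENNReal.ofReal (θ ^ 2) ∂wrightMeasure α ≤ ENNReal.ofReal 6 := by
  rw [lintegral_pow_wrightMeasure hα 2]
  apply ENNReal.ofReal_le_ofReal
  have h_Gamma : 1 / 3 ≤ Real.Gamma (1 + α * 2) := by
    have h := Gamma_lower (s := α * 2) (R := 1) (by linarith [hα.1]) zero_le_one
    have h_exp : 1 / 3 ≤ Real.exp (-1) := by
      rw [Real.exp_neg, ← one_div]
      exact one_div_le_one_div_of_le (Real.exp_pos 1) (by linarith [Real.exp_one_lt_d9])
    rw [Real.one_rpow, one_mul] at h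
    exact h_exp.trans h
  push_cast
  rw [div_le_iff₀ (by linarith)]
  norm_num [Nat.factorial]
  linarith

/-- The cut-offs `1/2` and `24` come from `θ ≤ 1/2 + θ 1_{(1/2,24]} + θ²/24`: integrated against
`h_α`, the left side is at least `1` and the outer terms on the right at most `1/2` and `1/4`. -/
theorem biasedWrightMeasure_Ioc_ge {α : ℝ} (hα : α ∈ Ioo (0 : ℝ) 1) :
    ENNReal.ofReal (1 / 4) ≤ biasedWrightMeasure α (Ioc (1 / 2) 24) := by
  set I := biasedWrightMeasure α (Ioc (1 / 2) 24)
  have h_pointwise (θ : ℝ) : ENNReal.ofReal θ ≤ ENNReal.ofReal (1 / 2) +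
      ENNReal.ofReal θ * (Ioc (1 / 2) 24).indicator 1 θ +
        ENNReal.ofReal (1 / 24) * ENNReal.ofReal (θ ^ 2) := by
    rcases le_or_gt θ (1 / 2) with h_small | h_small
    · exact (ENNReal.ofReal_le_ofReal h_small).trans (le_add_right le_self_add)
    rcases le_or_gt θ 24 with h_large | h_large
    · rw [indicator_of_mem (show θ ∈ Ioc (1 / 2) 24 from ⟨h_small, h_large⟩), Pi.one_apply, mul_one]
      exact le_add_right le_add_self
    · rw [← ENNReal.ofReal_mul (by norm_num)]
      exact le_add_left (ENNReal.ofReal_le_ofReal (by nlinarith))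
  have h_one : (1 : ℝ≥0∞) ≤ ENNReal.ofReal (3 / 4) + I :=
    calc (1 : ℝ≥0∞) ≤ ∫⁻ θ, ENNReal.ofReal θ ∂wrightMeasure α := by
          simpa using (one_le_biasedWrightMeasure_univ hα).trans_eq
            ((lintegral_one).symm.trans (lintegral_biasedWrightMeasure α fun _ => 1))
      _ ≤ _ := lintegral_mono h_pointwise
      _ = ENNReal.ofReal (1 / 2) + I +
            ENNReal.ofReal (1 / 24) * ∫⁻ θ, ENNReal.ofReal (θ ^ 2) ∂wrightMeasure α := by
          rw [lintegral_add_right _ (by fun_prop), lintegral_add_left (by fun_prop),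
            lintegral_const, wrightMeasure_univ hα, mul_one, lintegral_const_mul _ (by fun_prop),
            ← lintegral_biasedWrightMeasure, lintegral_indicator_one measurableSet_Ioc]
      _ ≤ ENNReal.ofReal (1 / 2) + I + ENNReal.ofReal (1 / 24) * ENNReal.ofReal 6 := by
          gcongr
          exact lintegral_sq_wrightMeasure_le hα
      _ = ENNReal.ofReal (3 / 4) + I := by
          rw [← ENNReal.ofReal_mul (by norm_num), add_right_comm,
            ← ENNReal.ofReal_add (by norm_num) (by norm_num)]
          norm_num
  rw [show (1 / 4 : ℝ) = 1 - 3 / 4 by norm_num, ENNReal.ofReal_sub _ (by norm_num),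
    ENNReal.ofReal_one]
  exact tsub_le_iff_left.2 h_one

theorem wrightMeasure_Ioc_ge {α : ℝ} (hα : α ∈ Ioo (0 : ℝ) 1) :
    ENNReal.ofReal (1 / 96) ≤ wrightMeasure α (Ioc (1 / 2) 24) := by
  have h_biased : biasedWrightMeasure α (Ioc (1 / 2) 24) ≤
      ENNReal.ofReal 24 * wrightMeasure α (Ioc (1 / 2) 24) := by
    rw [biasedWrightMeasure, withDensity_apply _ measurableSet_Ioc, ← setLIntegral_const]
    exact setLIntegral_mono (by fun_prop) fun θ hθ => ENNReal.ofReal_le_ofReal hθ.2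
  calc ENNReal.ofReal (1 / 96) = ENNReal.ofReal (1 / 24) * ENNReal.ofReal (1 / 4) := by
        rw [← ENNReal.ofReal_mul (by norm_num)]; norm_num
    _ ≤ ENNReal.ofReal (1 / 24) * (ENNReal.ofReal 24 * wrightMeasure α (Ioc (1 / 2) 24)) := by
        gcongr
        exact (biasedWrightMeasure_Ioc_ge hα).trans h_biased
    _ = wrightMeasure α (Ioc (1 / 2) 24) := by
        rw [← mul_assoc, ← ENNReal.ofReal_mul (by norm_num)]; norm_num

/-- `Γ(1 + s) ≥ R^s e^{-R}` with `R = (2b + 1)^{1/α}`. -/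
theorem pow_div_Gamma_le {α b : ℝ} (hα : 0 < α) (hb : 0 ≤ b) (k : ℕ) :
    b ^ k / Real.Gamma (1 + α * k) ≤ Real.exp ((2 * b + 1) ^ (1 / α)) * (1 / 2) ^ k := by
  set R : ℝ := (2 * b + 1) ^ (1 / α) with hR
  have hRk : R ^ (α * k) = (2 * b + 1) ^ k := by
    rw [hR, ← Real.rpow_mul (by positivity), ← Real.rpow_natCast]
    congr 1
    field_simp
  rw [div_le_iff₀ (Real.Gamma_pos_of_pos (by positivity))]
  calc b ^ k ≤ ((1 / 2) * (2 * b + 1)) ^ k := pow_le_pow_left₀ hb (by linarith) k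
    _ = Real.exp R * (1 / 2) ^ k * (R ^ (α * k) * Real.exp (-R)) := by
      rw [mul_pow, hRk, Real.exp_neg]
      field_simp
    _ ≤ Real.exp R * (1 / 2) ^ k * Real.Gamma (1 + α * k) := by
      gcongr
      exact Gamma_lower (by positivity) (by positivity)

theorem ofReal_exp_mul_eq_tsum {b θ : ℝ} (hb : 0 ≤ b) (hθ : 0 ≤ θ) :
    ENNReal.ofReal (Real.exp (b * θ)) =
      ∑' k : ℕ, ENNReal.ofReal (b ^ k / k.factorial) * ENNReal.ofReal (θ ^ k) := by
  have h_exp := NormedSpace.expSeries_div_hasSum_exp (b * θ)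
  rw [← Real.exp_eq_exp_ℝ] at h_exp
  rw [← h_exp.tsum_eq, ENNReal.ofReal_tsum_of_nonneg (fun k => by positivity) h_exp.summable]
  refine tsum_congr fun k => ?_
  rw [← ENNReal.ofReal_mul (by positivity), mul_pow, mul_div_right_comm]

theorem lintegral_exp_wrightMeasure_le {α : ℝ} (hα : α ∈ Ioo (0 : ℝ) 1) {b : ℝ} (hb : 0 ≤ b) :
    ∫⁻ θ, ENNReal.ofReal (Real.exp (b * θ)) ∂wrightMeasure α ≤
      ENNReal.ofReal (2 * Real.exp ((2 * b + 1) ^ (1 / α))) := by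
  have h_geom : HasSum (fun k : ℕ => Real.exp ((2 * b + 1) ^ (1 / α)) * (1 / 2 : ℝ) ^ k)
      (2 * Real.exp ((2 * b + 1) ^ (1 / α))) := by
    rw [mul_comm 2 (Real.exp _)]
    exact hasSum_geometric_two.mul_left _
  rw [lintegral_congr_ae ((ae_pos_wrightMeasure α).mono fun θ hθ =>
      ofReal_exp_mul_eq_tsum hb hθ.le),
    lintegral_tsum fun k => by fun_prop, ← h_geom.tsum_eq,
    ENNReal.ofReal_tsum_of_nonneg (fun k => by positivity) h_geom.summable]
  refine ENNReal.tsum_le_tsum fun k => ?_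
  rw [lintegral_const_mul _ (by fun_prop), lintegral_pow_wrightMeasure hα,
    ← ENNReal.ofReal_mul (by positivity), div_mul_div_cancel₀ (by positivity)]
  exact ENNReal.ofReal_le_ofReal (pow_div_Gamma_le hα.1 hb k)

theorem integrable_exp_wrightMeasure {α : ℝ} (hα : α ∈ Ioo (0 : ℝ) 1) {b : ℝ} (hb : 0 ≤ b) :
    Integrable (fun θ => Real.exp (b * θ)) (wrightMeasure α) := by
  refine ⟨by fun_prop, ?_⟩
  rw [hasFiniteIntegral_iff_ofReal (ae_of_all _ fun _ => (Real.exp_pos _).le)]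
  exact (lintegral_exp_wrightMeasure_le hα hb).trans_lt ENNReal.ofReal_lt_top

theorem integrable_exp_biasedWrightMeasure {α : ℝ} (hα : α ∈ Ioo (0 : ℝ) 1) {b : ℝ}
    (hb : 0 ≤ b) : Integrable (fun θ => Real.exp (b * θ)) (biasedWrightMeasure α) := by
  refine ⟨by fun_prop, ?_⟩
  rw [hasFiniteIntegral_iff_ofReal (ae_of_all _ fun _ => (Real.exp_pos _).le),
    lintegral_biasedWrightMeasure]
  refine (lintegral_mono_ae ?_).trans_lt
    (integrable_exp_wrightMeasure hα (b := b + 1) (by positivity)).lintegral_lt_top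
  filter_upwards [ae_pos_wrightMeasure α] with θ hθ
  rw [← ENNReal.ofReal_mul hθ.le, add_mul, one_mul, Real.exp_add, mul_comm]
  refine ENNReal.ofReal_le_ofReal (mul_le_mul_of_nonneg_left ?_ (Real.exp_pos _).le)
  linarith [Real.add_one_le_exp θ]

/-! ### The Duhamel identity for the Wright density -/

open ProbabilityTheory in
theorem complexMGF_eq_of_moments_eq {Ω Ω' : Type*} [MeasurableSpace Ω] [MeasurableSpace Ω']
    {μ : Measure Ω} {ν : Measure Ω'} {X : Ω → ℝ} {Y : Ω' → ℝ}
    (hX : ∀ t, Integrable (fun ω => Real.exp (t * X ω)) μ)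
    (hY : ∀ t, Integrable (fun ω => Real.exp (t * Y ω)) ν)
    (h : ∀ n : ℕ, ∫ ω, X ω ^ n ∂μ = ∫ ω, Y ω ^ n ∂ν) : complexMGF X μ = complexMGF Y ν := by
  have hX_univ : integrableExpSet X μ = univ := eq_univ_of_forall hX
  have hY_univ : integrableExpSet Y ν = univ := eq_univ_of_forall hY
  have hX_entire : Differentiable ℂ (complexMGF X μ) := fun z =>
    (analyticAt_complexMGF (by simp [hX_univ])).differentiableAt
  have hY_entire : Differentiable ℂ (complexMGF Y ν) := fun z =>
    (analyticAt_complexMGF (by simp [hY_univ])).differentiableAt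
  have h_deriv (n : ℕ) :
      iteratedDeriv n (complexMGF X μ) 0 = iteratedDeriv n (complexMGF Y ν) 0 := by
    rw [iteratedDeriv_complexMGF (by simp [hX_univ]), iteratedDeriv_complexMGF (by simp [hY_univ])]
    simp only [zero_mul, Complex.exp_zero, mul_one, ← Complex.ofReal_pow, integral_complex_ofReal,
      h]
  funext z
  rw [← Complex.taylorSeries_eq_of_entire' 0 z hX_entire,
    ← Complex.taylorSeries_eq_of_entire' 0 z hY_entire]
  simp only [h_deriv]

theorem integrable_exp_mul_dual {E : Type*} [NormedAddCommGroup E] [NormedSpace ℝ E]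
    [MeasurableSpace E] [BorelSpace E] {μ : Measure E}
    (hμ : ∀ c : ℝ, 0 ≤ c → Integrable (fun x => Real.exp (c * ‖x‖)) μ) (L : StrongDual ℝ E)
    (t : ℝ) : Integrable (fun x => Real.exp (t * L x)) μ := by
  refine (hμ (|t| * ‖L‖) (by positivity)).mono'
    (by fun_prop : Measurable fun x => Real.exp (t * L x)).aestronglyMeasurable
    (ae_of_all _ fun x => ?_)
  rw [Real.norm_of_nonneg (Real.exp_pos _).le, mul_assoc]
  refine Real.exp_le_exp.2 ((le_abs_self _).trans ?_)
  rw [abs_mul]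
  exact mul_le_mul_of_nonneg_left (L.le_opNorm x) (abs_nonneg t)

theorem isFiniteMeasure_of_integrable_exp {E : Type*} [NormedAddCommGroup E] [MeasurableSpace E]
    {μ : Measure E} (hμ : ∀ c : ℝ, 0 ≤ c → Integrable (fun x => Real.exp (c * ‖x‖)) μ) :
    IsFiniteMeasure μ := by
  have h_one := hμ 0 le_rfl
  simp only [zero_mul, Real.exp_zero] at h_one
  exact (integrable_const_iff_isFiniteMeasure one_ne_zero).1 h_one

theorem ext_of_integral_dual_pow_eq {E : Type*} [NormedAddCommGroup E] [NormedSpace ℝ E]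
    [CompleteSpace E] [SecondCountableTopology E] [MeasurableSpace E] [BorelSpace E]
    {μ ν : Measure E} (hμ : ∀ c : ℝ, 0 ≤ c → Integrable (fun x => Real.exp (c * ‖x‖)) μ)
    (hν : ∀ c : ℝ, 0 ≤ c → Integrable (fun x => Real.exp (c * ‖x‖)) ν)
    (h : ∀ (L : StrongDual ℝ E) (n : ℕ), ∫ x, L x ^ n ∂μ = ∫ x, L x ^ n ∂ν) : μ = ν := by
  have := isFiniteMeasure_of_integrable_exp hμ
  have := isFiniteMeasure_of_integrable_exp hν
  refine Measure.ext_of_charFunDual (funext fun L => ?_)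
  have h_mgf := congrFun (complexMGF_eq_of_moments_eq (integrable_exp_mul_dual hμ L)
    (integrable_exp_mul_dual hν L) (h L)) Complex.I
  simpa only [charFunDual_apply, ProbabilityTheory.complexMGF, mul_comm Complex.I] using h_mgf

theorem integrable_pow_mul_pow {μ : Measure (ℝ × ℝ)}
    (hμ : Integrable (fun z => Real.exp ‖z‖) μ) (j k : ℕ) :
    Integrable (fun z : ℝ × ℝ => z.1 ^ j * z.2 ^ k) μ := by
  refine (hμ.const_mul ((j + k).factorial : ℝ)).mono' (by fun_prop) (ae_of_all _ fun z => ?_)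
  calc ‖z.1 ^ j * z.2 ^ k‖ = ‖z.1‖ ^ j * ‖z.2‖ ^ k := by rw [norm_mul, norm_pow, norm_pow]
    _ ≤ ‖z‖ ^ j * ‖z‖ ^ k := by
      gcongr
      exacts [norm_fst_le z, norm_snd_le z]
    _ = ‖z‖ ^ (j + k) := (pow_add _ _ _).symm
    _ ≤ (j + k).factorial * Real.exp ‖z‖ :=
      (div_le_iff₀' (by positivity)).1 (Real.pow_div_factorial_le_exp _ (norm_nonneg z) _)

theorem integral_dual_pow_eq_sum {μ : Measure (ℝ × ℝ)}
    (hμ : Integrable (fun z => Real.exp ‖z‖) μ) (L : StrongDual ℝ (ℝ × ℝ)) (n : ℕ) :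
    ∫ z, L z ^ n ∂μ = ∑ m ∈ Finset.range (n + 1),
      L (1, 0) ^ m * L (0, 1) ^ (n - m) * n.choose m * ∫ z, z.1 ^ m * z.2 ^ (n - m) ∂μ := by
  have hL (z : ℝ × ℝ) : L z = L (1, 0) * z.1 + L (0, 1) * z.2 := by
    have h_basis : z = z.1 • ((1 : ℝ), (0 : ℝ)) + z.2 • ((0 : ℝ), (1 : ℝ)) := by ext <;> simp
    conv_lhs => rw [h_basis]
    simp only [map_add, map_smul, smul_eq_mul, mul_comm]
  have h_expand (z : ℝ × ℝ) : L z ^ n = ∑ m ∈ Finset.range (n + 1),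
      L (1, 0) ^ m * L (0, 1) ^ (n - m) * n.choose m * (z.1 ^ m * z.2 ^ (n - m)) := by
    rw [hL, add_pow]
    exact Finset.sum_congr rfl fun m _ => by ring
  simp only [h_expand]
  rw [integral_finsetSum _ fun m _ => (integrable_pow_mul_pow hμ m (n - m)).const_mul _]
  exact Finset.sum_congr rfl fun m _ => integral_const_mul _ _

theorem ext_of_mixed_moments_eq {μ ν : Measure (ℝ × ℝ)}
    (hμ : ∀ c : ℝ, 0 ≤ c → Integrable (fun z => Real.exp (c * ‖z‖)) μ)
    (hν : ∀ c : ℝ, 0 ≤ c → Integrable (fun z => Real.exp (c * ‖z‖)) ν)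
    (h : ∀ j k : ℕ, ∫ z, z.1 ^ j * z.2 ^ k ∂μ = ∫ z, z.1 ^ j * z.2 ^ k ∂ν) : μ = ν := by
  have hμ_one := hμ 1 zero_le_one
  have hν_one := hν 1 zero_le_one
  simp only [one_mul] at hμ_one hν_one
  refine ext_of_integral_dual_pow_eq hμ hν fun L n => ?_
  simp only [integral_dual_pow_eq_sum hμ_one, integral_dual_pow_eq_sum hν_one, h]

theorem integral_one_sub_rpow_mul_rpow {a b : ℝ} (ha : 0 < a) (hb : 0 < b) :
    ∫ ρ in Ioo (0 : ℝ) 1, (1 - ρ) ^ (a - 1) * ρ ^ (b - 1) = ProbabilityTheory.beta a b := by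
  have h_pos := ProbabilityTheory.beta_pos hb ha
  have h_one : ∫ ρ in Ioo (0 : ℝ) 1,
      1 / ProbabilityTheory.beta b a * ρ ^ (b - 1) * (1 - ρ) ^ (a - 1) = 1 := by
    rw [integral_eq_lintegral_of_nonneg_ae
      (ae_restrict_of_forall_mem measurableSet_Ioo fun ρ hρ => ?_) (by fun_prop),
      ← ProbabilityTheory.lintegral_betaPDF, ProbabilityTheory.lintegral_betaPDF_eq_one hb ha,
      ENNReal.toReal_one]
    have h_left := hρ.1
    have h_right := sub_pos.2 hρ.2
    simp only [Pi.zero_apply]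
    positivity
  simp only [mul_assoc] at h_one
  rw [integral_const_mul, one_div_mul_eq_div, div_eq_one_iff_eq h_pos.ne'] at h_one
  simp only [h_one, ProbabilityTheory.beta, add_comm, mul_comm]

/-- The law `α (1-ρ)^{α-1} dρ` on `(0,1)`: the kernel `α (t-s)^{α-1} ds` of the Duhamel term in the
variable `ρ = s/t`, up to the factor `t^α`. -/
def duhamelTimeMeasure (α : ℝ) : Measure ℝ :=
  (volume.restrict (Ioo 0 1)).withDensity fun ρ => ENNReal.ofReal (α * (1 - ρ) ^ (α - 1))

instance (α : ℝ) : SigmaFinite (duhamelTimeMeasure α) := SigmaFinite.withDensity_ofReal _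

theorem ae_mem_Ioo_duhamelTimeMeasure (α : ℝ) : ∀ᵐ ρ ∂duhamelTimeMeasure α, ρ ∈ Ioo (0 : ℝ) 1 :=
  (withDensity_absolutelyContinuous _ _).ae_le (ae_restrict_mem measurableSet_Ioo)

theorem integral_duhamelTimeMeasure {α : ℝ} (hα : 0 < α) (j k : ℕ) :
    ∫ ρ, ((1 - ρ) ^ α) ^ j * (ρ ^ α) ^ k ∂duhamelTimeMeasure α =
      α * ProbabilityTheory.beta (α * (j + 1)) (1 + α * k) := by
  rw [duhamelTimeMeasure, integral_withDensity_eq_integral_toReal_smul (by fun_prop)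
    (ae_of_all _ fun _ => ENNReal.ofReal_lt_top),
    ← integral_one_sub_rpow_mul_rpow (by positivity) (by positivity), ← integral_const_mul]
  refine setIntegral_congr_fun measurableSet_Ioo fun ρ hρ => ?_
  have h_left := hρ.1
  have h_right := sub_pos.2 hρ.2
  rw [smul_eq_mul, ENNReal.toReal_ofReal (by positivity), ← Real.rpow_mul_natCast h_right.le,
    ← Real.rpow_mul_natCast h_left.le, add_sub_cancel_left,
    show α * ((j : ℝ) + 1) - 1 = α - 1 + α * j by ring, Real.rpow_add h_right]
  ring

theorem isFiniteMeasure_duhamelTimeMeasure {α : ℝ} (hα : 0 < α) :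
    IsFiniteMeasure (duhamelTimeMeasure α) := by
  have h_total : ∫ _, (1 : ℝ) ∂duhamelTimeMeasure α = 1 := by
    have h := integral_duhamelTimeMeasure hα 0 0
    simp only [pow_zero, Nat.cast_zero, mul_zero, zero_add, add_zero, mul_one,
      ProbabilityTheory.beta, Real.Gamma_one, add_comm α 1] at h
    rw [h, add_comm 1 α, Real.Gamma_add_one hα.ne']
    field_simp
  exact (integrable_const_iff_isFiniteMeasure (one_ne_zero (α := ℝ))).1
    (by_contra fun h => by simp [integral_undef h] at h_total)

/-- The distribution of `((1-ρ)^α η, ρ^α θ)` under `α (1-ρ)^{α-1} η h_α(η) h_α(θ) dρ dη dθ`. -/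
def duhamelMeasure (α : ℝ) : Measure (ℝ × ℝ) :=
  ((duhamelTimeMeasure α).prod ((biasedWrightMeasure α).prod (wrightMeasure α))).map
    fun z => ((1 - z.1) ^ α * z.2.1, z.1 ^ α * z.2.2)

/-- The distribution of `(θ(1-ρ), θρ)` under `θ h_α(θ) dθ dρ` with `0 < ρ < 1`. -/
def splitMeasure (α : ℝ) : Measure (ℝ × ℝ) :=
  ((biasedWrightMeasure α).prod (volume.restrict (Ioo (0 : ℝ) 1))).map
    fun z => (z.1 * (1 - z.2), z.1 * z.2)

theorem lintegral_duhamelMeasure (α : ℝ) {Φ : ℝ × ℝ → ℝ≥0∞} (hΦ : Measurable Φ) :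
    ∫⁻ z, Φ z ∂duhamelMeasure α =
      ∫⁻ ρ in Ioo (0 : ℝ) 1, ENNReal.ofReal (α * (1 - ρ) ^ (α - 1)) *
        ∫⁻ η, ∫⁻ θ, Φ ((1 - ρ) ^ α * η, ρ ^ α * θ) ∂wrightMeasure α ∂biasedWrightMeasure α := by
  have h_meas : Measurable fun z : ℝ × ℝ × ℝ => Φ ((1 - z.1) ^ α * z.2.1, z.1 ^ α * z.2.2) := by
    fun_prop
  rw [duhamelMeasure, lintegral_map hΦ (by fun_prop), lintegral_prod _ h_meas.aemeasurable,
    duhamelTimeMeasure,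
    lintegral_withDensity_eq_lintegral_mul _ (by fun_prop) h_meas.lintegral_prod_right']
  refine lintegral_congr fun ρ => ?_
  simp only [Pi.mul_apply]
  rw [lintegral_prod _ (by fun_prop)]

theorem lintegral_splitMeasure (α : ℝ) {Φ : ℝ × ℝ → ℝ≥0∞} (hΦ : Measurable Φ) :
    ∫⁻ z, Φ z ∂splitMeasure α =
      ∫⁻ θ, (∫⁻ ρ in Ioo (0 : ℝ) 1, Φ (θ * (1 - ρ), θ * ρ)) ∂biasedWrightMeasure α := by
  rw [splitMeasure, lintegral_map hΦ (by fun_prop), lintegral_prod _ (by fun_prop)]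

theorem integrable_exp_duhamelMeasure {α : ℝ} (hα : α ∈ Ioo (0 : ℝ) 1) {c : ℝ} (hc : 0 ≤ c) :
    Integrable (fun z => Real.exp (c * ‖z‖)) (duhamelMeasure α) := by
  have := isFiniteMeasure_duhamelTimeMeasure hα.1
  refine (integrable_map_measure (by fun_prop) (by fun_prop)).2 ?_
  refine ((integrable_const (1 : ℝ)).mul_prod ((integrable_exp_biasedWrightMeasure hα hc).mul_prod
    (integrable_exp_wrightMeasure hα hc))).mono' (by fun_prop) ?_
  filter_upwards [Measure.quasiMeasurePreserving_fst.ae (ae_mem_Ioo_duhamelTimeMeasure α),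
    Measure.quasiMeasurePreserving_snd.ae (Measure.quasiMeasurePreserving_fst.ae
      (ae_pos_biasedWrightMeasure α)), Measure.quasiMeasurePreserving_snd.ae
      (Measure.quasiMeasurePreserving_snd.ae (ae_pos_wrightMeasure α))] with ⟨ρ, η, θ⟩ hρ hη hθ
  dsimp only at hρ hη hθ
  have hη_le : (1 - ρ) ^ α * η ≤ η := mul_le_of_le_one_left hη.le
    (Real.rpow_le_one (by linarith [hρ.2]) (by linarith [hρ.1]) hα.1.le)
  have hθ_le : ρ ^ α * θ ≤ θ := mul_le_of_le_one_left hθ.le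
    (Real.rpow_le_one hρ.1.le hρ.2.le hα.1.le)
  have hη_nonneg : 0 ≤ (1 - ρ) ^ α * η := mul_nonneg (Real.rpow_nonneg (by linarith [hρ.2]) _) hη.le
  have hθ_nonneg : 0 ≤ ρ ^ α * θ := mul_nonneg (Real.rpow_nonneg hρ.1.le _) hθ.le
  rw [Function.comp_apply, Real.norm_of_nonneg (Real.exp_pos _).le, one_mul, ← Real.exp_add,
    ← mul_add, Prod.norm_def, Real.norm_of_nonneg hη_nonneg, Real.norm_of_nonneg hθ_nonneg]
  gcongr
  exact max_le (by linarith) (by linarith)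

theorem integrable_exp_splitMeasure {α : ℝ} (hα : α ∈ Ioo (0 : ℝ) 1) {c : ℝ} (hc : 0 ≤ c) :
    Integrable (fun z => Real.exp (c * ‖z‖)) (splitMeasure α) := by
  refine (integrable_map_measure (by fun_prop) (by fun_prop)).2 ?_
  refine ((integrable_exp_biasedWrightMeasure hα hc).mul_prod (integrable_const (1 : ℝ))).mono'
    (by fun_prop) ?_
  filter_upwards [Measure.quasiMeasurePreserving_fst.ae (ae_pos_biasedWrightMeasure α),
    Measure.quasiMeasurePreserving_snd.ae (ae_restrict_mem measurableSet_Ioo)] with ⟨θ, ρ⟩ hθ hρ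
  dsimp only at hρ hθ
  rw [Function.comp_apply, Real.norm_of_nonneg (Real.exp_pos _).le, mul_one, Prod.norm_def,
    Real.norm_of_nonneg (mul_nonneg hθ.le (by linarith [hρ.2])),
    Real.norm_of_nonneg (mul_nonneg hθ.le hρ.1.le)]
  gcongr
  exact max_le (mul_le_of_le_one_right hθ.le (by linarith [hρ.1]))
    (mul_le_of_le_one_right hθ.le hρ.2.le)

theorem integral_pow_mul_pow_duhamelMeasure {α : ℝ} (hα : α ∈ Ioo (0 : ℝ) 1) (j k : ℕ) :
    ∫ z, z.1 ^ j * z.2 ^ k ∂duhamelMeasure α =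
      j.factorial * k.factorial / Real.Gamma (1 + α * (j + k + 1)) := by
  have hα_pos := hα.1
  have h_Gamma : Real.Gamma (1 + α * (j + 1)) = α * (j + 1) * Real.Gamma (α * (j + 1)) := by
    rw [add_comm, Real.Gamma_add_one (by positivity)]
  calc ∫ z, z.1 ^ j * z.2 ^ k ∂duhamelMeasure α
      = ∫ z : ℝ × ℝ × ℝ, ((1 - z.1) ^ α) ^ j * (z.1 ^ α) ^ k * (z.2.1 ^ j * z.2.2 ^ k)
          ∂(duhamelTimeMeasure α).prod ((biasedWrightMeasure α).prod (wrightMeasure α)) := by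
        rw [duhamelMeasure, integral_map (by fun_prop) (by fun_prop)]
        exact integral_congr_ae (ae_of_all _ fun z => by ring)
    _ = α * ProbabilityTheory.beta (α * (j + 1)) (1 + α * k) *
          ((j + 1).factorial / Real.Gamma (1 + α * (j + 1)) *
            (k.factorial / Real.Gamma (1 + α * k))) := by
        rw [integral_prod_mul (fun ρ : ℝ => ((1 - ρ) ^ α) ^ j * (ρ ^ α) ^ k)
          (fun w : ℝ × ℝ => w.1 ^ j * w.2 ^ k),
          integral_prod_mul (fun η : ℝ => η ^ j) (fun θ : ℝ => θ ^ k),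
          integral_duhamelTimeMeasure hα_pos, integral_pow_biasedWrightMeasure hα,
          integral_pow_wrightMeasure hα]
    _ = j.factorial * k.factorial / Real.Gamma (1 + α * (j + k + 1)) := by
        rw [ProbabilityTheory.beta, h_Gamma, Nat.factorial_succ,
          show α * ((j : ℝ) + 1) + (1 + α * k) = 1 + α * (j + k + 1) by ring]
        push_cast
        field_simp

theorem integral_pow_mul_pow_splitMeasure {α : ℝ} (hα : α ∈ Ioo (0 : ℝ) 1) (j k : ℕ) :
    ∫ z, z.1 ^ j * z.2 ^ k ∂splitMeasure α =
      j.factorial * k.factorial / Real.Gamma (1 + α * (j + k + 1)) := by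
  have h_beta : ∫ ρ in Ioo (0 : ℝ) 1, (1 - ρ) ^ j * ρ ^ k =
      j.factorial * k.factorial / (j + k + 1).factorial := by
    have h := integral_one_sub_rpow_mul_rpow (a := j + 1) (b := k + 1) (by positivity)
      (by positivity)
    simp only [add_sub_cancel_right, Real.rpow_natCast, ProbabilityTheory.beta,
      Real.Gamma_nat_eq_factorial] at h
    rw [h, show (j : ℝ) + 1 + (k + 1) = (j + k + 1 : ℕ) + 1 by push_cast; ring,
      Real.Gamma_nat_eq_factorial]
  calc ∫ z, z.1 ^ j * z.2 ^ k ∂splitMeasure α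
      = ∫ z : ℝ × ℝ, z.1 ^ (j + k) * ((1 - z.2) ^ j * z.2 ^ k)
          ∂(biasedWrightMeasure α).prod (volume.restrict (Ioo (0 : ℝ) 1)) := by
        rw [splitMeasure, integral_map (by fun_prop) (by fun_prop)]
        exact integral_congr_ae (ae_of_all _ fun z => by simp only [mul_pow, pow_add]; ring)
    _ = (j + k + 1).factorial / Real.Gamma (1 + α * ((j + k : ℕ) + 1)) *
          (j.factorial * k.factorial / (j + k + 1).factorial) := by
        rw [integral_prod_mul (fun θ : ℝ => θ ^ (j + k)) (fun ρ : ℝ => (1 - ρ) ^ j * ρ ^ k),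
          integral_pow_biasedWrightMeasure hα, h_beta]
    _ = j.factorial * k.factorial / Real.Gamma (1 + α * (j + k + 1)) := by
        push_cast
        field_simp

theorem duhamelMeasure_eq_splitMeasure {α : ℝ} (hα : α ∈ Ioo (0 : ℝ) 1) :
    duhamelMeasure α = splitMeasure α :=
  ext_of_mixed_moments_eq (fun _ => integrable_exp_duhamelMeasure hα)
    (fun _ => integrable_exp_splitMeasure hα) fun j k => by
      rw [integral_pow_mul_pow_duhamelMeasure hα, integral_pow_mul_pow_splitMeasure hα]

theorem lintegral_Ioo_zero_eq {t : ℝ} (ht : 0 < t) (f : ℝ → ℝ≥0∞) :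
    ∫⁻ s in Ioo 0 t, f s = ENNReal.ofReal t * ∫⁻ ρ in Ioo (0 : ℝ) 1, f (t * ρ) := by
  have h_image : (fun ρ => t * ρ) '' Ioo (0 : ℝ) 1 = Ioo 0 t := by
    rw [image_mul_left_Ioo ht, mul_zero, mul_one]
  rw [← h_image, lintegral_image_eq_lintegral_abs_deriv_mul measurableSet_Ioo (f' := fun _ => t)
    (fun ρ _ => by simpa using ((hasDerivAt_id ρ).const_mul t).hasDerivWithinAt)
    (mul_right_injective₀ ht.ne').injOn, abs_of_pos ht,
    lintegral_const_mul' _ _ ENNReal.ofReal_ne_top]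

theorem lintegral_Ioo_sub_rpow_mul {α t : ℝ} (hα : 0 < α) (ht : 0 < t) (g : ℝ → ℝ → ℝ≥0∞) :
    ENNReal.ofReal α * ∫⁻ s in Ioo 0 t, ENNReal.ofReal ((t - s) ^ (α - 1)) *
      g ((t - s) ^ α) (s ^ α) =
    ENNReal.ofReal (t ^ α) * ∫⁻ ρ in Ioo (0 : ℝ) 1, ENNReal.ofReal (α * (1 - ρ) ^ (α - 1)) *
      g (t ^ α * (1 - ρ) ^ α) (t ^ α * ρ ^ α) := by
  rw [lintegral_Ioo_zero_eq ht, ← mul_assoc, ← lintegral_const_mul' _ _ (by finiteness),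
    ← lintegral_const_mul' _ _ ENNReal.ofReal_ne_top]
  refine setLIntegral_congr_fun measurableSet_Ioo fun ρ hρ => ?_
  have h_right := sub_pos.2 hρ.2
  rw [show t - t * ρ = t * (1 - ρ) by ring, Real.mul_rpow ht.le h_right.le,
    Real.mul_rpow ht.le h_right.le, Real.mul_rpow ht.le hρ.1.le, ← mul_assoc, ← mul_assoc,
    ← ENNReal.ofReal_mul hα.le, ← ENNReal.ofReal_mul (by positivity),
    ← ENNReal.ofReal_mul (by positivity), Real.rpow_sub_one ht.ne']
  congr 2
  field_simp

theorem lintegral_duhamel {α t : ℝ} (hα : α ∈ Ioo (0 : ℝ) 1) (ht : 0 < t)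
    {Φ : ℝ × ℝ → ℝ≥0∞} (hΦ : Measurable Φ) :
    ENNReal.ofReal α * ∫⁻ s in Ioo 0 t, ENNReal.ofReal ((t - s) ^ (α - 1)) *
      ∫⁻ η, ∫⁻ θ, Φ ((t - s) ^ α * η, s ^ α * θ) ∂wrightMeasure α ∂biasedWrightMeasure α =
    ∫⁻ θ, (∫⁻ σ in Ioo 0 (t ^ α * θ), Φ (t ^ α * θ - σ, σ)) ∂wrightMeasure α := by
  have h_scaled : Measurable fun z : ℝ × ℝ => Φ (t ^ α * z.1, t ^ α * z.2) := by fun_prop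
  rw [lintegral_Ioo_sub_rpow_mul hα.1 ht fun a b => ∫⁻ η, ∫⁻ θ, Φ (a * η, b * θ)
    ∂wrightMeasure α ∂biasedWrightMeasure α]
  simp only [mul_assoc (t ^ α)]
  rw [← lintegral_duhamelMeasure α h_scaled, duhamelMeasure_eq_splitMeasure hα,
    lintegral_splitMeasure α h_scaled, lintegral_biasedWrightMeasure,
    ← lintegral_const_mul' _ _ ENNReal.ofReal_ne_top]
  refine lintegral_congr_ae ((ae_pos_wrightMeasure α).mono fun θ hθ => ?_)
  dsimp only
  rw [lintegral_Ioo_zero_eq (t := t ^ α * θ) (by positivity), ← mul_assoc,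
    ← ENNReal.ofReal_mul (by positivity)]
  simp only [mul_sub, mul_one, mul_assoc]

/-! ### The heat semigroup -/

theorem lintegral_exp_neg_mul_sq_norm {V : Type*} [NormedAddCommGroup V] [InnerProductSpace ℝ V]
    [FiniteDimensional ℝ V] [MeasurableSpace V] [BorelSpace V] {b : ℝ} (hb : 0 < b) :
    ∫⁻ v : V, ENNReal.ofReal (Real.exp (-b * ‖v‖ ^ 2)) =
      ENNReal.ofReal ((Real.pi / b) ^ ((Module.finrank ℝ V : ℝ) / 2)) := by
  have h := GaussianFourier.integral_rexp_neg_mul_sq_norm (V := V) hb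
  have h_pos : 0 < (Real.pi / b) ^ ((Module.finrank ℝ V : ℝ) / 2) := by
    positivity
  rw [← h, ofReal_integral_eq_lintegral_ofReal
      (not_imp_comm.1 integral_undef (h.trans_ne h_pos.ne'))
    (ae_of_all _ fun _ => (Real.exp_pos _).le)]

theorem norm_sq_div_add_norm_sq_div {E : Type*} [NormedAddCommGroup E] [InnerProductSpace ℝ E]
    {r s : ℝ} (hr : 0 < r) (hs : 0 < s) (x y z : E) :
    ‖x - z‖ ^ 2 / (4 * r) + ‖z - y‖ ^ 2 / (4 * s) = ‖x - y‖ ^ 2 / (4 * (r + s)) +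
      ‖z - ((s / (r + s)) • x + (r / (r + s)) • y)‖ ^ 2 / (4 * (r * s / (r + s))) := by
  have h_weights : r / (r + s) = 1 - s / (r + s) := by field_simp; ring
  have h_left : x - z =
      (r / (r + s)) • (x - y) - (z - ((s / (r + s)) • x + (r / (r + s)) • y)) := by
    rw [h_weights]; module
  have h_right : z - y =
      (s / (r + s)) • (x - y) + (z - ((s / (r + s)) • x + (r / (r + s)) • y)) := by
    rw [h_weights]; module
  rw [h_left, h_right]
  generalize z - ((s / (r + s)) • x + (r / (r + s)) • y) = w
  rw [norm_sub_sq_real, norm_add_sq_real, norm_smul, norm_smul, inner_smul_left,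
    inner_smul_left, Real.norm_of_nonneg (by positivity), Real.norm_of_nonneg (by positivity)]
  simp only [conj_trivial]
  field_simp
  ring

theorem exists_ball_subset_closedBall_inter_closedBall {E : Type*} [NormedAddCommGroup E]
    [NormedSpace ℝ E] {r R : ℝ} {x : E} (hr : 0 < r) (hrR : r ≤ R) (hx : ‖x‖ ≤ R) :
    ∃ c : E, Metric.ball c (r / 2) ⊆ Metric.closedBall 0 R ∩ Metric.closedBall x r := by
  have hR := hr.trans_le hrR
  set q := r / (2 * R) with hq
  have hq_pos : 0 < q := by positivity
  have hq_le : q ≤ 1 := by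
    rw [hq, div_le_one (by positivity)]; linarith
  have hqR : q * R = r / 2 := by rw [hq]; field_simp
  have h_center : ‖(1 - q) • x‖ ≤ R - r / 2 := by
    rw [norm_smul, Real.norm_of_nonneg (by linarith), ← hqR]
    calc (1 - q) * ‖x‖ ≤ (1 - q) * R := by gcongr
      _ = R - q * R := by ring
  have h_dist : ‖(1 - q) • x - x‖ ≤ r / 2 := by
    rw [show (1 - q) • x - x = -(q • x) by module, norm_neg, norm_smul,
      Real.norm_of_nonneg hq_pos.le, ← hqR]
    gcongr
  refine ⟨(1 - q) • x, fun y hy => ⟨?_, ?_⟩⟩ <;> rw [mem_ball_iff_norm] at hy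
  · rw [mem_closedBall_zero_iff]
    linarith [norm_le_norm_sub_add y ((1 - q) • x)]
  · rw [mem_closedBall_iff_norm]
    linarith [norm_sub_le_norm_sub_add_norm_sub y ((1 - q) • x) x]

variable {N : ℕ}

theorem heatKernel_nonneg {t : ℝ} (ht : 0 ≤ t) (x : EuclideanSpace ℝ (Fin N)) :
    0 ≤ heatKernel t x := by
  unfold heatKernel; positivity

@[fun_prop]
theorem measurable_heatKernel {X : Type*} [MeasurableSpace X] {f : X → ℝ}
    {g : X → EuclideanSpace ℝ (Fin N)} (hf : Measurable f) (hg : Measurable g) :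
    Measurable fun z => heatKernel (f z) (g z) := by
  unfold heatKernel; fun_prop

theorem lintegral_heatKernel {t : ℝ} (ht : 0 < t) :
    ∫⁻ y : EuclideanSpace ℝ (Fin N), ENNReal.ofReal (heatKernel t y) = 1 := by
  have h_exp (y : EuclideanSpace ℝ (Fin N)) : -‖y‖ ^ 2 / (4 * t) = -(1 / (4 * t)) * ‖y‖ ^ 2 := by
    ring
  have h_nonneg : 0 ≤ 1 / (4 * Real.pi * t) ^ ((N : ℝ) / 2) := by positivity
  simp only [heatKernel, ENNReal.ofReal_mul h_nonneg, h_exp]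
  rw [lintegral_const_mul _ (by fun_prop), lintegral_exp_neg_mul_sq_norm (by positivity),
    finrank_euclideanSpace_fin, ← ENNReal.ofReal_mul h_nonneg,
    show Real.pi / (1 / (4 * t)) = 4 * Real.pi * t by field_simp,
    one_div_mul_cancel (by positivity), ENNReal.ofReal_one]

theorem lintegral_heatKernel_sub {t : ℝ} (ht : 0 < t) (x : EuclideanSpace ℝ (Fin N)) :
    ∫⁻ y, ENNReal.ofReal (heatKernel t (x - y)) = 1 := by
  rw [lintegral_sub_left_eq_self (fun y => ENNReal.ofReal (heatKernel t y)),
    lintegral_heatKernel ht]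

theorem heatKernel_mul_heatKernel {r s : ℝ} (hr : 0 < r) (hs : 0 < s)
    (x y z : EuclideanSpace ℝ (Fin N)) :
    heatKernel r (x - z) * heatKernel s (z - y) = heatKernel (r + s) (x - y) *
      heatKernel (r * s / (r + s)) (z - ((s / (r + s)) • x + (r / (r + s)) • y)) := by
  have h_norm : (4 * Real.pi * r) ^ ((N : ℝ) / 2) * (4 * Real.pi * s) ^ ((N : ℝ) / 2) =
      (4 * Real.pi * (r + s)) ^ ((N : ℝ) / 2) *
        (4 * Real.pi * (r * s / (r + s))) ^ ((N : ℝ) / 2) := by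
    rw [← Real.mul_rpow (by positivity) (by positivity),
      ← Real.mul_rpow (by positivity) (by positivity)]
    congr 1
    field_simp
  unfold heatKernel
  rw [mul_mul_mul_comm, mul_mul_mul_comm _ _ (1 / _) (Real.exp _), one_div_mul_one_div,
    one_div_mul_one_div, h_norm,
    ← Real.exp_add, ← Real.exp_add]
  simp only [neg_div]
  rw [← neg_add, ← neg_add, norm_sq_div_add_norm_sq_div hr hs x y z]

theorem lintegral_heatKernel_mul_heatKernel {r s : ℝ} (hr : 0 < r) (hs : 0 < s)
    (x y : EuclideanSpace ℝ (Fin N)) :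
    ∫⁻ z, ENNReal.ofReal (heatKernel r (x - z)) * ENNReal.ofReal (heatKernel s (z - y)) =
      ENNReal.ofReal (heatKernel (r + s) (x - y)) := by
  simp only [← ENNReal.ofReal_mul (heatKernel_nonneg hr.le _), heatKernel_mul_heatKernel hr hs]
  simp only [ENNReal.ofReal_mul (heatKernel_nonneg (add_pos hr hs).le _)]
  rw [lintegral_const_mul _ (by fun_prop), lintegral_sub_right_eq_self
    (fun z => ENNReal.ofReal (heatKernel (r * s / (r + s)) z)),
    lintegral_heatKernel (by positivity), mul_one]

theorem heat_withDensity (t : ℝ) {f : EuclideanSpace ℝ (Fin N) → ℝ≥0∞} (hf : Measurable f)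
    (x : EuclideanSpace ℝ (Fin N)) :
    heat t (volume.withDensity f) x = ∫⁻ y, ENNReal.ofReal (heatKernel t (x - y)) * f y := by
  rw [heat, lintegral_withDensity_eq_lintegral_mul _ hf (by fun_prop)]
  exact lintegral_congr fun y => mul_comm _ _

@[fun_prop]
theorem measurable_heat (μ : Measure (EuclideanSpace ℝ (Fin N))) [SFinite μ]
    {X : Type*} [MeasurableSpace X] {f : X → ℝ} {g : X → EuclideanSpace ℝ (Fin N)}
    (hf : Measurable f) (hg : Measurable g) : Measurable fun z => heat (f z) μ (g z) :=
  Measurable.lintegral_prod_right'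
    (f := fun z : X × EuclideanSpace ℝ (Fin N) =>
      ENNReal.ofReal (heatKernel (f z.1) (g z.1 - z.2))) (by fun_prop)

theorem heat_heat (μ : Measure (EuclideanSpace ℝ (Fin N))) [SFinite μ] {r s : ℝ}
    (hr : 0 < r) (hs : 0 < s) (x : EuclideanSpace ℝ (Fin N)) :
    heat r (volume.withDensity (heat s μ)) x = heat (r + s) μ x := by
  rw [heat_withDensity r (by fun_prop)]
  calc ∫⁻ z, ENNReal.ofReal (heatKernel r (x - z)) * heat s μ z
      = ∫⁻ z, ∫⁻ y, ENNReal.ofReal (heatKernel r (x - z)) *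
          ENNReal.ofReal (heatKernel s (z - y)) ∂μ :=
        lintegral_congr fun z => (lintegral_const_mul' _ _ ENNReal.ofReal_ne_top).symm
    _ = ∫⁻ y, (∫⁻ z, ENNReal.ofReal (heatKernel r (x - z)) *
          ENNReal.ofReal (heatKernel s (z - y))) ∂μ := lintegral_lintegral_swap (by fun_prop)
    _ = heat (r + s) μ x :=
        lintegral_congr fun y => lintegral_heatKernel_mul_heatKernel hr hs x y

theorem heatKernel_ge_of_norm_sq_le {t : ℝ} (ht : 0 < t) {x : EuclideanSpace ℝ (Fin N)}
    (hx : ‖x‖ ^ 2 ≤ t) :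
    1 / (4 * Real.pi * t) ^ ((N : ℝ) / 2) * Real.exp (-(1 / 4)) ≤ heatKernel t x := by
  unfold heatKernel
  gcongr
  rw [neg_div, neg_le_neg_iff, div_le_div_iff₀ (by positivity) (by positivity)]
  linarith

/-- The Lebesgue measure of the unit ball of `ℝ^N`, as a real number. -/
def unitBallVolume (N : ℕ) : ℝ := volume.real (Metric.ball (0 : EuclideanSpace ℝ (Fin N)) 1)

theorem unitBallVolume_pos (N : ℕ) : 0 < unitBallVolume N :=
  ENNReal.toReal_pos (Metric.measure_ball_pos _ _ one_pos).ne' measure_ball_lt_top.ne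

theorem volume_ball_eq (x : EuclideanSpace ℝ (Fin N)) {r : ℝ} (hr : 0 < r) :
    volume (Metric.ball x r) = ENNReal.ofReal (unitBallVolume N * r ^ N) := by
  rw [Measure.addHaar_ball_of_pos _ _ hr, finrank_euclideanSpace_fin, mul_comm,
    ENNReal.ofReal_mul (unitBallVolume_pos N).le, unitBallVolume, ofReal_measureReal]

/-- A lower bound for the mass that the heat flow started in a ball of radius `R` leaves in this
ball up to time `24 R²`. -/
def retainedMass (N : ℕ) : ℝ :=
  Real.exp (-(1 / 4)) * unitBallVolume N * (1 / (384 * Real.pi)) ^ ((N : ℝ) / 2)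

theorem retainedMass_pos (N : ℕ) : 0 < retainedMass N := by
  have := unitBallVolume_pos N
  unfold retainedMass
  positivity

theorem lintegral_closedBall_heatKernel_ge {R t : ℝ} (hR : 0 < R) (ht : 0 < t)
    (htR : t ≤ 24 * R ^ 2) {x : EuclideanSpace ℝ (Fin N)} (hx : ‖x‖ ≤ R) :
    ENNReal.ofReal (retainedMass N) ≤
      ∫⁻ y in Metric.closedBall 0 R, ENNReal.ofReal (heatKernel t (x - y)) := by
  have hπ := Real.pi_pos
  set r := min (√t) R with hr
  have hr_pos : 0 < r := lt_min (Real.sqrt_pos.2 ht) hR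
  have hr_sq : r ^ 2 ≤ t := (Real.le_sqrt' hr_pos).1 (min_le_left _ _)
  have ht_le : t ≤ 24 * r ^ 2 := by
    rcases min_choice (√t) R with h | h
    · rw [hr, h, Real.sq_sqrt ht.le]; linarith
    · rwa [hr, h]
  obtain ⟨c, hc⟩ := exists_ball_subset_closedBall_inter_closedBall hr_pos (min_le_right _ _) hx
  have h_kernel : ∀ y ∈ Metric.ball c (r / 2),
      ENNReal.ofReal (1 / (4 * Real.pi * t) ^ ((N : ℝ) / 2) * Real.exp (-(1 / 4))) ≤
        ENNReal.ofReal (heatKernel t (x - y)) := fun y hy => by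
    have hy_norm := mem_closedBall_iff_norm'.1 (hc hy).2
    exact ENNReal.ofReal_le_ofReal
      (heatKernel_ge_of_norm_sq_le ht ((by gcongr : ‖x - y‖ ^ 2 ≤ r ^ 2).trans hr_sq))
  have h_ratio : (1 / (384 * Real.pi)) ^ ((N : ℝ) / 2) ≤
      1 / (4 * Real.pi * t) ^ ((N : ℝ) / 2) * (r / 2) ^ N := by
    rw [show (r / 2) ^ N = ((r / 2) ^ 2) ^ ((N : ℝ) / 2) by
      rw [← Real.rpow_natCast_mul (by positivity), ← Real.rpow_natCast]
      congr 1; push_cast; ring, one_div_mul_eq_div, ← Real.div_rpow (by positivity) (by positivity)]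
    refine Real.rpow_le_rpow (by positivity) ?_ (by positivity)
    rw [div_le_div_iff₀ (by positivity) (by positivity)]
    nlinarith
  calc _ ≤ ENNReal.ofReal (1 / (4 * Real.pi * t) ^ ((N : ℝ) / 2) * Real.exp (-(1 / 4))) *
          volume (Metric.ball c (r / 2)) := by
        rw [volume_ball_eq c (by positivity), ← ENNReal.ofReal_mul (by positivity)]
        have hω := unitBallVolume_pos N
        refine ENNReal.ofReal_le_ofReal ((mul_le_mul_of_nonneg_left h_ratio ?_).trans_eq ?_)
        · positivity
        · ring
    _ ≤ ∫⁻ y in Metric.ball c (r / 2), ENNReal.ofReal (heatKernel t (x - y)) := by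
        rw [← setLIntegral_const]
        exact setLIntegral_mono' measurableSet_ball h_kernel
    _ ≤ _ := lintegral_mono_set fun y hy => (hc hy).1

/-! ### The heat flow of the decaying data -/

theorem setIntegral_ball_fun_norm {E : Type*} [NormedAddCommGroup E] [NormedSpace ℝ E]
    [FiniteDimensional ℝ E] [Nontrivial E] [MeasurableSpace E] [BorelSpace E] (μ : Measure E)
    [μ.IsAddHaarMeasure] (f : ℝ → ℝ) {ρ : ℝ} (hρ : 0 ≤ ρ) :
    ∫ x in Metric.ball 0 ρ, f ‖x‖ ∂μ = Module.finrank ℝ E • μ.real (Metric.ball 0 1) •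
      ∫ r in (0 : ℝ)..ρ, r ^ (Module.finrank ℝ E - 1) * f r := by
  have h_ball : (Metric.ball 0 ρ).indicator (fun x : E => f ‖x‖) =
      fun x => (Iio ρ).indicator f ‖x‖ := by
    ext x; simp [indicator]
  rw [← integral_indicator measurableSet_ball, h_ball, integral_fun_norm_addHaar,
    intervalIntegral.integral_of_le hρ, integral_Ioc_eq_integral_Ioo, ← Iio_inter_Ioi, inter_comm,
    ← setIntegral_indicator measurableSet_Iio]
  simp only [indicator, mem_Iio, smul_eq_mul, mul_ite, mul_zero]

theorem integrableOn_pow_mul_one_add_rpow (n : ℕ) (s ρ : ℝ) :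
    IntegrableOn (fun r : ℝ => r ^ n * (1 + r) ^ s) (Icc 0 ρ) :=
  ContinuousOn.integrableOn_Icc ((continuous_pow _).continuousOn.mul
    (ContinuousOn.rpow_const (by fun_prop) fun r hr => Or.inl (by linarith [hr.1])))

theorem integral_pow_mul_one_add_rpow_le_of_lt (hN : 1 ≤ N) {A ρ : ℝ} (hA : 0 < A) (h : A < N)
    (hρ : 0 ≤ ρ) :
    ∫ r in (0 : ℝ)..ρ, r ^ (N - 1) * (1 + r) ^ (-A) ≤ 1 / (N - A) * ρ ^ ((N : ℝ) - A) := by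
  have hNA : 0 < (N : ℝ) - A := by linarith
  have h_le := intervalIntegral.integral_le_sub_of_hasDeriv_right_of_le hρ
    (g := fun r => 1 / (N - A) * r ^ ((N : ℝ) - A)) (g' := fun r => r ^ ((N : ℝ) - A - 1))
    (φ := fun r => r ^ (N - 1) * (1 + r) ^ (-A))
    (continuousOn_const.mul (continuousOn_id.rpow_const fun _ _ => Or.inr hNA.le))
    (fun r hr => ?_) (integrableOn_pow_mul_one_add_rpow _ _ ρ) (fun r hr => ?_)
  · simpa [Real.zero_rpow hNA.ne'] using h_le
  · have h_deriv := (Real.hasDerivAt_rpow_const (p := (N : ℝ) - A)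
      (Or.inl hr.1.ne')).const_mul (1 / ((N : ℝ) - A))
    rw [← mul_assoc, one_div_mul_cancel hNA.ne', one_mul] at h_deriv
    exact h_deriv.hasDerivWithinAt
  · have hr_pos := hr.1
    rw [show (N : ℝ) - A - 1 = (N - 1 : ℕ) + -A by push_cast [Nat.cast_sub hN]; ring,
      Real.rpow_add hr_pos, Real.rpow_natCast]
    exact mul_le_mul_of_nonneg_left
      (Real.rpow_le_rpow_of_nonpos hr_pos (by linarith) (by linarith)) (by positivity)

theorem pow_mul_one_add_rpow_le (hN : 1 ≤ N) (A : ℝ) {r : ℝ} (hr : 0 ≤ r) :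
    r ^ (N - 1) * (1 + r) ^ (-A) ≤ (1 + r) ^ ((N : ℝ) - A - 1) := by
  rw [show (N : ℝ) - A - 1 = (N - 1 : ℕ) + -A by push_cast [Nat.cast_sub hN]; ring,
    Real.rpow_add (by positivity), Real.rpow_natCast]
  gcongr
  linarith

theorem integral_pow_mul_one_add_rpow_le_of_gt (hN : 1 ≤ N) {A ρ : ℝ} (h : N < A) (hρ : 0 ≤ ρ) :
    ∫ r in (0 : ℝ)..ρ, r ^ (N - 1) * (1 + r) ^ (-A) ≤ 1 / (A - N) := by
  have hAN : 0 < A - N := by linarith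
  have h_le := intervalIntegral.integral_le_sub_of_hasDeriv_right_of_le hρ
    (g := fun r => -(1 / (A - N) * (1 + r) ^ ((N : ℝ) - A)))
    (g' := fun r => (1 + r) ^ ((N : ℝ) - A - 1))
    (φ := fun r => r ^ (N - 1) * (1 + r) ^ (-A))
    (continuousOn_const.mul (ContinuousOn.rpow_const (by fun_prop)
      fun r hr => Or.inl (by linarith [hr.1]))).neg
    (fun r hr => ?_) (integrableOn_pow_mul_one_add_rpow _ _ ρ)
    (fun r hr => pow_mul_one_add_rpow_le hN A hr.1.le)
  · refine h_le.trans ?_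
    rw [add_zero, Real.one_rpow, mul_one, sub_neg_eq_add, neg_add_le_iff_le_add]
    exact le_add_of_nonneg_left (by positivity)
  · have h_deriv := ((((hasDerivAt_id r).const_add 1).rpow_const (p := (N : ℝ) - A)
      (Or.inl (by simp only [id]; linarith [hr.1]))).const_mul (1 / (A - N))).neg
    simp only [id, one_mul] at h_deriv
    refine (h_deriv.congr_deriv ?_).hasDerivWithinAt
    field_simp
    ring

theorem integral_pow_mul_one_add_rpow_le_log (hN : 1 ≤ N) {ρ : ℝ} (hρ : 0 ≤ ρ) :
    ∫ r in (0 : ℝ)..ρ, r ^ (N - 1) * (1 + r) ^ (-(N : ℝ)) ≤ Real.log (1 + ρ) := by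
  have h_le := intervalIntegral.integral_le_sub_of_hasDeriv_right_of_le hρ
    (g := fun r => Real.log (1 + r)) (g' := fun r => 1 / (1 + r))
    (φ := fun r => r ^ (N - 1) * (1 + r) ^ (-(N : ℝ)))
    (ContinuousOn.log (by fun_prop) fun r hr => by linarith [hr.1])
    (fun r hr => ?_) (integrableOn_pow_mul_one_add_rpow _ _ ρ) (fun r hr => ?_)
  · simpa using h_le
  · exact (((hasDerivAt_id r).const_add 1).log (by
      simp only [id]; linarith [hr.1])).hasDerivWithinAt
  · have h := pow_mul_one_add_rpow_le hN N hr.1.le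
    rwa [sub_self, zero_sub, Real.rpow_neg_one, ← one_div] at h

theorem le_integral_pow_mul_one_add_rpow (hN : 1 ≤ N) {ρ : ℝ} (hρ : 1 ≤ ρ) :
    (1 / 2 : ℝ) ^ N * Real.log ρ ≤
      ∫ r in (0 : ℝ)..ρ, r ^ (N - 1) * (1 + r) ^ (-(N : ℝ)) := by
  have h_int := integrableOn_pow_mul_one_add_rpow (N - 1) (-N) ρ
  have h_le := intervalIntegral.sub_le_integral_of_hasDeriv_right_of_le hρ
    (g := fun r => (1 / 2 : ℝ) ^ N * Real.log r) (g' := fun r => (1 / 2 : ℝ) ^ N * r⁻¹)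
    (φ := fun r => r ^ (N - 1) * (1 + r) ^ (-(N : ℝ)))
    (continuousOn_const.mul (ContinuousOn.log continuousOn_id fun r hr =>
      ne_of_gt (one_pos.trans_le hr.1)))
    (fun r hr => ((Real.hasDerivAt_log (by linarith [hr.1])).const_mul _).hasDerivWithinAt)
    (h_int.mono_set (Icc_subset_Icc_left zero_le_one)) (fun r hr => ?_)
  · simp only [Real.log_one, mul_zero, sub_zero] at h_le
    refine h_le.trans ?_
    rw [intervalIntegral.integral_of_le hρ, intervalIntegral.integral_of_le (by linarith)]
    refine setIntegral_mono_set (h_int.mono_set Ioc_subset_Icc_self) ?_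
      (Ioc_subset_Ioc_left zero_le_one).eventuallyLE
    filter_upwards [ae_restrict_mem measurableSet_Ioc] with r hr
    have := hr.1
    simp only [Pi.zero_apply]
    positivity
  · have hr_pos : 0 < r := by linarith [hr.1]
    calc (1 / 2 : ℝ) ^ N * r⁻¹ = r ^ (N - 1) * (r * 2) ^ (-(N : ℝ)) := by
          rw [Real.rpow_neg (by positivity), Real.rpow_natCast, mul_pow, one_div, inv_pow, mul_inv,
            ← pow_sub_one_mul (by lia : N ≠ 0) r]
          field_simp
      _ ≤ r ^ (N - 1) * (1 + r) ^ (-(N : ℝ)) := by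
          gcongr ?_ * ?_
          exact Real.rpow_le_rpow_of_nonpos (by positivity) (by linarith [hr.1]) (by simp)

/-- The mass of `(1+|y|)^{-A}` in the ball of radius `ρ`, which governs the heat flow of the initial
data at time `ρ²`. -/
def decayMass (N : ℕ) (A ρ : ℝ) : ℝ≥0∞ :=
  ∫⁻ y in Metric.ball (0 : EuclideanSpace ℝ (Fin N)) ρ, ENNReal.ofReal ((1 + ‖y‖) ^ (-A))

theorem decayMass_eq (hN : 1 ≤ N) (A : ℝ) {ρ : ℝ} (hρ : 0 ≤ ρ) :
    decayMass N A ρ = ENNReal.ofReal (N * (unitBallVolume N *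
      ∫ r in (0 : ℝ)..ρ, r ^ (N - 1) * (1 + r) ^ (-A))) := by
  have : Nonempty (Fin N) := ⟨⟨0, hN⟩⟩
  have h_cont : Continuous fun y : EuclideanSpace ℝ (Fin N) => (1 + ‖y‖) ^ (-A) :=
    Continuous.rpow_const (by fun_prop) fun y => Or.inl (by positivity)
  have h_polar := setIntegral_ball_fun_norm (E := EuclideanSpace ℝ (Fin N)) volume
    (fun r => (1 + r) ^ (-A)) hρ
  rw [finrank_euclideanSpace_fin, nsmul_eq_mul, smul_eq_mul] at h_polar
  rw [decayMass, ← ofReal_integral_eq_lintegral_ofReal ((h_cont.continuousOn.integrableOn_compact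
    (isCompact_closedBall 0 ρ)).mono_set Metric.ball_subset_closedBall)
    (ae_of_all _ fun y => by positivity), h_polar, unitBallVolume]

theorem exists_decayMass_le (hN : 1 ≤ N) {A : ℝ} (hA : 0 < A) (hAN : A ≠ N) :
    ∃ D : ℝ, 0 < D ∧ ∀ ρ : ℝ, 0 ≤ ρ →
      decayMass N A ρ ≤ ENNReal.ofReal (D * ρ ^ ((N : ℝ) - min A N)) := by
  have hω := unitBallVolume_pos N
  suffices h_integral : ∃ D : ℝ, 0 < D ∧ ∀ ρ : ℝ, 0 ≤ ρ →
      ∫ r in (0 : ℝ)..ρ, r ^ (N - 1) * (1 + r) ^ (-A) ≤ D * ρ ^ ((N : ℝ) - min A N) by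
    obtain ⟨D, hD, h_le⟩ := h_integral
    refine ⟨N * (unitBallVolume N * D), by positivity, fun ρ hρ => ?_⟩
    rw [decayMass_eq hN A hρ, mul_assoc, mul_assoc]
    gcongr
    exact h_le ρ hρ
  rcases lt_or_gt_of_ne hAN with h | h
  · refine ⟨1 / (N - A), one_div_pos.2 (by linarith), fun ρ hρ => ?_⟩
    rw [min_eq_left h.le]
    exact integral_pow_mul_one_add_rpow_le_of_lt hN hA h hρ
  · refine ⟨1 / (A - N), one_div_pos.2 (by linarith), fun ρ hρ => ?_⟩
    rw [min_eq_right h.le, sub_self, Real.rpow_zero, mul_one]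
    exact integral_pow_mul_one_add_rpow_le_of_gt hN h hρ

theorem decayMass_natCast_le_log (hN : 1 ≤ N) {ρ : ℝ} (hρ : 0 ≤ ρ) :
    decayMass N N ρ ≤ ENNReal.ofReal (N * (unitBallVolume N * Real.log (1 + ρ))) := by
  have hω := unitBallVolume_pos N
  rw [decayMass_eq hN N hρ]
  gcongr
  exact integral_pow_mul_one_add_rpow_le_log hN hρ

theorem le_decayMass {A : ℝ} (hA : 0 < A) {r ρ : ℝ} (hr : 0 < r) (hrρ : r ≤ ρ) :
    ENNReal.ofReal ((1 + r) ^ (-A) * (unitBallVolume N * r ^ N)) ≤ decayMass N A ρ := by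
  calc _ = ∫⁻ _ in Metric.ball (0 : EuclideanSpace ℝ (Fin N)) r,
        ENNReal.ofReal ((1 + r) ^ (-A)) := by
        rw [setLIntegral_const, volume_ball_eq _ hr, ENNReal.ofReal_mul (by positivity)]
    _ ≤ ∫⁻ y in Metric.ball (0 : EuclideanSpace ℝ (Fin N)) r,
        ENNReal.ofReal ((1 + ‖y‖) ^ (-A)) := by
        refine setLIntegral_mono' measurableSet_ball fun y hy => ENNReal.ofReal_le_ofReal ?_
        rw [mem_ball_zero_iff] at hy
        exact Real.rpow_le_rpow_of_nonpos (by positivity) (by linarith) (by linarith)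
    _ ≤ _ := lintegral_mono_set (Metric.ball_subset_ball hrρ)

theorem exists_le_decayMass (N : ℕ) {A : ℝ} (hA : 0 < A) :
    ∃ c : ℝ, 0 < c ∧ ∀ ρ : ℝ, 1 ≤ ρ →
      ENNReal.ofReal (c * ρ ^ ((N : ℝ) - min A N)) ≤ decayMass N A ρ := by
  have hω := unitBallVolume_pos N
  refine ⟨2 ^ (-A) * unitBallVolume N, by positivity, fun ρ hρ => ?_⟩
  have hρ_pos : 0 < ρ := by linarith
  rcases le_total A N with h | h
  · refine le_trans (ENNReal.ofReal_le_ofReal ?_) (le_decayMass hA hρ_pos le_rfl)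
    calc 2 ^ (-A) * unitBallVolume N * ρ ^ ((N : ℝ) - min A N)
        = (2 * ρ) ^ (-A) * (unitBallVolume N * ρ ^ N) := by
          rw [min_eq_left h, sub_eq_add_neg, Real.rpow_add hρ_pos, Real.rpow_natCast,
            Real.mul_rpow (by norm_num) hρ_pos.le]
          ring
      _ ≤ (1 + ρ) ^ (-A) * (unitBallVolume N * ρ ^ N) := mul_le_mul_of_nonneg_right
          (Real.rpow_le_rpow_of_nonpos (by positivity) (by linarith) (by linarith)) (by positivity)
  · refine le_trans (ENNReal.ofReal_le_ofReal ?_) (le_decayMass hA one_pos hρ)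
    rw [min_eq_right h, sub_self, Real.rpow_zero]
    norm_num

theorem exists_log_le_decayMass (hN : 1 ≤ N) :
    ∃ c : ℝ, 0 < c ∧ ∀ ρ : ℝ, 1 ≤ ρ → ENNReal.ofReal (c * Real.log ρ) ≤ decayMass N N ρ := by
  have hω := unitBallVolume_pos N
  refine ⟨N * (unitBallVolume N * (1 / 2 : ℝ) ^ N), by positivity, fun ρ hρ => ?_⟩
  rw [decayMass_eq hN N (by linarith), mul_assoc, mul_assoc]
  gcongr
  exact le_integral_pow_mul_one_add_rpow hN hρ

theorem heat_decayData_eq (A : ℝ) {κ : ℝ} (hκ : 0 ≤ κ) (t : ℝ) (x : EuclideanSpace ℝ (Fin N)) :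
    heat t (decayData N A κ) x = ENNReal.ofReal κ *
      ∫⁻ y, ENNReal.ofReal (heatKernel t (x - y)) * ENNReal.ofReal ((1 + ‖y‖) ^ (-A)) := by
  rw [decayData, heat_withDensity _ (by fun_prop), ← lintegral_const_mul' _ _ ENNReal.ofReal_ne_top]
  refine lintegral_congr fun y => ?_
  rw [ENNReal.ofReal_mul hκ, mul_left_comm]

theorem heat_decayData_le_ofReal {A κ t : ℝ} (hA : 0 < A) (hκ : 0 ≤ κ) (ht : 0 < t)
    (x : EuclideanSpace ℝ (Fin N)) : heat t (decayData N A κ) x ≤ ENNReal.ofReal κ := by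
  rw [heat_decayData_eq A hκ]
  refine mul_le_of_le_one_right' ?_
  rw [← lintegral_heatKernel_sub ht x]
  refine lintegral_mono fun y => mul_le_of_le_one_right' (ENNReal.ofReal_le_one.2 ?_)
  exact Real.rpow_le_one_of_one_le_of_nonpos (by linarith [norm_nonneg y]) (by linarith)

theorem heatKernel_le_rpow {t : ℝ} (ht : 0 < t) (x : EuclideanSpace ℝ (Fin N)) :
    heatKernel t x ≤ t ^ (-((N : ℝ) / 2)) := by
  have hπ := Real.pi_gt_three
  have h_exp : Real.exp (-‖x‖ ^ 2 / (4 * t)) ≤ 1 :=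
    Real.exp_le_one_iff.2 (div_nonpos_of_nonpos_of_nonneg (by simp) (by positivity))
  refine (mul_le_of_le_one_right (by positivity) h_exp).trans ?_
  rw [Real.rpow_neg ht.le, ← one_div]
  gcongr
  nlinarith

theorem heat_decayData_le_add {A κ t : ℝ} (hA : 0 < A) (hκ : 0 ≤ κ) (ht : 0 < t)
    (x : EuclideanSpace ℝ (Fin N)) :
    heat t (decayData N A κ) x ≤ ENNReal.ofReal κ *
      (ENNReal.ofReal (t ^ (-((N : ℝ) / 2))) * decayMass N A (√t) +
        ENNReal.ofReal ((1 + √t) ^ (-A))) := by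
  rw [heat_decayData_eq A hκ]
  gcongr
  rw [← lintegral_add_compl _ (measurableSet_ball (x := (0 : EuclideanSpace ℝ (Fin N))) (ε := √t))]
  refine add_le_add ?_ ?_
  · rw [decayMass, ← lintegral_const_mul' _ _ ENNReal.ofReal_ne_top]
    gcongr with y
    exact heatKernel_le_rpow ht _
  · calc _ ≤ ∫⁻ y in (Metric.ball 0 (√t))ᶜ, ENNReal.ofReal (heatKernel t (x - y)) *
            ENNReal.ofReal ((1 + √t) ^ (-A)) := by
          refine setLIntegral_mono' measurableSet_ball.compl fun y hy => ?_
          rw [mem_compl_iff, mem_ball_zero_iff, not_lt] at hy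
          gcongr _ * ENNReal.ofReal ?_
          exact Real.rpow_le_rpow_of_nonpos (by positivity) (by linarith) (by linarith)
      _ ≤ ∫⁻ y, ENNReal.ofReal (heatKernel t (x - y)) * ENNReal.ofReal ((1 + √t) ^ (-A)) :=
          setLIntegral_le_lintegral _ _
      _ = _ := by
          rw [lintegral_mul_const' _ _ ENNReal.ofReal_ne_top, lintegral_heatKernel_sub ht, one_mul]

theorem sqrt_rpow_neg {t : ℝ} (ht : 0 ≤ t) (a : ℝ) : (√t) ^ (-a) = t ^ (-(a / 2)) := by
  rw [Real.sqrt_eq_rpow, ← Real.rpow_mul ht]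
  congr 1; ring

theorem heat_decayData_le_of_decayMass_le {A a κ t D : ℝ} (hA : 0 < A) (ha : 0 ≤ a) (haA : a ≤ A)
    (hκ : 0 ≤ κ) (ht : 0 < t) (hD : 0 ≤ D)
    (h_mass : decayMass N A (√t) ≤ ENNReal.ofReal (D * (√t) ^ ((N : ℝ) - a)))
    (x : EuclideanSpace ℝ (Fin N)) :
    heat t (decayData N A κ) x ≤ ENNReal.ofReal (κ * ((D + 1) * t ^ (-(a / 2)))) := by
  have hs := Real.sqrt_pos.2 ht
  have h_far : (1 + √t) ^ (-A) ≤ t ^ (-(a / 2)) :=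
    calc (1 + √t) ^ (-A) ≤ (1 + √t) ^ (-a) :=
          Real.rpow_le_rpow_of_exponent_le (by linarith) (by linarith)
      _ ≤ (√t) ^ (-a) := Real.rpow_le_rpow_of_nonpos hs (by linarith) (by linarith)
      _ = t ^ (-(a / 2)) := sqrt_rpow_neg ht.le a
  have h_near : t ^ (-((N : ℝ) / 2)) * (D * (√t) ^ ((N : ℝ) - a)) = D * t ^ (-(a / 2)) := by
    rw [← sqrt_rpow_neg ht.le, ← sqrt_rpow_neg ht.le, mul_left_comm, ← Real.rpow_add hs]
    congr 2; ring
  refine (heat_decayData_le_add hA hκ ht x).trans ?_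
  rw [ENNReal.ofReal_mul hκ, add_mul, one_mul, ENNReal.ofReal_add (by positivity) (by positivity),
    ← h_near, ENNReal.ofReal_mul (p := t ^ (-((N : ℝ) / 2))) (by positivity)]
  gcongr

theorem exists_heat_decayData_le (hN : 1 ≤ N) {A : ℝ} (hA : 0 < A) (hAN : A ≠ N) :
    ∃ L : ℝ, 0 < L ∧ ∀ κ t : ℝ, 0 ≤ κ → 0 < t → ∀ x : EuclideanSpace ℝ (Fin N),
      heat t (decayData N A κ) x ≤ ENNReal.ofReal (κ * (L * t ^ (-(min A N / 2)))) := by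
  obtain ⟨D, hD, h_mass⟩ := exists_decayMass_le hN hA hAN
  exact ⟨D + 1, by positivity, fun κ t hκ ht =>
    heat_decayData_le_of_decayMass_le hA (le_min hA.le (Nat.cast_nonneg N)) (min_le_left _ _) hκ ht
      hD.le (h_mass _ (Real.sqrt_nonneg t))⟩

theorem exists_heat_decayData_le_log (hN : 1 ≤ N) :
    ∃ L : ℝ, 0 < L ∧ ∀ κ t : ℝ, 0 ≤ κ → 0 < t → ∀ x : EuclideanSpace ℝ (Fin N),
      heat t (decayData N N κ) x ≤
        ENNReal.ofReal (κ * (L * Real.log (2 + t) * t ^ (-((N : ℝ) / 2)))) := by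
  have hω := unitBallVolume_pos N
  have hN_pos : (0 : ℝ) < N := by exact_mod_cast hN
  refine ⟨N * unitBallVolume N + 2, by positivity, fun κ t hκ ht x => ?_⟩
  have h_log_pos : 0 < Real.log (2 + t) := Real.log_pos (by linarith)
  have h_one_le : 1 ≤ 2 * Real.log (2 + t) := by
    linarith [Real.log_le_log (x := 2) (y := 2 + t) (by norm_num) (by linarith),
      Real.log_two_gt_d9]
  have h_log_le : Real.log (1 + √t) ≤ Real.log (2 + t) :=
    Real.log_le_log (by positivity) (by nlinarith [Real.sq_sqrt ht.le, sq_nonneg (√t - 1)])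
  refine (heat_decayData_le_of_decayMass_le (a := N)
    (D := N * (unitBallVolume N * Real.log (2 + t))) hN_pos hN_pos.le le_rfl hκ ht (by positivity)
    ?_ x).trans ?_
  · rw [sub_self, Real.rpow_zero, mul_one]
    exact (decayMass_natCast_le_log hN (Real.sqrt_nonneg t)).trans (by gcongr)
  · gcongr
    linarith

theorem heat_decayData_ge {A κ t R : ℝ} (hκ : 0 ≤ κ) (ht : 0 < t)
    {x : EuclideanSpace ℝ (Fin N)} (hx : ‖x‖ ≤ R) :
    ENNReal.ofReal κ * (ENNReal.ofReal (1 / (4 * Real.pi * t) ^ ((N : ℝ) / 2) *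
      Real.exp (-(R ^ 2 / t))) * decayMass N A R) ≤ heat t (decayData N A κ) x := by
  rw [heat_decayData_eq A hκ]
  gcongr
  refine le_trans ?_ (setLIntegral_le_lintegral (Metric.ball 0 R) _)
  rw [decayMass, ← lintegral_const_mul' _ _ ENNReal.ofReal_ne_top]
  refine setLIntegral_mono' measurableSet_ball fun y hy => ?_
  rw [mem_ball_zero_iff] at hy
  have h_dist : ‖x - y‖ ^ 2 ≤ (2 * R) ^ 2 := by
    gcongr
    linarith [norm_sub_le x y]
  unfold heatKernel
  gcongr
  rw [neg_div, neg_le_neg_iff, div_le_div_iff₀ (by positivity) (by positivity)]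
  nlinarith

theorem heat_decayData_ge_of_parabolic {A κ t R m : ℝ} (hκ : 0 ≤ κ) (hR : 0 < R)
    (h_le : R ^ 2 / 4 ≤ t) (h_ge : t ≤ 24 * R ^ 2) (hm : ENNReal.ofReal m ≤ decayMass N A R)
    {x : EuclideanSpace ℝ (Fin N)} (hx : ‖x‖ ≤ R) :
    ENNReal.ofReal (κ * ((96 * Real.pi) ^ (-((N : ℝ) / 2)) * Real.exp (-4) *
      (R ^ (-(N : ℝ)) * m))) ≤ heat t (decayData N A κ) x := by
  have ht : 0 < t := lt_of_lt_of_le (by positivity) h_le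
  have h_scale : (96 * Real.pi) ^ (-((N : ℝ) / 2)) * R ^ (-(N : ℝ)) =
      1 / (4 * Real.pi * (24 * R ^ 2)) ^ ((N : ℝ) / 2) := by
    rw [← Real.sqrt_sq hR.le, sqrt_rpow_neg (sq_nonneg R), Real.sqrt_sq hR.le,
      ← Real.mul_rpow (by positivity) (by positivity), Real.rpow_neg (by positivity), one_div]
    ring_nf
  refine le_trans ?_ (heat_decayData_ge hκ ht hx)
  rw [ENNReal.ofReal_mul hκ, show (96 * Real.pi) ^ (-((N : ℝ) / 2)) * Real.exp (-4) *
      (R ^ (-(N : ℝ)) * m) = (96 * Real.pi) ^ (-((N : ℝ) / 2)) * R ^ (-(N : ℝ)) *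
      Real.exp (-4) * m by ring, h_scale, ENNReal.ofReal_mul (by positivity)]
  gcongr ENNReal.ofReal κ * (ENNReal.ofReal (?_ * ?_) * ?_)
  · gcongr
  · gcongr
    rw [div_le_iff₀ ht]
    linarith

/-! ### Amplification of lower bounds -/

theorem lintegral_sub_rpow {α a b : ℝ} (hα : 0 < α) (hab : a ≤ b) :
    ENNReal.ofReal α * ∫⁻ s in Ioo a b, ENNReal.ofReal ((b - s) ^ (α - 1)) =
      ENNReal.ofReal ((b - a) ^ α) := by
  have h_integrable : IntervalIntegrable (fun s => (b - s) ^ (α - 1)) volume a b := by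
    simpa using (intervalIntegral.intervalIntegrable_rpow' (r := α - 1) (a := b - a) (b := b - b)
      (by linarith)).comp_sub_left b
  have h_integral : ∫ s in Ioo a b, (b - s) ^ (α - 1) = (b - a) ^ α / α := by
    rw [← integral_Ioc_eq_integral_Ioo, ← intervalIntegral.integral_of_le hab,
      intervalIntegral.integral_comp_sub_left (fun x => x ^ (α - 1)), sub_self,
      integral_rpow (Or.inl (by linarith)), sub_add_cancel, Real.zero_rpow hα.ne', sub_zero]
  rw [← ofReal_integral_eq_lintegral_ofReal, h_integral, ← ENNReal.ofReal_mul hα.le,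
    mul_div_cancel₀ _ hα.ne']
  · exact ((intervalIntegrable_iff_integrableOn_Ioc_of_le hab).1 h_integrable).mono_set
      Ioo_subset_Ioc_self
  · filter_upwards [ae_restrict_mem measurableSet_Ioo] with s hs
    exact Real.rpow_nonneg (by linarith [hs.2]) _

theorem heat_withDensity_ge {R t : ℝ} (hR : 0 < R) (ht : 0 < t) (htR : t ≤ 24 * R ^ 2)
    {f : EuclideanSpace ℝ (Fin N) → ℝ≥0∞} (hf : Measurable f) {M : ℝ≥0∞}
    (hM : ∀ᵐ y ∂volume.restrict (Metric.closedBall 0 R), M ≤ f y)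
    {x : EuclideanSpace ℝ (Fin N)} (hx : ‖x‖ ≤ R) :
    ENNReal.ofReal (retainedMass N) * M ≤ heat t (volume.withDensity f) x := by
  rw [heat_withDensity _ hf]
  calc ENNReal.ofReal (retainedMass N) * M
      ≤ (∫⁻ y in Metric.closedBall 0 R, ENNReal.ofReal (heatKernel t (x - y))) * M := by
        gcongr
        exact lintegral_closedBall_heatKernel_ge hR ht htR hx
    _ = ∫⁻ y in Metric.closedBall 0 R, ENNReal.ofReal (heatKernel t (x - y)) * M := by
        rw [lintegral_mul_const _ (by fun_prop)]
    _ ≤ ∫⁻ y in Metric.closedBall 0 R, ENNReal.ofReal (heatKernel t (x - y)) * f y :=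
        lintegral_mono_ae (hM.mono fun y hy => by gcongr)
    _ ≤ _ := setLIntegral_le_lintegral _ _

theorem opS_withDensity_ge {α r R : ℝ} (hα : α ∈ Ioo (0 : ℝ) 1) (hr : 0 < r) (hR : 0 < R)
    (hrR : r ^ α ≤ R ^ 2) {f : EuclideanSpace ℝ (Fin N) → ℝ≥0∞} (hf : Measurable f) {M : ℝ≥0∞}
    (hM : ∀ᵐ y ∂volume.restrict (Metric.closedBall 0 R), M ≤ f y)
    {x : EuclideanSpace ℝ (Fin N)} (hx : ‖x‖ ≤ R) :
    ENNReal.ofReal (1 / 4) * (ENNReal.ofReal (retainedMass N) * M) ≤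
      opS α r (volume.withDensity f) x := by
  rw [opS_eq_lintegral]
  calc _ ≤ ∫⁻ _ in Ioc (1 / 2) 24, ENNReal.ofReal (retainedMass N) * M ∂biasedWrightMeasure α := by
        rw [setLIntegral_const, mul_comm]
        gcongr
        exact biasedWrightMeasure_Ioc_ge hα
    _ ≤ ∫⁻ θ in Ioc (1 / 2) 24, heat (r ^ α * θ) (volume.withDensity f) x
          ∂biasedWrightMeasure α := by
        refine setLIntegral_mono' measurableSet_Ioc fun θ hθ => ?_
        have hθ_pos : 0 < θ := by linarith [hθ.1]
        exact heat_withDensity_ge hR (by positivity) (by nlinarith [hθ.2]) hf hM hx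
    _ ≤ _ := setLIntegral_le_lintegral _ _

/-- The parabolic cylinder `(t₀, T] × B̄(0, R)`, where lower bounds of a solution are amplified. -/
def cylinder (N : ℕ) (t₀ T R : ℝ) : Set (ℝ × EuclideanSpace ℝ (Fin N)) :=
  Ioc t₀ T ×ˢ Metric.closedBall 0 R

theorem measurableSet_cylinder {t₀ T R : ℝ} : MeasurableSet (cylinder N t₀ T R) :=
  measurableSet_Ioc.prod measurableSet_closedBall

theorem cylinder_subset_of_le {t₀ t₁ : ℝ} (h : t₀ ≤ t₁) (T R : ℝ) :
    cylinder N t₁ T R ⊆ cylinder N t₀ T R :=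
  prod_mono (Ioc_subset_Ioc_left h) le_rfl

theorem cylinder_subset_strip {t₀ : ℝ} (h : 0 ≤ t₀) (T R : ℝ) :
    cylinder N t₀ T R ⊆ Ioc (0 : ℝ) T ×ˢ univ :=
  prod_mono (Ioc_subset_Ioc_left h) (subset_univ _)

theorem volume_cylinder_pos {t₀ T R : ℝ} (hT : t₀ < T) (hR : 0 < R) :
    0 < volume (cylinder N t₀ T R) := by
  rw [cylinder, Measure.volume_eq_prod, Measure.prod_prod, Real.volume_Ioc]
  exact ENNReal.mul_pos (ENNReal.ofReal_pos.2 (sub_pos.2 hT)).ne'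
    (Metric.measure_closedBall_pos _ _ hR).ne'

theorem ae_restrict_cylinder_slices {t₀ T R : ℝ} {P : ℝ × EuclideanSpace ℝ (Fin N) → Prop}
    (h : ∀ᵐ z ∂volume.restrict (cylinder N t₀ T R), P z) :
    ∀ᵐ s ∂volume.restrict (Ioc t₀ T),
      ∀ᵐ y ∂volume.restrict (Metric.closedBall (0 : EuclideanSpace ℝ (Fin N)) R), P (s, y) := by
  rw [cylinder, Measure.volume_eq_prod, ← Measure.prod_restrict] at h
  exact Measure.ae_ae_of_ae_prod h

theorem lintegral_opS_withDensity_ge {α t₀ T R t : ℝ} (hα : α ∈ Ioo (0 : ℝ) 1)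
    (hTR : T ^ α ≤ R ^ 2) (hR : 0 < R) (h0 : 0 ≤ t₀) (ht : t ∈ Ioc t₀ T) {M : ℝ≥0∞}
    {f : ℝ → EuclideanSpace ℝ (Fin N) → ℝ≥0∞} (hf : ∀ s, Measurable (f s))
    (hM : ∀ᵐ s ∂volume.restrict (Ioc t₀ T),
      ∀ᵐ y ∂volume.restrict (Metric.closedBall 0 R), M ≤ f s y)
    {x : EuclideanSpace ℝ (Fin N)} (hx : ‖x‖ ≤ R) :
    ENNReal.ofReal ((t - t₀) ^ α) *
        (ENNReal.ofReal (1 / 4) * (ENNReal.ofReal (retainedMass N) * M)) ≤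
      ENNReal.ofReal α * ∫⁻ s in Ioo 0 t, ENNReal.ofReal ((t - s) ^ (α - 1)) *
        opS α (t - s) (volume.withDensity (f s)) x := by
  rw [← lintegral_sub_rpow hα.1 ht.1.le, mul_assoc]
  refine mul_le_mul_right (le_trans ?_ (lintegral_mono_set (Ioo_subset_Ioo_left h0))) _
  rw [← lintegral_mul_const _ (by fun_prop)]
  have h_sub : Ioo t₀ t ⊆ Ioc t₀ T := fun s hs => ⟨hs.1, hs.2.le.trans ht.2⟩
  refine lintegral_mono_ae ?_
  filter_upwards [ae_restrict_of_ae_restrict_of_subset h_sub hM,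
    ae_restrict_mem measurableSet_Ioo] with s hs hs_mem
  have h_time : (t - s) ^ α ≤ T ^ α :=
    Real.rpow_le_rpow (by linarith [hs_mem.2]) (by linarith [hs_mem.1, ht.2]) hα.1.le
  gcongr
  exact opS_withDensity_ge hα (by linarith [hs_mem.2]) hR (h_time.trans hTR) (hf s) hs hx

theorem IsSolution.amplify {α p T R t₀ t₁ m : ℝ} (hα : α ∈ Ioo (0 : ℝ) 1) (hp : 0 ≤ p)
    (hTR : T ^ α ≤ R ^ 2) (hR : 0 < R) (h0 : 0 ≤ t₀) (h01 : t₀ < t₁) (hm : 0 ≤ m)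
    {μ : Measure (EuclideanSpace ℝ (Fin N))} {u : ℝ × EuclideanSpace ℝ (Fin N) → ℝ≥0∞}
    (hu : IsSolution α p T μ u)
    (h_low : ∀ᵐ z ∂volume.restrict (cylinder N t₀ T R), ENNReal.ofReal m ≤ u z) :
    ∀ᵐ z ∂volume.restrict (cylinder N t₁ T R),
      ENNReal.ofReal (retainedMass N / 4 * m ^ p * (t₁ - t₀) ^ α) ≤ u z := by
  have hc := retainedMass_pos N
  have h_slices : ∀ᵐ s ∂volume.restrict (Ioc t₀ T),
      ∀ᵐ y ∂volume.restrict (Metric.closedBall (0 : EuclideanSpace ℝ (Fin N)) R),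
        ENNReal.ofReal (m ^ p) ≤ u (s, y) ^ p := by
    refine ae_restrict_cylinder_slices (P := fun z => ENNReal.ofReal (m ^ p) ≤ u z ^ p) ?_
    filter_upwards [h_low] with z hz
    rw [← ENNReal.ofReal_rpow_of_nonneg hm hp]
    gcongr
  filter_upwards [ae_restrict_of_ae_restrict_of_subset
      (cylinder_subset_strip (h0.trans h01.le) T R) hu.2,
    ae_restrict_mem measurableSet_cylinder] with z hz ⟨hz_time, hz_space⟩
  rw [mem_closedBall_zero_iff] at hz_space
  rw [hz.2]
  refine le_add_left (le_trans ?_ (lintegral_opS_withDensity_ge hα hTR hR h0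
    ⟨h01.trans hz_time.1, hz_time.2⟩
    (fun s => (hu.1.comp measurable_prodMk_left).pow_const p) h_slices hz_space))
  rw [← ENNReal.ofReal_mul hc.le, ← ENNReal.ofReal_mul (by norm_num),
    ← ENNReal.ofReal_mul (Real.rpow_nonneg (by linarith [hz_time.1]) _)]
  refine ENNReal.ofReal_le_ofReal ?_
  calc retainedMass N / 4 * m ^ p * (t₁ - t₀) ^ α
      ≤ retainedMass N / 4 * m ^ p * (z.1 - t₀) ^ α := by
        have hα_pos := hα.1
        have := hz_time.1.le
        gcongr
    _ = _ := by ring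

theorem mul_pow_succ_le_amplified {α c p R T m q : ℝ} (hα : α ∈ Ioo (0 : ℝ) 1) (hc : 0 < c)
    (hT : 0 < T) (hTR : T ^ α = R ^ 2) (hm : 0 < m) (hq : 0 < q) (hqp : q ^ p = q * 2)
    (h_large : q ≤ c * R ^ 2 / 32 * m ^ (p - 1)) (n : ℕ) :
    m * q ^ (n + 1) ≤ c / 4 * (m * q ^ n) ^ p * (T * ((1 / 2) ^ n / 8)) ^ α := by
  have h_increment : (1 / 2 : ℝ) ^ n / 8 ≤ ((1 / 2 : ℝ) ^ n / 8) ^ α := by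
    have h_le_one : (1 / 2 : ℝ) ^ n ≤ 1 := pow_le_one₀ (by norm_num) (by norm_num)
    simpa using Real.rpow_le_rpow_of_exponent_ge (x := (1 / 2 : ℝ) ^ n / 8) (by positivity)
      (by linarith) hα.2.le
  have h_power : (m * q ^ n) ^ p = m * m ^ (p - 1) * (q ^ n * 2 ^ n) := by
    rw [Real.mul_rpow hm.le (by positivity), ← Real.rpow_natCast_mul hq.le, mul_comm (n : ℝ),
      Real.rpow_mul_natCast hq.le, hqp, mul_pow, Real.rpow_sub_one hm.ne', mul_div_cancel₀ _ hm.ne']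
  have h_two : (2 : ℝ) ^ n * (1 / 2 : ℝ) ^ n = 1 := by rw [← mul_pow]; norm_num
  rw [Real.mul_rpow hT.le (by positivity), h_power, hTR]
  calc m * q ^ (n + 1) = m * q ^ n * q := by rw [pow_succ]; ring
    _ ≤ m * q ^ n * (c * R ^ 2 / 32 * m ^ (p - 1)) := by gcongr
    _ = c / 4 * (m * m ^ (p - 1) * (q ^ n * 2 ^ n)) * (R ^ 2 * ((1 / 2) ^ n / 8)) := by
        linear_combination (-(m * q ^ n * (c * R ^ 2 / 32 * m ^ (p - 1)))) * h_two
    _ ≤ _ := by gcongr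

/-- The `n`-th amplification uses up a time `T 2⁻ⁿ/8`; since `q ^ p = 2 q`, the factor `2 ⁿ` gained
from the nonlinearity makes up for it. -/
theorem IsSolution.mul_pow_le {α p T R m q : ℝ} (hα : α ∈ Ioo (0 : ℝ) 1) (hp : 0 ≤ p)
    (hT : 0 < T) (hR : 0 < R) (hTR : T ^ α = R ^ 2) (hm : 0 < m) (hq : 0 < q)
    (hqp : q ^ p = q * 2) (h_large : q ≤ retainedMass N * R ^ 2 / 32 * m ^ (p - 1))
    {μ : Measure (EuclideanSpace ℝ (Fin N))} {u : ℝ × EuclideanSpace ℝ (Fin N) → ℝ≥0∞}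
    (hu : IsSolution α p T μ u)
    (h_low : ∀ᵐ z ∂volume.restrict (cylinder N (T / 2) T R), ENNReal.ofReal m ≤ u z) (n : ℕ) :
    ∀ᵐ z ∂volume.restrict (cylinder N (T * (3 / 4 - (1 / 2) ^ n / 4)) T R),
      ENNReal.ofReal (m * q ^ n) ≤ u z := by
  induction n with
  | zero =>
    rw [show T * (3 / 4 - (1 / 2) ^ 0 / 4) = T / 2 by ring]
    simpa using h_low
  | succ n ih =>
    have h_pow_le : (1 / 2 : ℝ) ^ n ≤ 1 := pow_le_one₀ (by norm_num) (by norm_num)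
    have h_step : T * (3 / 4 - (1 / 2) ^ (n + 1) / 4) - T * (3 / 4 - (1 / 2) ^ n / 4) =
        T * ((1 / 2) ^ n / 8) := by rw [pow_succ]; ring
    filter_upwards [hu.amplify hα hp hTR.le hR (mul_nonneg hT.le (by linarith))
      (sub_pos.1 (by rw [h_step]; positivity)) (by positivity) ih] with z hz
    rw [h_step] at hz
    exact (ENNReal.ofReal_le_ofReal (mul_pow_succ_le_amplified hα (retainedMass_pos N) hT hTR hm hq
      hqp h_large n)).trans hz

theorem eq_zero_of_ae_mul_pow_le {X : Type*} [MeasurableSpace X] {ν : Measure X} {u : X → ℝ≥0∞}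
    {m q : ℝ} (hm : 0 < m) (hq : 1 < q) (h_fin : ∀ᵐ x ∂ν, u x < ∞)
    (h_le : ∀ n : ℕ, ∀ᵐ x ∂ν, ENNReal.ofReal (m * q ^ n) ≤ u x) : ν = 0 := by
  rw [← ae_eq_bot, ← eventually_false_iff_eq_bot]
  filter_upwards [ae_all_iff.2 h_le, h_fin] with x hx hx_fin
  obtain ⟨n, hn⟩ := pow_unbounded_of_one_lt ((u x).toReal / m) hq
  rw [div_lt_iff₀' hm] at hn
  exact hn.not_ge ((ENNReal.ofReal_le_iff_le_toReal hx_fin.ne).1 (hx n))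

theorem IsSolution.mul_rpow_lt {α p T R m : ℝ} (hα : α ∈ Ioo (0 : ℝ) 1) (hp : 1 < p) (hT : 0 < T)
    (hR : 0 < R) (hTR : T ^ α = R ^ 2) (hm : 0 < m) {μ : Measure (EuclideanSpace ℝ (Fin N))}
    {u : ℝ × EuclideanSpace ℝ (Fin N) → ℝ≥0∞} (hu : IsSolution α p T μ u)
    (h_low : ∀ t ∈ Ioc (T / 2) T, ∀ x : EuclideanSpace ℝ (Fin N), ‖x‖ ≤ R →
      ENNReal.ofReal m ≤ opP α t μ x) :
    retainedMass N * R ^ 2 / 32 * m ^ (p - 1) < 2 ^ (1 / (p - 1)) := by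
  by_contra! h_large
  have hp_pos : 0 < p - 1 := by linarith
  set q : ℝ := 2 ^ (1 / (p - 1)) with hq_def
  have hq : 1 < q := Real.one_lt_rpow (by norm_num) (by positivity)
  have hq_pos : 0 < q := one_pos.trans hq
  have hqp : q ^ p = q * 2 := by
    rw [← add_sub_cancel 1 p, Real.rpow_add hq_pos, Real.rpow_one, hq_def,
      ← Real.rpow_mul (by norm_num), one_div_mul_cancel hp_pos.ne', Real.rpow_one]
  have h_start : ∀ᵐ z ∂volume.restrict (cylinder N (T / 2) T R), ENNReal.ofReal m ≤ u z := by
    filter_upwards [ae_restrict_of_ae_restrict_of_subset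
        (cylinder_subset_strip (half_pos hT).le T R) hu.2,
      ae_restrict_mem measurableSet_cylinder] with z hz ⟨hz_time, hz_space⟩
    rw [hz.2]
    exact le_add_right (h_low _ hz_time _ (mem_closedBall_zero_iff.1 hz_space))
  have h_zero : volume.restrict (cylinder N (T * (3 / 4)) T R) = 0 := by
    refine eq_zero_of_ae_mul_pow_le hm hq
      ((ae_restrict_of_ae_restrict_of_subset (cylinder_subset_strip (by positivity) T R) hu.2).mono
        fun z hz => hz.1) fun n => ae_restrict_of_ae_restrict_of_subset
          (cylinder_subset_of_le (by gcongr; exact sub_le_self _ (by positivity)) T R)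
          (hu.mul_pow_le hα (by linarith) hT hR hTR hm hq_pos hqp h_large h_start n)
  exact (volume_cylinder_pos (by linarith) hR).ne' (Measure.restrict_eq_zero.1 h_zero)

theorem opP_decayData_ge {A α κ T R m t : ℝ} (hα : α ∈ Ioo (0 : ℝ) 1) (hκ : 0 ≤ κ) (hR : 0 < R)
    (hTR : T ^ α = R ^ 2) (hm : ENNReal.ofReal m ≤ decayMass N A R) (hT : 0 < T)
    (ht : t ∈ Ioc (T / 2) T) {x : EuclideanSpace ℝ (Fin N)} (hx : ‖x‖ ≤ R) :
    ENNReal.ofReal (κ * ((96 * Real.pi) ^ (-((N : ℝ) / 2)) * Real.exp (-4) *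
      (R ^ (-(N : ℝ)) * m))) * ENNReal.ofReal (1 / 96) ≤ opP α t (decayData N A κ) x := by
  have ht_pos : 0 < t := (half_pos hT).trans ht.1
  have h_upper : t ^ α ≤ R ^ 2 := hTR ▸ Real.rpow_le_rpow ht_pos.le ht.2 hα.1.le
  have h_lower : R ^ 2 / 2 ≤ t ^ α := by
    calc R ^ 2 / 2 = T ^ α * (1 / 2) ^ (1 : ℝ) := by rw [Real.rpow_one, hTR]; ring
      _ ≤ T ^ α * (1 / 2) ^ α := mul_le_mul_of_nonneg_left
          (Real.rpow_le_rpow_of_exponent_ge (by norm_num) (by norm_num) hα.2.le) (by positivity)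
      _ = (T / 2) ^ α := by rw [← Real.mul_rpow hT.le (by norm_num), mul_one_div]
      _ ≤ t ^ α := Real.rpow_le_rpow (half_pos hT).le ht.1.le hα.1.le
  rw [opP_eq_lintegral]
  calc _ ≤ ∫⁻ _ in Ioc (1 / 2) 24, ENNReal.ofReal (κ * ((96 * Real.pi) ^ (-((N : ℝ) / 2)) *
          Real.exp (-4) * (R ^ (-(N : ℝ)) * m))) ∂wrightMeasure α := by
        rw [setLIntegral_const]
        gcongr
        exact wrightMeasure_Ioc_ge hα
    _ ≤ ∫⁻ θ in Ioc (1 / 2) 24, heat (t ^ α * θ) (decayData N A κ) x ∂wrightMeasure α := by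
        refine setLIntegral_mono' measurableSet_Ioc fun θ hθ => ?_
        refine heat_decayData_ge_of_parabolic hκ hR ?_ ?_ hm hx
        · nlinarith [hθ.1, sq_nonneg R]
        · nlinarith [hθ.1, hθ.2, sq_nonneg R]
    _ ≤ _ := setLIntegral_le_lintegral _ _

theorem exists_mul_le_of_isSolution (N : ℕ) {p A : ℝ} (hp : 1 < p) :
    ∃ C : ℝ, 0 < C ∧ ∀ α ∈ Ioo (0 : ℝ) 1, ∀ κ T R m : ℝ, 0 < κ → 0 < T → 0 < R → T ^ α = R ^ 2 →
      0 < m → ENNReal.ofReal m ≤ decayMass N A R →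
      (∃ u, IsSolution α p T (decayData N A κ) u) → κ * m * R ^ (2 / (p - 1) - N) ≤ C := by
  have hp_pos : 0 < p - 1 := by linarith
  have hc := retainedMass_pos N
  set K := (96 * Real.pi) ^ (-((N : ℝ) / 2)) * Real.exp (-4)
  set Q : ℝ := 32 * 2 ^ (1 / (p - 1)) / retainedMass N with hQ_def
  have hK : 0 < K := by positivity
  have hQ : 0 < Q := by positivity
  refine ⟨Q ^ (1 / (p - 1)) * (96 / K), by positivity, ?_⟩
  rintro α hα κ T R m hκ hT hR hTR hm hmR ⟨u, hu⟩
  set m₀ := κ * (K * (R ^ (-(N : ℝ)) * m)) * (1 / 96) with hm₀_def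
  have hm₀ : 0 < m₀ := by positivity
  have h_lt := hu.mul_rpow_lt hα hp hT hR hTR hm₀ fun t ht x hx => by
    rw [hm₀_def, ENNReal.ofReal_mul (by positivity)]
    exact opP_decayData_ge hα hκ.le hR hTR hmR hT ht hx
  have h_bound : m₀ * R ^ (2 / (p - 1)) ≤ Q ^ (1 / (p - 1)) := by
    rw [one_div, Real.le_rpow_inv_iff_of_pos (by positivity) hQ.le hp_pos,
      Real.mul_rpow hm₀.le (by positivity), ← Real.rpow_mul hR.le, div_mul_cancel₀ _ hp_pos.ne',
      hQ_def, le_div_iff₀ hc, Real.rpow_two]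
    linarith
  calc κ * m * R ^ (2 / (p - 1) - N) = m₀ * R ^ (2 / (p - 1)) * (96 / K) := by
        rw [sub_eq_add_neg, Real.rpow_add hR, hm₀_def]
        field_simp
    _ ≤ _ := by gcongr

/-! ### Monotone iteration -/

section Hammerstein

variable {X : Type*} [MeasurableSpace X] {ν : Measure X} {k : X → X → ℝ≥0∞} {f u v : X → ℝ≥0∞}
  {p : ℝ}

/-- The right-hand side of the Hammerstein integral equation `u = f + ∫ k(·, q) u(q)^p dν(q)`. -/
def hammersteinMap (ν : Measure X) (k : X → X → ℝ≥0∞) (f : X → ℝ≥0∞) (p : ℝ) (u : X → ℝ≥0∞)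
    (z : X) : ℝ≥0∞ :=
  f z + ∫⁻ q, k z q * u q ^ p ∂ν

/-- The iterates from `0` of the Hammerstein map, whose supremum is its smallest fixed point. -/
def hammersteinIterate (ν : Measure X) (k : X → X → ℝ≥0∞) (f : X → ℝ≥0∞) (p : ℝ) :
    ℕ → X → ℝ≥0∞
  | 0 => 0
  | n + 1 => hammersteinMap ν k f p (hammersteinIterate ν k f p n)

theorem measurable_hammersteinMap [SFinite ν] (hk : Measurable (Function.uncurry k))
    (hf : Measurable f) (hu : Measurable u) : Measurable (hammersteinMap ν k f p u) :=
  hf.add (Measurable.lintegral_prod_right' (hk.mul ((hu.comp measurable_snd).pow_const p)))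

theorem measurable_hammersteinIterate [SFinite ν] (hk : Measurable (Function.uncurry k))
    (hf : Measurable f) (n : ℕ) : Measurable (hammersteinIterate ν k f p n) := by
  induction n with
  | zero => exact measurable_const
  | succ n ih => exact measurable_hammersteinMap hk hf ih

theorem hammersteinMap_le_of_ae_le {S : Set X} (hS : MeasurableSet S) (hp : 0 ≤ p) {z : X}
    (hk : ∀ q ∉ S, k z q = 0) (h : ∀ᵐ q ∂ν.restrict S, u q ≤ v q) :
    hammersteinMap ν k f p u z ≤ hammersteinMap ν k f p v z := by
  refine add_le_add le_rfl (lintegral_mono_ae ?_)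
  filter_upwards [(ae_restrict_iff' hS).1 h] with q hq
  by_cases hqS : q ∈ S
  · gcongr
    exact hq hqS
  · simp only [hk q hqS, zero_mul, le_refl]

theorem monotone_hammersteinIterate (hp : 0 ≤ p) : Monotone (hammersteinIterate ν k f p) := by
  refine monotone_nat_of_le_succ fun n => ?_
  induction n with
  | zero => exact fun _ => zero_le
  | succ n ih =>
    exact fun z => hammersteinMap_le_of_ae_le MeasurableSet.univ hp
      (fun q hq => absurd (mem_univ q) hq) (ae_of_all _ ih)

theorem hammersteinMap_iSup [SFinite ν] (hp : 0 < p) (hk : Measurable (Function.uncurry k))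
    (hf : Measurable f) (z : X) :
    hammersteinMap ν k f p (fun q => ⨆ n, hammersteinIterate ν k f p n q) z =
      ⨆ n, hammersteinIterate ν k f p n z := by
  have h_mono := monotone_hammersteinIterate (ν := ν) (k := k) (f := f) hp.le
  have h_iSup (q : X) : k z q * (⨆ n, hammersteinIterate ν k f p n q) ^ p =
      ⨆ n, k z q * hammersteinIterate ν k f p n q ^ p := by
    rw [← ENNReal.mul_iSup]
    exact congrArg _ ((ENNReal.orderIsoRpow p hp).map_iSup _)
  calc _ = ⨆ n, hammersteinIterate ν k f p (n + 1) z := by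
        simp only [hammersteinMap, h_iSup, hammersteinIterate]
        rw [lintegral_iSup, ENNReal.add_iSup]
        · exact fun n => (hk.comp measurable_prodMk_left).mul
            ((measurable_hammersteinIterate hk hf n).pow_const p)
        · intro i j hij q
          dsimp only
          gcongr
          exact h_mono hij q
    _ = _ := Monotone.iSup_nat_add (f := fun n => hammersteinIterate ν k f p n z)
        (fun i j hij => h_mono hij z) 1

theorem ae_iSup_hammersteinIterate_le {S : Set X} (hS : MeasurableSet S) (hp : 0 ≤ p)
    (hk : ∀ z ∈ S, ∀ q ∉ S, k z q = 0)
    (hv : ∀ᵐ z ∂ν.restrict S, hammersteinMap ν k f p v z ≤ v z) :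
    ∀ᵐ z ∂ν.restrict S, ⨆ n, hammersteinIterate ν k f p n z ≤ v z := by
  suffices h_le : ∀ n, ∀ᵐ z ∂ν.restrict S, hammersteinIterate ν k f p n z ≤ v z by
    filter_upwards [ae_all_iff.2 h_le] with z hz using iSup_le hz
  intro n
  induction n with
  | zero => exact ae_of_all _ fun z => zero_le
  | succ n ih =>
    filter_upwards [hv, ae_restrict_mem hS] with z hz hzS
    exact (hammersteinMap_le_of_ae_le hS hp (hk z hzS) ih).trans hz

end Hammerstein

/-- The kernel of the Duhamel term of the time-fractional heat equation, as a weight on the past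
points `q` of the space-time point `z`. -/
def duhamelKernel (α : ℝ) (z q : ℝ × EuclideanSpace ℝ (Fin N)) : ℝ≥0∞ :=
  if q.1 ∈ Ioo 0 z.1 then
    ENNReal.ofReal α * (ENNReal.ofReal ((z.1 - q.1) ^ (α - 1)) *
      ∫⁻ η, ENNReal.ofReal (heatKernel ((z.1 - q.1) ^ α * η) (z.2 - q.2)) ∂biasedWrightMeasure α)
  else 0

theorem measurable_duhamelKernel (α : ℝ) :
    Measurable (Function.uncurry (duhamelKernel α :
      ℝ × EuclideanSpace ℝ (Fin N) → ℝ × EuclideanSpace ℝ (Fin N) → ℝ≥0∞)) := by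
  unfold duhamelKernel Function.uncurry
  refine Measurable.ite ((measurableSet_lt measurable_const measurable_snd.fst).inter
    (measurableSet_lt measurable_snd.fst measurable_fst.fst))
    (measurable_const.mul (Measurable.mul (by fun_prop) ?_)) measurable_const
  exact Measurable.lintegral_prod_right'
    (f := fun w : ((ℝ × EuclideanSpace ℝ (Fin N)) × (ℝ × EuclideanSpace ℝ (Fin N))) × ℝ =>
      ENNReal.ofReal (heatKernel ((w.1.1.1 - w.1.2.1) ^ α * w.2) (w.1.1.2 - w.1.2.2)))
    (by fun_prop)

theorem opS_withDensity (α r : ℝ) {f : EuclideanSpace ℝ (Fin N) → ℝ≥0∞} (hf : Measurable f)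
    (x : EuclideanSpace ℝ (Fin N)) :
    opS α r (volume.withDensity f) x =
      ∫⁻ y, (∫⁻ η, ENNReal.ofReal (heatKernel (r ^ α * η) (x - y)) ∂biasedWrightMeasure α) *
        f y := by
  simp only [opS_eq_lintegral, heat_withDensity _ hf]
  rw [lintegral_lintegral_swap (by fun_prop)]
  exact lintegral_congr fun y => lintegral_mul_const _ (by fun_prop)

theorem lintegral_duhamelKernel_mul (α : ℝ) {f : ℝ × EuclideanSpace ℝ (Fin N) → ℝ≥0∞}
    (hf : Measurable f) (z : ℝ × EuclideanSpace ℝ (Fin N)) :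
    ∫⁻ q, duhamelKernel α z q * f q = ENNReal.ofReal α * ∫⁻ s in Ioo (0 : ℝ) z.1,
      ENNReal.ofReal ((z.1 - s) ^ (α - 1)) *
        opS α (z.1 - s) (volume.withDensity fun y => f (s, y)) z.2 := by
  have h_meas : Measurable fun q => duhamelKernel α z q * f q :=
    ((measurable_duhamelKernel α).comp measurable_prodMk_left).mul hf
  rw [Measure.volume_eq_prod, lintegral_prod _ h_meas.aemeasurable,
    ← lintegral_const_mul' _ _ ENNReal.ofReal_ne_top, ← lintegral_indicator measurableSet_Ioo]
  refine lintegral_congr fun s => ?_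
  by_cases hs : s ∈ Ioo 0 z.1
  · rw [indicator_of_mem hs, opS_withDensity (f := fun y => f (s, y)) _ _ (by fun_prop),
      ← lintegral_const_mul' _ _ ENNReal.ofReal_ne_top,
      ← lintegral_const_mul' _ _ ENNReal.ofReal_ne_top]
    exact lintegral_congr fun y => by simp only [duhamelKernel, if_pos hs, mul_assoc]
  · rw [indicator_of_notMem hs]
    simp only [duhamelKernel, if_neg hs, zero_mul, lintegral_zero]

theorem measurable_opP (α : ℝ) (μ : Measure (EuclideanSpace ℝ (Fin N))) [SFinite μ] :
    Measurable fun z : ℝ × EuclideanSpace ℝ (Fin N) => opP α z.1 μ z.2 := by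
  simp only [opP_eq_lintegral]
  exact Measurable.lintegral_prod_right'
    (f := fun w : (ℝ × EuclideanSpace ℝ (Fin N)) × ℝ => heat (w.1.1 ^ α * w.2) μ w.1.2)
    (by fun_prop)

theorem exists_isMinimalSolution {α p T : ℝ} (hp : 0 < p)
    (μ : Measure (EuclideanSpace ℝ (Fin N))) [SFinite μ]
    {w : ℝ × EuclideanSpace ℝ (Fin N) → ℝ≥0∞} (hw : Measurable w)
    (h_super : ∀ᵐ z ∂volume.restrict (Ioc (0 : ℝ) T ×ˢ univ), w z < ∞ ∧
      opP α z.1 μ z.2 + ENNReal.ofReal α * ∫⁻ s in Ioo (0 : ℝ) z.1,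
        ENNReal.ofReal ((z.1 - s) ^ (α - 1)) *
          opS α (z.1 - s) (volume.withDensity fun y => w (s, y) ^ p) z.2 ≤ w z) :
    ∃ u, IsMinimalSolution α p T μ u := by
  set S : Set (ℝ × EuclideanSpace ℝ (Fin N)) := Ioc (0 : ℝ) T ×ˢ univ
  have hS : MeasurableSet S := measurableSet_Ioc.prod MeasurableSet.univ
  set f : ℝ × EuclideanSpace ℝ (Fin N) → ℝ≥0∞ := fun z => opP α z.1 μ z.2
  have hf : Measurable f := measurable_opP α μ
  have h_map {v : ℝ × EuclideanSpace ℝ (Fin N) → ℝ≥0∞} (hv : Measurable v) (z) :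
      hammersteinMap volume (duhamelKernel α) f p v z = opP α z.1 μ z.2 + ENNReal.ofReal α *
        ∫⁻ s in Ioo (0 : ℝ) z.1, ENNReal.ofReal ((z.1 - s) ^ (α - 1)) *
          opS α (z.1 - s) (volume.withDensity fun y => v (s, y) ^ p) z.2 := by
    rw [hammersteinMap, lintegral_duhamelKernel_mul α (hv.pow_const p)]
  have h_causal : ∀ z ∈ S, ∀ q ∉ S, duhamelKernel α z q = 0 := fun z hz q hq =>
    if_neg fun h => hq ⟨⟨h.1, h.2.le.trans hz.1.2⟩, mem_univ _⟩
  set u := fun z => ⨆ n, hammersteinIterate volume (duhamelKernel α) f p n z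
  have hu : Measurable u :=
    Measurable.iSup (measurable_hammersteinIterate (measurable_duhamelKernel α) hf)
  refine ⟨u, ⟨hu, ?_⟩, fun v hv => ae_iSup_hammersteinIterate_le hS hp.le h_causal
    (hv.2.mono fun z hz => by rw [h_map hv.1]; exact hz.2.ge)⟩
  filter_upwards [h_super, ae_iSup_hammersteinIterate_le hS hp.le h_causal
    (h_super.mono fun z hz => by rw [h_map hw]; exact hz.2)] with z hz h_le
  exact ⟨h_le.trans_lt hz.1, by
    rw [← h_map hu, hammersteinMap_iSup hp (measurable_duhamelKernel α) hf]⟩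

/-! ### Supersolutions by subordination -/

/-- The subordination `∫ h_α(θ) F(t^α θ) e^{t^α θ Δ} μ dθ` to the time-fractional flow of the family
`F(τ) e^{τΔ} μ`, at the point `z = (t, x)`. -/
def subordinate (α : ℝ) (μ : Measure (EuclideanSpace ℝ (Fin N))) (F : ℝ → ℝ≥0∞)
    (z : ℝ × EuclideanSpace ℝ (Fin N)) : ℝ≥0∞ :=
  ∫⁻ θ, F (z.1 ^ α * θ) * heat (z.1 ^ α * θ) μ z.2 ∂wrightMeasure α

section Subordinate

variable {α : ℝ} {μ : Measure (EuclideanSpace ℝ (Fin N))} [SFinite μ] {F G : ℝ → ℝ≥0∞}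

@[fun_prop]
theorem measurable_subordinate (α : ℝ) (μ : Measure (EuclideanSpace ℝ (Fin N))) [SFinite μ]
    (hF : Measurable F) : Measurable (subordinate α μ F) :=
  Measurable.lintegral_prod_right'
    (f := fun w : (ℝ × EuclideanSpace ℝ (Fin N)) × ℝ =>
      F (w.1.1 ^ α * w.2) * heat (w.1.1 ^ α * w.2) μ w.1.2)
    (by fun_prop)

theorem heat_subordinate (hF : Measurable F) {r s : ℝ} (hr : 0 < r) (hs : 0 < s)
    (x : EuclideanSpace ℝ (Fin N)) :
    heat r (volume.withDensity fun y => subordinate α μ F (s, y)) x =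
      ∫⁻ θ, F (s ^ α * θ) * heat (r + s ^ α * θ) μ x ∂wrightMeasure α := by
  rw [heat_withDensity r (by fun_prop)]
  calc _ = ∫⁻ y, ∫⁻ θ, ENNReal.ofReal (heatKernel r (x - y)) *
          (F (s ^ α * θ) * heat (s ^ α * θ) μ y) ∂wrightMeasure α :=
        lintegral_congr fun y => (lintegral_const_mul' _ _ ENNReal.ofReal_ne_top).symm
    _ = ∫⁻ θ, (∫⁻ y, ENNReal.ofReal (heatKernel r (x - y)) *
          (F (s ^ α * θ) * heat (s ^ α * θ) μ y)) ∂wrightMeasure α :=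
        lintegral_lintegral_swap (by fun_prop)
    _ = _ := by
        refine lintegral_congr_ae ?_
        filter_upwards [ae_pos_wrightMeasure α] with θ hθ
        rw [← heat_heat μ hr (by positivity), heat_withDensity r (by fun_prop)]
        exact (lintegral_congr fun y => mul_left_comm _ _ _).trans
          (lintegral_const_mul _ (by fun_prop))

theorem opS_subordinate (hF : Measurable F) {r s : ℝ} (hr : 0 < r) (hs : 0 < s)
    (x : EuclideanSpace ℝ (Fin N)) :
    opS α r (volume.withDensity fun y => subordinate α μ F (s, y)) x =
      ∫⁻ η, ∫⁻ θ, F (s ^ α * θ) * heat (r ^ α * η + s ^ α * θ) μ x ∂wrightMeasure α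
        ∂biasedWrightMeasure α := by
  rw [opS_eq_lintegral]
  refine lintegral_congr_ae ?_
  filter_upwards [ae_pos_biasedWrightMeasure α] with η hη
  exact heat_subordinate hF (mul_pos (Real.rpow_pos_of_pos hr α) hη) hs x

theorem opP_add_lintegral_opS_subordinate_le {p : ℝ} (hα : α ∈ Ioo (0 : ℝ) 1) (hF : Measurable F)
    (hFG : ∀ τ : ℝ, 0 < τ → 1 + ∫⁻ σ in Ioo 0 τ, F σ ≤ G τ) {t : ℝ} (ht : 0 < t)
    (h_pow : ∀ s ∈ Ioo 0 t, ∀ y, subordinate α μ G (s, y) ^ p ≤ subordinate α μ F (s, y))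
    (x : EuclideanSpace ℝ (Fin N)) :
    opP α t μ x + ENNReal.ofReal α * ∫⁻ s in Ioo (0 : ℝ) t, ENNReal.ofReal ((t - s) ^ (α - 1)) *
        opS α (t - s) (volume.withDensity fun y => subordinate α μ G (s, y) ^ p) x ≤
      subordinate α μ G (t, x) := by
  have h_opS (s : ℝ) (hs : s ∈ Ioo 0 t) :
      opS α (t - s) (volume.withDensity fun y => subordinate α μ G (s, y) ^ p) x ≤
        ∫⁻ η, ∫⁻ θ, F (s ^ α * θ) * heat ((t - s) ^ α * η + s ^ α * θ) μ x ∂wrightMeasure α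
          ∂biasedWrightMeasure α := by
    rw [← opS_subordinate hF (sub_pos.2 hs.2) hs.1, opS_eq_lintegral, opS_eq_lintegral]
    exact lintegral_mono fun η => lintegral_mono'
      (withDensity_mono (ae_of_all _ (h_pow s hs))) le_rfl
  calc _ ≤ opP α t μ x + ENNReal.ofReal α *
          ∫⁻ s in Ioo 0 t, ENNReal.ofReal ((t - s) ^ (α - 1)) *
            ∫⁻ η, ∫⁻ θ, F (s ^ α * θ) * heat ((t - s) ^ α * η + s ^ α * θ) μ x ∂wrightMeasure α
              ∂biasedWrightMeasure α := by
        gcongr _ + _ * ?_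
        refine setLIntegral_mono' measurableSet_Ioo fun s hs => ?_
        gcongr
        exact h_opS s hs
    _ = ∫⁻ θ, (heat (t ^ α * θ) μ x + ∫⁻ σ in Ioo 0 (t ^ α * θ),
          F σ * heat (t ^ α * θ - σ + σ) μ x) ∂wrightMeasure α := by
        rw [lintegral_add_left (by fun_prop), ← opP_eq_lintegral,
          ← lintegral_duhamel hα ht (Φ := fun w => F w.2 * heat (w.1 + w.2) μ x) (by fun_prop)]
    _ ≤ subordinate α μ G (t, x) := by
        refine lintegral_mono_ae ?_
        filter_upwards [ae_pos_wrightMeasure α] with θ hθ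
        simp only [sub_add_cancel]
        rw [lintegral_mul_const _ hF, ← one_add_mul]
        gcongr
        exact hFG _ (mul_pos (Real.rpow_pos_of_pos ht α) hθ)

end Subordinate

theorem lintegral_rpow_le_of_rpow_le {X : Type*} [MeasurableSpace X] {ν : Measure X} {p : ℝ}
    (hp : 1 < p) {f g k : X → ℝ≥0∞} (hg : AEMeasurable g ν) (hk : AEMeasurable k ν)
    (h : ∀ᵐ x ∂ν, f x ^ p ≤ g x * k x ^ (p - 1)) :
    (∫⁻ x, f x ∂ν) ^ p ≤ (∫⁻ x, g x ∂ν) * (∫⁻ x, k x ∂ν) ^ (p - 1) := by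
  have hp_pos : 0 < p := by linarith
  have hp_sub : 0 < p - 1 := by linarith
  have h_le : ∀ᵐ x ∂ν, f x ≤ g x ^ (1 / p) * k x ^ ((p - 1) / p) := by
    filter_upwards [h] with x hx
    rw [← ENNReal.le_rpow_inv_iff hp_pos, ENNReal.mul_rpow_of_nonneg _ _ (by positivity),
      ← ENNReal.rpow_mul] at hx
    simpa only [div_eq_mul_inv, one_mul] using hx
  have h_holder := ENNReal.lintegral_mul_le_Lp_mul_Lq ν (Real.HolderConjugate.conjExponent hp)
    (hg.pow_const (1 / p)) (hk.pow_const ((p - 1) / p))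
  simp only [Real.conjExponent, Pi.mul_apply, ← ENNReal.rpow_mul, one_div_mul_cancel hp_pos.ne',
    div_mul_div_cancel₀ hp_pos.ne', div_self hp_sub.ne', ENNReal.rpow_one] at h_holder
  calc (∫⁻ x, f x ∂ν) ^ p
      ≤ ((∫⁻ x, g x ∂ν) ^ (1 / p) * (∫⁻ x, k x ∂ν) ^ (1 / (p / (p - 1)))) ^ p := by
        gcongr
        exact (lintegral_mono_ae h_le).trans h_holder
    _ = _ := by
        rw [ENNReal.mul_rpow_of_nonneg _ _ hp_pos.le, ← ENNReal.rpow_mul, ← ENNReal.rpow_mul,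
          one_div_mul_cancel hp_pos.ne', ENNReal.rpow_one, one_div_div,
          div_mul_cancel₀ _ hp_pos.ne']

/-- The factor by which the supersolution built from the heat flow exceeds that flow. -/
def growth (γ τ₀ τ : ℝ) : ℝ :=
  Real.exp ((τ / τ₀) ^ γ)

/-- The derivative of `growth`. -/
def growthRate (γ τ₀ τ : ℝ) : ℝ :=
  γ * τ ^ (γ - 1) * τ₀ ^ (-γ) * growth γ τ₀ τ

@[fun_prop]
theorem measurable_growth (γ τ₀ : ℝ) : Measurable (growth γ τ₀) := by
  unfold growth
  fun_prop

@[fun_prop]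
theorem measurable_growthRate (γ τ₀ : ℝ) : Measurable (growthRate γ τ₀) := by
  unfold growthRate
  fun_prop

theorem growth_pos (γ τ₀ τ : ℝ) : 0 < growth γ τ₀ τ :=
  Real.exp_pos _

section Growth

variable {γ τ₀ τ : ℝ}

theorem growthRate_nonneg (hγ : 0 ≤ γ) (hτ₀ : 0 ≤ τ₀) (hτ : 0 ≤ τ) : 0 ≤ growthRate γ τ₀ τ := by
  have := growth_pos γ τ₀ τ
  unfold growthRate
  positivity

theorem hasDerivAt_growth (hτ₀ : 0 < τ₀) (hτ : 0 < τ) :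
    HasDerivAt (growth γ τ₀) (growthRate γ τ₀ τ) τ := by
  have h := (((hasDerivAt_id τ).div_const τ₀).rpow_const (p := γ)
    (Or.inl (div_pos hτ hτ₀).ne')).exp
  convert! h using 1
  simp only [id, growthRate, growth]
  rw [Real.div_rpow hτ.le hτ₀.le, Real.div_rpow hτ.le hτ₀.le, Real.rpow_neg hτ₀.le,
    Real.rpow_sub_one hτ₀.ne']
  field_simp

theorem one_add_lintegral_growthRate (hγ : 0 < γ) (hτ₀ : 0 < τ₀) (hτ : 0 < τ) :
    1 + ∫⁻ σ in Ioo 0 τ, ENNReal.ofReal (growthRate γ τ₀ σ) =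
      ENNReal.ofReal (growth γ τ₀ τ) := by
  have h_cont : ContinuousOn (growth γ τ₀) (Icc 0 τ) :=
    (Real.continuous_exp.comp ((Real.continuous_rpow_const hγ.le).comp
      (continuous_id.div_const τ₀))).continuousOn
  have h_deriv : ∀ σ ∈ Ioo 0 τ, HasDerivAt (growth γ τ₀) (growthRate γ τ₀ σ) σ :=
    fun σ hσ => hasDerivAt_growth hτ₀ hσ.1
  have h_nonneg : ∀ σ ∈ Ioo 0 τ, 0 ≤ growthRate γ τ₀ σ :=
    fun σ hσ => growthRate_nonneg hγ.le hτ₀.le hσ.1.le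
  have h_int := intervalIntegral.integrableOn_deriv_of_nonneg h_cont h_deriv h_nonneg
  have h_ftc := intervalIntegral.integral_eq_sub_of_hasDerivAt_of_le hτ.le h_cont h_deriv
    ((intervalIntegrable_iff_integrableOn_Ioc_of_le hτ.le).2 h_int)
  have h_zero : growth γ τ₀ 0 = 1 := by
    rw [growth, zero_div, Real.zero_rpow hγ.ne', Real.exp_zero]
  have h_one : 1 ≤ growth γ τ₀ τ := Real.one_le_exp (by positivity)
  rw [intervalIntegral.integral_of_le hτ.le, integral_Ioc_eq_integral_Ioo, h_zero] at h_ftc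
  rw [← ofReal_integral_eq_lintegral_ofReal (h_int.mono_set Ioo_subset_Ioc_self)
      ((ae_restrict_mem measurableSet_Ioo).mono h_nonneg), h_ftc,
    ← ENNReal.ofReal_one, ← ENNReal.ofReal_add zero_le_one (sub_nonneg.2 h_one), add_sub_cancel]

theorem growth_le_exp_one_add (hγ₀ : 0 ≤ γ) (hγ₁ : γ ≤ 1) (hτ : 0 ≤ τ / τ₀) :
    growth γ τ₀ τ ≤ Real.exp (1 + τ / τ₀) := by
  refine Real.exp_le_exp.2 ?_
  rcases le_total (τ / τ₀) 1 with h | h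
  · linarith [Real.rpow_le_one hτ h hγ₀]
  · have := Real.rpow_le_rpow_of_exponent_le h hγ₁
    rw [Real.rpow_one] at this
    linarith

variable {p a B k θ : ℝ}

theorem growth_mul_rpow_le (hp : 1 < p) (hγ : γ = 1 - (p - 1) * (a / 2)) (hγ₀ : 0 < γ)
    (hγ₁ : γ ≤ 1) (hB : 0 ≤ B) (hτ₀ : 0 < τ₀) (hτ : 0 < τ) (hτθ : τ / τ₀ ≤ θ)
    (hk : (Real.exp 1 * B) ^ (p - 1) ≤ k * (γ * τ₀ ^ (-γ))) :
    growth γ τ₀ τ *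
        (growth γ τ₀ τ * (B * Real.exp (2 * (τ / τ₀)) * τ ^ (-(a / 2)))) ^ (p - 1) ≤
      k * growthRate γ τ₀ τ * Real.exp (3 * θ) ^ (p - 1) := by
  have h_growth := growth_pos γ τ₀ τ
  have h_exponent : (τ ^ (-(a / 2))) ^ (p - 1) = τ ^ (γ - 1) := by
    rw [← Real.rpow_mul hτ.le, hγ]
    ring_nf
  have h_base : growth γ τ₀ τ * (B * Real.exp (2 * (τ / τ₀)) * τ ^ (-(a / 2))) ≤
      Real.exp 1 * B * Real.exp (3 * θ) * τ ^ (-(a / 2)) :=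
    calc _ ≤ Real.exp (1 + τ / τ₀) * (B * Real.exp (2 * (τ / τ₀)) * τ ^ (-(a / 2))) := by
          gcongr
          exact growth_le_exp_one_add hγ₀.le hγ₁ (by positivity)
      _ = Real.exp 1 * B * Real.exp (3 * (τ / τ₀)) * τ ^ (-(a / 2)) := by
          rw [show 3 * (τ / τ₀) = τ / τ₀ + 2 * (τ / τ₀) by ring, Real.exp_add, Real.exp_add]
          ring
      _ ≤ _ := by gcongr
  calc _ ≤ growth γ τ₀ τ *
          (Real.exp 1 * B * Real.exp (3 * θ) * τ ^ (-(a / 2))) ^ (p - 1) := by gcongr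
    _ = growth γ τ₀ τ * ((Real.exp 1 * B) ^ (p - 1) * Real.exp (3 * θ) ^ (p - 1) *
          τ ^ (γ - 1)) := by
        rw [Real.mul_rpow (by positivity) (by positivity),
          Real.mul_rpow (by positivity) (by positivity), h_exponent]
    _ ≤ growth γ τ₀ τ * (k * (γ * τ₀ ^ (-γ)) * Real.exp (3 * θ) ^ (p - 1) * τ ^ (γ - 1)) := by
        gcongr
    _ = _ := by
        rw [growthRate]
        ring

theorem ofReal_growth_mul_rpow_le (hp : 1 < p) (hγ : γ = 1 - (p - 1) * (a / 2)) (hγ₀ : 0 < γ)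
    (hγ₁ : γ ≤ 1) (hB : 0 ≤ B) (hτ₀ : 0 < τ₀) (hτ : 0 < τ) (hτθ : τ / τ₀ ≤ θ) (hk_nonneg : 0 ≤ k)
    (hk : (Real.exp 1 * B) ^ (p - 1) ≤ k * (γ * τ₀ ^ (-γ))) {H : ℝ≥0∞}
    (hH : H ≤ ENNReal.ofReal (B * Real.exp (2 * (τ / τ₀)) * τ ^ (-(a / 2)))) :
    (ENNReal.ofReal (growth γ τ₀ τ) * H) ^ p ≤
      ENNReal.ofReal k * (ENNReal.ofReal (growthRate γ τ₀ τ) * H) *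
        ENNReal.ofReal (Real.exp (3 * θ)) ^ (p - 1) := by
  have hp_sub : 0 < p - 1 := by linarith
  have h_growth := growth_pos γ τ₀ τ
  have h_rate := growthRate_nonneg hγ₀.le hτ₀.le hτ.le
  set g := growth γ τ₀ τ
  set b := B * Real.exp (2 * (τ / τ₀)) * τ ^ (-(a / 2))
  calc (ENNReal.ofReal g * H) ^ p
      = ENNReal.ofReal g * H * (ENNReal.ofReal g * H) ^ (p - 1) := by
        have := ENNReal.rpow_add_of_nonneg (x := ENNReal.ofReal g * H) 1 (p - 1) zero_le_one
          hp_sub.le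
        rwa [add_sub_cancel, ENNReal.rpow_one] at this
    _ ≤ ENNReal.ofReal g * H * (ENNReal.ofReal g * ENNReal.ofReal b) ^ (p - 1) := by gcongr
    _ = ENNReal.ofReal (g * (g * b) ^ (p - 1)) * H := by
        rw [← ENNReal.ofReal_mul h_growth.le,
          ENNReal.ofReal_rpow_of_nonneg (by positivity) hp_sub.le, mul_right_comm,
          ← ENNReal.ofReal_mul h_growth.le]
    _ ≤ ENNReal.ofReal (k * growthRate γ τ₀ τ * Real.exp (3 * θ) ^ (p - 1)) * H := by
        gcongr ENNReal.ofReal ?_ * _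
        exact growth_mul_rpow_le hp hγ hγ₀ hγ₁ hB hτ₀ hτ hτθ hk
    _ = _ := by
        rw [ENNReal.ofReal_rpow_of_nonneg (by positivity) hp_sub.le,
          ENNReal.ofReal_mul (by positivity), ENNReal.ofReal_mul hk_nonneg]
        ring

end Growth

section LowerBound

variable {α p a B M τ₀ γ t : ℝ} {μ : Measure (EuclideanSpace ℝ (Fin N))}

theorem rpow_mul_div_le {θ : ℝ} (hτ₀ : 0 < τ₀) (ht : t ^ α ≤ τ₀) (hθ : 0 ≤ θ) :
    t ^ α * θ / τ₀ ≤ θ := by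
  rw [div_le_iff₀ hτ₀, mul_comm θ]
  gcongr

theorem subordinate_growth_lt_top (hα : α ∈ Ioo (0 : ℝ) 1) (hγ₀ : 0 ≤ γ) (hγ₁ : γ ≤ 1)
    (hτ₀ : 0 < τ₀) (h_heat : ∀ τ : ℝ, 0 < τ → ∀ x, heat τ μ x ≤ ENNReal.ofReal M) (ht : 0 < t)
    (htτ₀ : t ^ α ≤ τ₀) (x : EuclideanSpace ℝ (Fin N)) :
    subordinate α μ (fun τ => ENNReal.ofReal (growth γ τ₀ τ)) (t, x) < ∞ := by
  calc _ ≤ ∫⁻ θ, ENNReal.ofReal (Real.exp 1) * ENNReal.ofReal (Real.exp (1 * θ)) *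
          ENNReal.ofReal M ∂wrightMeasure α := by
        refine lintegral_mono_ae ?_
        filter_upwards [ae_pos_wrightMeasure α] with θ hθ
        have h_pos := mul_pos (Real.rpow_pos_of_pos ht α) hθ
        gcongr
        · rw [← ENNReal.ofReal_mul (Real.exp_pos 1).le, ← Real.exp_add]
          refine ENNReal.ofReal_le_ofReal
            ((growth_le_exp_one_add hγ₀ hγ₁ (by positivity)).trans (Real.exp_le_exp.2 ?_))
          linarith [rpow_mul_div_le hτ₀ htτ₀ hθ.le]
        · exact h_heat _ h_pos _
    _ < ∞ := by
        rw [lintegral_mul_const _ (by fun_prop), lintegral_const_mul _ (by fun_prop)]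
        exact ENNReal.mul_lt_top (ENNReal.mul_lt_top ENNReal.ofReal_lt_top
          ((lintegral_exp_wrightMeasure_le hα zero_le_one).trans_lt ENNReal.ofReal_lt_top))
          ENNReal.ofReal_lt_top

variable [SFinite μ]

theorem subordinate_growth_rpow_le {E : ℝ} (hp : 1 < p) (hγ : γ = 1 - (p - 1) * (a / 2))
    (hγ₀ : 0 < γ) (hγ₁ : γ ≤ 1) (hB : 0 ≤ B) (hE : 0 < E) (hτ₀ : 0 < τ₀)
    (h_moment : ∫⁻ θ, ENNReal.ofReal (Real.exp (3 * θ)) ∂wrightMeasure α ≤ ENNReal.ofReal E)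
    (h_heat : ∀ τ : ℝ, 0 < τ → ∀ x,
      heat τ μ x ≤ ENNReal.ofReal (B * Real.exp (2 * (τ / τ₀)) * τ ^ (-(a / 2))))
    (h_small : (Real.exp 1 * B * E) ^ (p - 1) * τ₀ ^ γ ≤ γ) (ht : 0 < t) (htτ₀ : t ^ α ≤ τ₀)
    (x : EuclideanSpace ℝ (Fin N)) :
    subordinate α μ (fun τ => ENNReal.ofReal (growth γ τ₀ τ)) (t, x) ^ p ≤
      subordinate α μ (fun τ => ENNReal.ofReal (growthRate γ τ₀ τ)) (t, x) := by
  have hp_sub : 0 < p - 1 := by linarith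
  set k := E ^ (-(p - 1)) with hk
  have h_le_k : (Real.exp 1 * B) ^ (p - 1) ≤ k * (γ * τ₀ ^ (-γ)) := by
    rw [Real.mul_rpow (by positivity) hE.le] at h_small
    rw [hk, Real.rpow_neg hE.le, Real.rpow_neg hτ₀.le]
    field_simp
    linarith
  have h_pointwise : ∀ᵐ θ ∂wrightMeasure α,
      (ENNReal.ofReal (growth γ τ₀ (t ^ α * θ)) * heat (t ^ α * θ) μ x) ^ p ≤
        ENNReal.ofReal k *
          (ENNReal.ofReal (growthRate γ τ₀ (t ^ α * θ)) * heat (t ^ α * θ) μ x) *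
          ENNReal.ofReal (Real.exp (3 * θ)) ^ (p - 1) := by
    filter_upwards [ae_pos_wrightMeasure α] with θ hθ
    have h_pos := mul_pos (Real.rpow_pos_of_pos ht α) hθ
    exact ofReal_growth_mul_rpow_le hp hγ hγ₀ hγ₁ hB hτ₀ h_pos (rpow_mul_div_le hτ₀ htτ₀ hθ.le)
      (by positivity) h_le_k (h_heat _ h_pos x)
  calc _ ≤ _ := lintegral_rpow_le_of_rpow_le hp (by fun_prop) (by fun_prop) h_pointwise
    _ ≤ ENNReal.ofReal k *
          subordinate α μ (fun τ => ENNReal.ofReal (growthRate γ τ₀ τ)) (t, x) *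
          ENNReal.ofReal E ^ (p - 1) := by
        rw [lintegral_const_mul _ (by fun_prop)]
        gcongr
        exact le_rfl
    _ = _ := by
        rw [ENNReal.ofReal_rpow_of_nonneg hE.le hp_sub.le, mul_right_comm,
          ← ENNReal.ofReal_mul (by positivity), hk, ← Real.rpow_add hE, neg_add_cancel,
          Real.rpow_zero, ENNReal.ofReal_one, one_mul]

theorem le_lifespan (hα : α ∈ Ioo (0 : ℝ) 1) (hp : 1 < p) (hγ : γ = 1 - (p - 1) * (a / 2))
    (hγ₀ : 0 < γ) (hγ₁ : γ ≤ 1) (hB : 0 ≤ B) (hτ₀ : 0 < τ₀)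
    (h_bounded : ∀ τ : ℝ, 0 < τ → ∀ x, heat τ μ x ≤ ENNReal.ofReal M)
    (h_decay : ∀ τ : ℝ, 0 < τ → ∀ x,
      heat τ μ x ≤ ENNReal.ofReal (B * Real.exp (2 * (τ / τ₀)) * τ ^ (-(a / 2))))
    (h_small : (Real.exp 1 * B * (2 * Real.exp (7 ^ (1 / α)))) ^ (p - 1) * τ₀ ^ γ ≤ γ) :
    ENNReal.ofReal (τ₀ ^ (1 / α)) ≤ lifespan α p μ := by
  have h_scale {t : ℝ} (ht : t ∈ Ioc 0 (τ₀ ^ (1 / α))) : t ^ α ≤ τ₀ := by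
    have := Real.rpow_le_rpow ht.1.le ht.2 hα.1.le
    rwa [← Real.rpow_mul hτ₀.le, one_div_mul_cancel hα.1.ne', Real.rpow_one] at this
  have h_moment : ∫⁻ θ, ENNReal.ofReal (Real.exp (3 * θ)) ∂wrightMeasure α ≤
      ENNReal.ofReal (2 * Real.exp (7 ^ (1 / α))) := by
    convert lintegral_exp_wrightMeasure_le hα (b := 3) (by norm_num) using 5
    norm_num
  refine le_sSup ⟨_, Real.rpow_pos_of_pos hτ₀ _, rfl, exists_isMinimalSolution (by linarith) μ
    (w := subordinate α μ fun τ => ENNReal.ofReal (growth γ τ₀ τ)) (by fun_prop) ?_⟩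
  filter_upwards [ae_restrict_mem (measurableSet_Ioc.prod MeasurableSet.univ)] with z ⟨hz, _⟩
  exact ⟨subordinate_growth_lt_top hα hγ₀.le hγ₁ hτ₀ h_bounded hz.1 (h_scale hz) z.2,
    opP_add_lintegral_opS_subordinate_le hα (by fun_prop)
      (fun τ hτ => (one_add_lintegral_growthRate hγ₀ hτ₀ hτ).le) hz.1
      (fun s hs => subordinate_growth_rpow_le hp hγ hγ₀ hγ₁ hB (by positivity) hτ₀ h_moment h_decay
        h_small hs.1 (h_scale ⟨hs.1, hs.2.le.trans hz.2⟩)) z.2⟩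

end LowerBound

/-! ### Life span -/

theorem simeqSmall_of_rpow {T : ℝ → ℝ → ℝ≥0∞} {F : ℝ → ℝ → ℝ} {f c : ℝ → ℝ} {C κ₀ : ℝ}
    (hκ₀ : κ₀ ∈ Ioo (0 : ℝ) 1) (hc : ∀ α ∈ Ioc (0 : ℝ) 1, 0 < c α) (hc_cont : ContinuousAt c 1)
    (hC : 0 < C) (hf : ∀ κ ∈ Ioo 0 κ₀, 0 ≤ f κ)
    (hF : ∀ α ∈ Ioo (0 : ℝ) 1, ∀ κ ∈ Ioo 0 κ₀, F α κ = f κ ^ (1 / α))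
    (h_lower : ∀ α ∈ Ioo (0 : ℝ) 1, ∀ κ ∈ Ioo 0 κ₀,
      ENNReal.ofReal ((c α * f κ) ^ (1 / α)) ≤ T α κ)
    (h_upper : ∀ α ∈ Ioo (0 : ℝ) 1, ∀ κ ∈ Ioo 0 κ₀,
      T α κ ≤ ENNReal.ofReal ((C * f κ) ^ (1 / α))) : SimeqSmall T F := by
  have hc_one := hc 1 ⟨zero_lt_one, le_rfl⟩
  have h_inv : ContinuousAt (fun α : ℝ => 1 / α) 1 :=
    continuousAt_const.div continuousAt_id one_ne_zero
  have h_lim {g : ℝ → ℝ} (hg : ContinuousAt g 1) (hg_one : 0 < g 1) :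
      Tendsto (fun α => g α ^ (1 / α)) (𝓝[<] 1) (𝓝 (g 1)) := by
    have := (hg.rpow h_inv (Or.inl hg_one.ne')).tendsto
    rw [div_one, Real.rpow_one] at this
    exact this.mono_left nhdsWithin_le_nhds
  refine ⟨κ₀, hκ₀, fun α => c α ^ (1 / α), fun α => C ^ (1 / α), fun α hα =>
    ⟨Real.rpow_pos_of_pos (hc α ⟨hα.1, hα.2.le⟩) _, Real.rpow_pos_of_pos hC _⟩,
    ⟨c 1 / 2, C + 1, by positivity, ?_⟩, fun α hα κ hκ => ?_⟩
  · filter_upwards [(h_lim hc_cont hc_one).eventually (lt_mem_nhds (half_lt_self hc_one)),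
      (h_lim continuousAt_const hC).eventually (gt_mem_nhds (lt_add_one C))] with α h_low h_up
    exact ⟨h_low.le, h_up.le⟩
  · rw [hF α hα κ hκ, ← Real.mul_rpow (hc α ⟨hα.1, hα.2.le⟩).le (hf κ hκ),
      ← Real.mul_rpow hC.le (hf κ hκ)]
    exact ⟨h_lower α hα κ hκ, h_upper α hα κ hκ⟩

/-- The factor in the lower bound of the life span: small enough for the smallness condition of
`le_lifespan`, and continuous up to `α = 1`. -/
def lowerFactor (p β L α : ℝ) : ℝ :=
  min 1 (((p - 1) * β) ^ (1 / (p - 1)) / (Real.exp 1 * L)) / (2 * Real.exp (7 ^ (1 / α)))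

section LowerFactor

variable {p β L : ℝ}

theorem lowerFactor_pos (hp : 1 < p) (hβ : 0 < β) (hL : 0 < L) (α : ℝ) :
    0 < lowerFactor p β L α := by
  unfold lowerFactor
  positivity

theorem lowerFactor_le_one (p β L α : ℝ) : lowerFactor p β L α ≤ 1 := by
  have : 1 ≤ Real.exp ((7 : ℝ) ^ (1 / α)) := Real.one_le_exp (by positivity)
  exact div_le_one_of_le₀ ((min_le_left _ _).trans (by linarith)) (by positivity)

theorem mul_lowerFactor_le (hL : 0 < L) (α : ℝ) :
    Real.exp 1 * L * (2 * Real.exp (7 ^ (1 / α))) * lowerFactor p β L α ≤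
      ((p - 1) * β) ^ (1 / (p - 1)) := by
  rw [lowerFactor, mul_assoc, mul_div_cancel₀ _ (by positivity), ← le_div_iff₀' (by positivity)]
  exact min_le_right _ _

theorem continuousAt_lowerFactor (p β L : ℝ) : ContinuousAt (lowerFactor p β L) 1 := by
  have h_exponent : ContinuousAt (fun α : ℝ => (7 : ℝ) ^ (1 / α)) 1 :=
    continuousAt_const.rpow (continuousAt_const.div continuousAt_id one_ne_zero)
      (Or.inl (by norm_num))
  exact continuousAt_const.div (continuousAt_const.mul h_exponent.rexp) (by positivity)

end LowerFactor

instance sFinite_decayData (A κ : ℝ) : SFinite (decayData N A κ) := by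
  unfold decayData
  infer_instance

theorem le_lifespan_decayData {α p A a β L κ y : ℝ} (hα : α ∈ Ioo (0 : ℝ) 1) (hp : 1 < p)
    (hA : 0 < A) (ha : 0 ≤ a) (hβ : β = 1 / (p - 1) - a / 2) (hβ_pos : 0 < β) (hL : 0 < L)
    (hκ : 0 ≤ κ) (hy : 0 < y)
    (h_heat : ∀ τ₀ : ℝ, 0 < τ₀ → τ₀ ≤ y ^ (1 / β) → ∃ B : ℝ, 0 ≤ B ∧ B * y ≤ L ∧
      ∀ τ : ℝ, 0 < τ → ∀ x : EuclideanSpace ℝ (Fin N), heat τ (decayData N A κ) x ≤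
        ENNReal.ofReal (B * Real.exp (2 * (τ / τ₀)) * τ ^ (-(a / 2)))) :
    ENNReal.ofReal (((lowerFactor p β L α * y) ^ (1 / β)) ^ (1 / α)) ≤
      lifespan α p (decayData N A κ) := by
  have hp_sub : 0 < p - 1 := sub_pos.2 hp
  have hγ : (p - 1) * β = 1 - (p - 1) * (a / 2) := by rw [hβ]; field_simp
  have hγ_pos : 0 < (p - 1) * β := by positivity
  have hγ_le : (p - 1) * β ≤ 1 := hγ.trans_le (sub_le_self _ (by positivity))
  have hc := lowerFactor_pos hp hβ_pos hL α
  have h_scaled := mul_lowerFactor_le (p := p) (β := β) hL α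
  set c := lowerFactor p β L α
  obtain ⟨B, hB, hBL, h_decay⟩ := h_heat ((c * y) ^ (1 / β)) (by positivity) (by
    gcongr
    exact mul_le_of_le_one_left hy.le (lowerFactor_le_one p β L α))
  refine le_lifespan hα hp hγ hγ_pos hγ_le hB (by positivity)
    (fun τ hτ => heat_decayData_le_ofReal hA hκ hτ) h_decay ?_
  have h_power : ((c * y) ^ (1 / β)) ^ ((p - 1) * β) = (c * y) ^ (p - 1) := by
    rw [← Real.rpow_mul (by positivity)]
    congr 1
    field_simp
  set E := 2 * Real.exp ((7 : ℝ) ^ (1 / α))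
  calc _ = (Real.exp 1 * (B * y) * E * c) ^ (p - 1) := by
        rw [h_power, ← Real.mul_rpow (by positivity) (by positivity)]
        ring_nf
    _ ≤ (((p - 1) * β) ^ (1 / (p - 1))) ^ (p - 1) := by
        gcongr
        refine le_trans ?_ h_scaled
        gcongr
    _ = (p - 1) * β := by
        rw [← Real.rpow_mul hγ_pos.le, one_div_mul_cancel hp_sub.ne', Real.rpow_one]

theorem lifespan_le_of_rpow_le {α p β K : ℝ} {μ : Measure (EuclideanSpace ℝ (Fin N))} (hα : 0 < α)
    (hβ : 0 < β) (hK : 1 ≤ K)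
    (h : ∀ T R : ℝ, 0 < T → 1 < R → T ^ α = R ^ 2 → (∃ u, IsSolution α p T μ u) →
      R ^ (2 * β) ≤ K) :
    lifespan α p μ ≤ ENNReal.ofReal ((K ^ (1 / β)) ^ (1 / α)) := by
  refine sSup_le ?_
  rintro _ ⟨T, hT, rfl, u, hu, -⟩
  refine ENNReal.ofReal_le_ofReal ?_
  set R := T ^ (α / 2) with hR_def
  have hR : 0 < R := by positivity
  have hTR : T ^ α = R ^ 2 := by
    rw [← Real.rpow_mul_natCast hT.le]
    congr 1
    push_cast
    ring
  have hRK : R ^ (2 * β) ≤ K := by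
    rcases lt_or_ge 1 R with hR_large | hR_small
    · exact h T R hT hR_large hTR ⟨u, hu⟩
    · exact (Real.rpow_le_one hR.le hR_small (by positivity)).trans hK
  calc T = ((R ^ (2 * β)) ^ (1 / β)) ^ (1 / α) := by
        rw [hR_def, ← Real.rpow_mul hT.le, ← Real.rpow_mul hT.le, ← Real.rpow_mul hT.le]
        conv_lhs => rw [← Real.rpow_one T]
        congr 1
        field_simp
    _ ≤ _ := by gcongr

theorem simeqSmall_lifespan {p A a β κ₀ L C : ℝ} {Y : ℝ → ℝ} {F : ℝ → ℝ → ℝ}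
    (hp : 1 < p) (hA : 0 < A) (ha : 0 ≤ a) (hβ : β = 1 / (p - 1) - a / 2) (hβ_pos : 0 < β)
    (hκ₀ : κ₀ ∈ Ioo (0 : ℝ) 1) (hL : 0 < L) (hC : 1 ≤ C) (hY : ∀ κ ∈ Ioo 0 κ₀, 1 ≤ Y κ)
    (hF : ∀ α ∈ Ioo (0 : ℝ) 1, ∀ κ ∈ Ioo 0 κ₀, F α κ = Y κ ^ (α * β)⁻¹)
    (h_heat : ∀ κ ∈ Ioo 0 κ₀, ∀ τ₀ : ℝ, 0 < τ₀ → τ₀ ≤ Y κ ^ (1 / β) → ∃ B : ℝ, 0 ≤ B ∧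
      B * Y κ ≤ L ∧ ∀ τ : ℝ, 0 < τ → ∀ x : EuclideanSpace ℝ (Fin N),
        heat τ (decayData N A κ) x ≤
          ENNReal.ofReal (B * Real.exp (2 * (τ / τ₀)) * τ ^ (-(a / 2))))
    (h_sol : ∀ α ∈ Ioo (0 : ℝ) 1, ∀ κ ∈ Ioo 0 κ₀, ∀ T R : ℝ, 0 < T → 1 < R → T ^ α = R ^ 2 →
      (∃ u, IsSolution α p T (decayData N A κ) u) → R ^ (2 * β) ≤ C * Y κ) :
    SimeqSmall (fun α κ => lifespan α p (decayData N A κ)) F := by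
  have hY_pos (κ : ℝ) (hκ : κ ∈ Ioo 0 κ₀) : 0 < Y κ := zero_lt_one.trans_le (hY κ hκ)
  have hc := lowerFactor_pos hp hβ_pos hL
  refine simeqSmall_of_rpow (f := fun κ => Y κ ^ (1 / β))
    (c := fun α => lowerFactor p β L α ^ (1 / β)) (C := C ^ (1 / β)) hκ₀
    (fun α _ => Real.rpow_pos_of_pos (hc α) _)
    ((continuousAt_lowerFactor p β L).rpow continuousAt_const (Or.inl (hc 1).ne'))
    (by positivity) (fun κ hκ => Real.rpow_nonneg (hY_pos κ hκ).le _)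
    (fun α hα κ hκ => ?_) (fun α hα κ hκ => ?_) (fun α hα κ hκ => ?_)
  · rw [hF α hα κ hκ, ← Real.rpow_mul (hY_pos κ hκ).le, one_div_mul_one_div_rev, one_div]
  · rw [← Real.mul_rpow (hc α).le (hY_pos κ hκ).le]
    exact le_lifespan_decayData hα hp hA ha hβ hβ_pos hL hκ.1.le (hY_pos κ hκ) (h_heat κ hκ)
  · rw [← Real.mul_rpow (by positivity) (hY_pos κ hκ).le]
    exact lifespan_le_of_rpow_le hα.1 hβ_pos (one_le_mul_of_one_le_of_one_le hC (hY κ hκ))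
      (h_sol α hα κ hκ)

theorem simeqSmall_lifespan_of_ne (hN : 1 ≤ N) {p A : ℝ} (hp : 1 < p) (hA : 0 < A)
    (hAN : A ≠ N) (hβ : 0 < 1 / (p - 1) - min A N / 2) :
    SimeqSmall (fun α κ => lifespan α p (decayData N A κ))
      (fun α κ => κ ^ (-(α / (p - 1) - α / 2 * min A N)⁻¹)) := by
  obtain ⟨L, hL, h_heat⟩ := exists_heat_decayData_le hN hA hAN
  obtain ⟨C, _, h_sol⟩ := exists_mul_le_of_isSolution N (A := A) hp
  obtain ⟨c, hc, h_mass⟩ := exists_le_decayMass N hA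
  refine simeqSmall_lifespan (κ₀ := 1 / 2) (Y := fun κ => κ⁻¹) (C := max 1 (C / c)) hp hA
    (le_min hA.le (Nat.cast_nonneg N)) rfl hβ ⟨by norm_num, by norm_num⟩ hL (le_max_left _ _)
    (fun κ hκ => (one_le_inv₀ hκ.1).2 (by linarith [hκ.2])) (fun α _ κ hκ => ?_)
    (fun κ hκ τ₀ hτ₀ _ => ?_) (fun α hα κ hκ T R hT hR hTR hu => ?_)
  · rw [Real.inv_rpow hκ.1.le, Real.rpow_neg hκ.1.le]
    ring_nf
  · have hκ_pos := hκ.1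
    refine ⟨κ * L, by positivity, by field_simp; exact le_rfl, fun τ hτ x =>
      (h_heat κ τ hκ_pos.le hτ x).trans (ENNReal.ofReal_le_ofReal ?_)⟩
    rw [← mul_assoc]
    gcongr ?_ * _
    exact le_mul_of_one_le_right (by positivity) (Real.one_le_exp (by positivity))
  · have hκ_pos := hκ.1
    have hR_pos : 0 < R := by linarith
    have h_bound : κ * c * R ^ (2 * (1 / (p - 1) - min A N / 2)) ≤ C :=
      calc _ = κ * (c * R ^ ((N : ℝ) - min A N)) * R ^ (2 / (p - 1) - N) := by
            rw [show 2 * (1 / (p - 1) - min A (N : ℝ) / 2) =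
              (N - min A N) + (2 / (p - 1) - N) by ring, Real.rpow_add hR_pos]
            ring
        _ ≤ C := h_sol α hα κ T R _ hκ_pos hT hR_pos hTR (by positivity) (h_mass R hR.le) hu
    calc _ ≤ C / c * κ⁻¹ := by
          rw [← div_eq_mul_inv, div_div, le_div_iff₀ (by positivity)]
          linarith
      _ ≤ _ := by
          gcongr
          exact le_max_right _ _

theorem log_two_add_le_mul_exp {τ τ₀ : ℝ} (hτ : 0 < τ) (hτ₀ : 0 < τ₀) :
    Real.log (2 + τ) ≤ Real.log (2 + τ₀) * Real.exp (2 * (τ / τ₀)) := by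
  have h_ratio : 0 < τ / τ₀ := by positivity
  have h_log : 1 / 2 ≤ Real.log (2 + τ₀) := by
    have := Real.log_le_log two_pos (by linarith : 2 ≤ 2 + τ₀)
    linarith [Real.log_two_gt_d9]
  calc Real.log (2 + τ) ≤ Real.log ((2 + τ₀) * (1 + τ / τ₀)) := by
        refine Real.log_le_log (by positivity) ?_
        have : τ₀ * (τ / τ₀) = τ := mul_div_cancel₀ τ hτ₀.ne'
        nlinarith
    _ = Real.log (2 + τ₀) + Real.log (1 + τ / τ₀) := Real.log_mul (by positivity) (by positivity)
    _ ≤ Real.log (2 + τ₀) + τ / τ₀ := by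
        gcongr
        linarith [Real.log_le_sub_one_of_pos (x := 1 + τ / τ₀) (by positivity)]
    _ ≤ Real.log (2 + τ₀) * (2 * (τ / τ₀) + 1) := by nlinarith
    _ ≤ _ := by
        gcongr
        exact Real.add_one_le_exp _

theorem log_le_half {z : ℝ} (hz : 0 < z) : Real.log z ≤ z / 2 := by
  have h := Real.log_le_sub_one_of_pos (half_pos hz)
  rw [Real.log_div hz.ne' two_ne_zero] at h
  linarith [Real.log_two_lt_d9]

theorem log_two_add_le_of_le_rpow {x q τ : ℝ} (hx : 0 < x) (h_log : 1 ≤ Real.log x) (hq : 0 ≤ q)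
    (hτ : 0 ≤ τ) (h : τ ≤ x ^ q) : Real.log (2 + τ) ≤ (2 + q) * Real.log x := by
  have h_one : 1 ≤ x := by linarith [Real.log_le_sub_one_of_pos hx]
  have h_log_three : Real.log 3 ≤ 2 := by
    linarith [Real.log_le_sub_one_of_pos (x := 3) (by norm_num)]
  calc Real.log (2 + τ) ≤ Real.log (3 * x ^ q) :=
        Real.log_le_log (by positivity) (by linarith [Real.one_le_rpow h_one hq])
    _ = Real.log 3 + q * Real.log x := by
        rw [Real.log_mul (by norm_num) (by positivity), Real.log_rpow hx]
    _ ≤ _ := by linarith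

theorem le_mul_div_log_of_mul_log_le {x s K : ℝ} (hx : 1 < x) (h : s * Real.log s ≤ K * x) :
    s ≤ max 1 (2 * K) * (x / Real.log x) := by
  have h_log := Real.log_pos hx
  have h_quot : 0 < x / Real.log x := by positivity
  rcases le_total s (x / Real.log x) with hs | hs
  · exact hs.trans (le_mul_of_one_le_left h_quot.le (le_max_left _ _))
  · have h_half : Real.log x / 2 ≤ Real.log s :=
      calc Real.log x / 2 ≤ Real.log x - Real.log (Real.log x) := by
            linarith [log_le_half h_log]
        _ = Real.log (x / Real.log x) := (Real.log_div (by positivity) h_log.ne').symm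
        _ ≤ Real.log s := Real.log_le_log h_quot hs
    calc s ≤ 2 * K * (x / Real.log x) := by
          rw [mul_div_assoc', le_div_iff₀ h_log]
          linarith [mul_le_mul_of_nonneg_left h_half (h_quot.le.trans hs)]
      _ ≤ _ := by
          gcongr
          exact le_max_right _ _

theorem exists_heat_decayData_le_mul_exp (hN : 1 ≤ N) {q : ℝ} (hq : 0 ≤ q) :
    ∃ L : ℝ, 0 < L ∧ ∀ κ : ℝ, 0 < κ → 1 ≤ Real.log κ⁻¹ → ∀ τ₀ : ℝ, 0 < τ₀ →
      τ₀ ≤ (κ⁻¹ / Real.log κ⁻¹) ^ q → ∃ B : ℝ, 0 ≤ B ∧ B * (κ⁻¹ / Real.log κ⁻¹) ≤ L ∧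
        ∀ τ : ℝ, 0 < τ → ∀ x : EuclideanSpace ℝ (Fin N), heat τ (decayData N N κ) x ≤
          ENNReal.ofReal (B * Real.exp (2 * (τ / τ₀)) * τ ^ (-((N : ℝ) / 2))) := by
  obtain ⟨L, hL, h_heat⟩ := exists_heat_decayData_le_log hN
  refine ⟨L * (2 + q), by positivity, fun κ hκ h_log τ₀ hτ₀ hτ₀_le => ?_⟩
  have h_log_pos : 0 < Real.log κ⁻¹ := by linarith
  have hτ₀_log : Real.log (2 + τ₀) ≤ (2 + q) * Real.log κ⁻¹ := by
    refine log_two_add_le_of_le_rpow (inv_pos.2 hκ) h_log hq hτ₀.le (hτ₀_le.trans ?_)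
    gcongr
    exact div_le_self (inv_pos.2 hκ).le h_log
  have : 0 < Real.log (2 + τ₀) := Real.log_pos (by linarith)
  refine ⟨κ * (L * Real.log (2 + τ₀)), by positivity, ?_, fun τ hτ x =>
    (h_heat κ τ hκ.le hτ x).trans (ENNReal.ofReal_le_ofReal ?_)⟩
  · calc _ = L * Real.log (2 + τ₀) / Real.log κ⁻¹ := by field_simp
      _ ≤ L * ((2 + q) * Real.log κ⁻¹) / Real.log κ⁻¹ := by gcongr
      _ = L * (2 + q) := by rw [← mul_assoc, mul_div_cancel_right₀ _ h_log_pos.ne']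
  · calc _ ≤ κ * (L * (Real.log (2 + τ₀) * Real.exp (2 * (τ / τ₀))) * τ ^ (-((N : ℝ) / 2))) := by
          gcongr
          exact log_two_add_le_mul_exp hτ hτ₀
      _ = _ := by ring

theorem simeqSmall_lifespan_of_eq (hN : 1 ≤ N) {p : ℝ} (hp : 1 < p)
    (hβ : 0 < 1 / (p - 1) - (N : ℝ) / 2) :
    SimeqSmall (fun α κ => lifespan α p (decayData N N κ))
      (fun α κ => (κ⁻¹ / Real.log κ⁻¹) ^ (α / (p - 1) - α * N / 2)⁻¹) := by
  have hN_pos : (0 : ℝ) < N := by exact_mod_cast hN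
  set β := 1 / (p - 1) - (N : ℝ) / 2 with hβ_def
  obtain ⟨L, hL, h_heat⟩ := exists_heat_decayData_le_mul_exp hN (q := 1 / β) (by positivity)
  obtain ⟨C, _, h_sol⟩ := exists_mul_le_of_isSolution N (A := N) hp
  obtain ⟨c, hc, h_mass⟩ := exists_log_le_decayMass hN
  have h_log {κ : ℝ} (hκ : κ ∈ Ioo 0 (Real.exp (-1))) : 1 ≤ Real.log κ⁻¹ := by
    have := Real.log_lt_log hκ.1 hκ.2
    rw [Real.log_exp] at this
    rw [Real.log_inv]
    linarith
  refine simeqSmall_lifespan (κ₀ := Real.exp (-1)) (Y := fun κ => κ⁻¹ / Real.log κ⁻¹)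
    (C := max 1 (2 * (2 * β * C / c))) hp hN_pos hN_pos.le hβ_def hβ
    ⟨Real.exp_pos _, Real.exp_lt_one_iff.2 (by norm_num)⟩ hL (le_max_left _ _)
    (fun κ hκ => ?_) (fun α _ κ _ => ?_) (fun κ hκ => h_heat κ hκ.1 (h_log hκ))
    (fun α hα κ hκ T R hT hR hTR hu => ?_)
  · rw [one_le_div (by linarith [h_log hκ])]
    linarith [Real.log_le_sub_one_of_pos (inv_pos.2 hκ.1)]
  · rw [hβ_def]
    ring_nf
  · have hκ_pos := hκ.1
    have hR_pos : 0 < R := by linarith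
    have h_log_R : 0 < Real.log R := Real.log_pos hR
    have h_bound := h_sol α hα κ T R _ hκ_pos hT hR_pos hTR (by positivity) (h_mass R hR.le) hu
    rw [show 2 / (p - 1) - (N : ℝ) = 2 * β by rw [hβ_def]; ring] at h_bound
    refine le_mul_div_log_of_mul_log_le
      (by linarith [h_log hκ, Real.log_le_sub_one_of_pos (inv_pos.2 hκ_pos)]) ?_
    calc R ^ (2 * β) * Real.log (R ^ (2 * β))
        = 2 * β / c * (κ * (c * Real.log R) * R ^ (2 * β)) * κ⁻¹ := by
          rw [Real.log_rpow hR_pos]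
          field_simp
      _ ≤ 2 * β / c * C * κ⁻¹ := by gcongr
      _ = _ := by ring

theorem sub_min_div_two_pos (hN : 1 ≤ N) {p A : ℝ} (hp : 1 < p)
    (h : p < 1 + 2 / (N : ℝ) ∨ A < 2 / (p - 1)) : 0 < 1 / (p - 1) - min A N / 2 := by
  have hN_pos : (0 : ℝ) < N := by exact_mod_cast hN
  have hp_sub : 0 < p - 1 := sub_pos.2 hp
  suffices h_min : min A (N : ℝ) < 2 / (p - 1) by
    rw [show 1 / (p - 1) - min A (N : ℝ) / 2 = (2 / (p - 1) - min A N) / 2 by ring]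
    linarith
  rcases h with hpN | hAp
  · exact (min_le_right _ _).trans_lt ((lt_div_comm₀ hN_pos hp_sub).2 (by linarith))
  · exact (min_le_left _ _).trans_lt hAp

end

end TimeFractional

theorem mainTheorem11 (N : ℕ) (hN : 1 ≤ N) (p A : ℝ) (hp : 1 < p) (hA : 0 < A)
    (h : p < 1 + 2 / (N : ℝ) ∨ A < 2 / (p - 1)) :
    (A ≠ N → TimeFractional.SimeqSmall
      (fun α κ => TimeFractional.lifespan α p (TimeFractional.decayData N A κ))
      (fun α κ => κ ^ (-(α / (p - 1) - α / 2 * min A N)⁻¹))) ∧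
    (A = N → TimeFractional.SimeqSmall
      (fun α κ => TimeFractional.lifespan α p (TimeFractional.decayData N A κ))
      (fun α κ => (κ⁻¹ / Real.log κ⁻¹) ^ (α / (p - 1) - α * N / 2)⁻¹)) := by
  have hβ := TimeFractional.sub_min_div_two_pos hN hp h
  refine ⟨fun hAN => TimeFractional.simeqSmall_lifespan_of_ne hN hp hA hAN hβ, ?_⟩
  rintro rfl
  rw [min_self] at hβ
  exact TimeFractional.simeqSmall_lifespan_of_eq hN hp hβ
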